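/- **Theorem (Correctness of Glue).** Let $2\le \ell$, $\ell+2\le m$, let $c_1,\dots,c_m$ be distinct reals, and let $0<\varepsilon<|c_i-c_j|$ for all $i\neq j$. For a list $c_s,\dots,c_t$ with $t > s$, its map is the piecewise linear map on $[s-1,t+1]$ with value $c_i$ at each item $i$ and with the hooks $c_s+\varepsilon\,\mathrm{sign}(c_{s+1}-c_s)$ at $s-1$ and $c_t+\varepsilon\,\mathrm{sign}(c_{t-1}-c_t)$ at $t+1$. Let $g$, $h$ and $f=g\cdot h$ be the maps of $c_1,\dots,c_\ell$, of $c_{\ell+1},\dots,c_m$, and of $c_1,\dots,c_m$. *Up-tree.* The homological critical points of such a map are its minima (a hook counts if it is a local minimum at its end of the domain) and its interior maxima. Take the unique full binary tree whose in-order sequence is the sequence of critical points from left to right and in which values increase from leaf to root, and put a special root $\beta$, larger in value than all other nodes, above its root. Each minimum $a$ spans a *banana* with the nearest ancestor $b=\mathrm{Dth}(a)$ in whose subtree $a$ does not have the smallest value ($b=\beta$ if there is none); the nodes strictly between them on the path from $a$ to $b$ form the left trail (those to the left of $a$) and the right trail (those to the right of $a$), both ordered by value. The bananas are the up-tree $\mathrm{Up}(\cdot)$.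 Write $\mathrm{Birth}(b)=a$, and $\mathrm{Low}(u)=a$ for each interior node $u$ of the two trails; $\mathrm{Low}(\beta)=\mathrm{nil}$. If $a<b$, the left trail is the in-trail and the right trail the mid-trail; if $a>b$ it is the other way round. The left (right) spine consists of $\beta$ and the topmost interior node of each left (right) trail whose upper end is in the spine. For gluing, $\beta_g$ lies at $-\infty$ and $\beta_h$ at $+\infty$ along the interval, and $f(\mathrm{nil})=-\infty$, $f(\beta_h)<f(\beta_g)$. *Algorithm Glue.* Pre-processing, for $c_\ell<c_{\ell+1}$ (the other case is the mirror image): if $c_{\ell-1}<c_\ell$, remove $\ell$ and the hook paired with it from $\mathrm{Up}(g)$; in $\mathrm{Up}(h)$, replace by a dummy leaf $\alpha$ the hook paired with $\ell+1$ if $c_{\ell+2}<c_{\ell+1}$, and the leaf $\ell+1$ otherwise ($\alpha$ takes over its value). Let $q$ be $\mathrm{Dth}$ of the rightmost minimum of the left tree and $q'=\mathrm{Dth}(\alpha)$ in the right tree. Repeat the following, described for $f(q)<f(q')$ (if $f(q)>f(q')$, do the mirror image with the roles of $q,q'$ exchanged). Let $\mu=\mathrm{Low}(q)$, and let $\kappa=\mathrm{Birth}(q)$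 if this is not $\alpha$, and $\kappa=\mathrm{Birth}(q')$ otherwise. 1. If $f(\kappa)>f(\mu)$ and $\kappa=\mathrm{Birth}(q)$, *undo an injury*: move the nodes of value less than $f(q)$ from the mid-trail of $\alpha$ to the upper end of the in-trail between $\kappa$ and $q$. 2. If $f(\kappa)>f(\mu)$ and $\kappa=\mathrm{Birth}(q')$, *undo a fatality*: exchange $\alpha$ (paired with $q$) and $\kappa$ (paired with $q'$). The former in-trail of $\kappa$ extends the mid-trail of $q$ at its lower end, the nodes of value less than $f(q)$ on the former mid-trail of $\kappa$ extend the in-trail of $q$, and $\alpha$, now paired with $q'$, keeps the rest of that mid-trail and an empty in-trail. 3. If $f(\mu)>f(\kappa)$, *undo a scare*: set $f(\alpha)=f(\mu)-\varepsilon$ and interchange the minima $\alpha$ and $\mu$, that is, split both trails of $\mu$ at the value $f(q)$; the lower parts become the trails between $\mu$ and $q$, and the upper parts are put on top of the trails of $\alpha$, with $q$ in between on the side opposite to the trail of $\mu$ that contained $q$, so that $\alpha$ is now paired with the former $\mathrm{Dth}(\mu)$. Moved nodes take the bananas below them along. Then replace $q$ by $\mathrm{Dth}(\mathrm{Low}(q))$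 (it stays if $\mathrm{Low}(q)=\mathrm{nil}$). Stop after the first iteration after which one of the two trees consists only of its special root and $\alpha$, and discard these two nodes. *Claim.* Applied to $\mathrm{Up}(g)$ and $\mathrm{Up}(h)$, Glue terminates, and in every iteration one of the three cases applies and all pointers it needs exist. In every iteration $q$ is on the right spine of the left tree and $q'$ on the left spine of the right tree, both for the current trees and for the pre-processed trees with which the loop starts. The loop stops when one of the trees is reduced to its special root and the dummy leaf, and the remaining tree is the up-tree $\mathrm{Up}(g\cdot h)$ (with the remaining special root). -/

import Mathlib

noncomputable section

namespace BananaTree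

/-! ### Lists viewed as maps

A list `c s, c (s+1), …, c t` of at least two distinct values gives the piecewise linear map on
`[s-1, t+1]` whose values at the integers are `hookedMap c s t ε`. -/

/-- The values at the integers of the piecewise linear map of the list `c s, …, c t`; the two
artificial ends `s-1` and `t+1` are the hooks. -/
def hookedMap (c : ℕ → ℝ) (s t : ℕ) (ε : ℝ) (i : ℕ) : ℝ :=
  if i < s then c s + ε * (SignType.sign (c (s + 1) - c s) : ℝ)
  else if t < i then c t + ε * (SignType.sign (c (t - 1) - c t) : ℝ)
  else c i

/-- `i` is a minimum of a map `f` on `[s-1, t+1]`; this includes up-type endpoints. -/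
def IsMinAt (f : ℕ → ℝ) (s t i : ℕ) : Prop :=
  (s ≤ i → f i < f (i - 1)) ∧ (i ≤ t → f i < f (i + 1))

/-- `i` is a maximum in the interior of the domain `[s-1, t+1]` of `f`. -/
def IsMaxAt (f : ℕ → ℝ) (s t i : ℕ) : Prop :=
  s ≤ i ∧ i ≤ t ∧ f (i - 1) < f i ∧ f (i + 1) < f i

instance (f : ℕ → ℝ) (s t i : ℕ) : Decidable (IsMinAt f s t i) := by
  unfold IsMinAt; infer_instance

instance (f : ℕ → ℝ) (s t i : ℕ) : Decidable (IsMaxAt f s t i) := by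
  unfold IsMaxAt; infer_instance

/-- The two sides; also used to name the left tree (that of `g`) and the right tree (that of `h`). -/
inductive Side : Type
  | left
  | right
  deriving DecidableEq

/-- The opposite side. -/
def Side.opp : Side → Side
  | .left => .right
  | .right => .left

/-- The nodes of banana trees: items, hooks (both given by their integer position), the dummy
leaf `α`, and the special roots `β_g = root left` and `β_h = root right`. -/
inductive Node : Type
  | item (i : ℕ)
  | hook (i : ℕ)
  | dummy
  | root (s : Side)
  deriving DecidableEq

/-- The value of a map at a node that is an item or a hook. -/
def nodeValue (f : ℕ → ℝ) : Node → ℝ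
  | .item i => f i
  | .hook i => f i
  | _ => 0

/-- The node at the integer position `i` of the domain `[s-1, t+1]`. -/
def point (s t i : ℕ) : Node := if s ≤ i ∧ i ≤ t then .item i else .hook i

/-- The homological critical points `a₀ < b₁ < a₁ < … < bₙ < aₙ` of the map of the list
`c s, …, c t`, from left to right: minima (including up-type hooks) and maxima alternate. -/
def criticals (c : ℕ → ℝ) (s t : ℕ) (ε : ℝ) : List Node :=
  ((List.range' (s - 1) (t + 3 - s)).filter fun i =>
    IsMinAt (hookedMap c s t ε) s t i ∨ IsMaxAt (hookedMap c s t ε) s t i).map (point s t)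

/-! ### First step: the full binary tree -/

/-- Full binary trees whose leaves are minima and whose internal nodes are maxima. -/
inductive BinTree : Type
  | leaf (a : Node)
  | node (l : BinTree) (b : Node) (r : BinTree)

namespace BinTree

/-- The in-order sequence of the nodes. -/
def inorder : BinTree → List Node
  | leaf a => [a]
  | node l b r => l.inorder ++ b :: r.inorder

/-- The node at the top. -/
def top : BinTree → Node
  | leaf a => a
  | node _ b _ => b

/-- The values increase along every path from a leaf to the root. -/
def HeapOrdered (v : Node → ℝ) : BinTree → Prop
  | leaf _ => True
  | node l b r => v l.top < v b ∧ v r.top < v b ∧ l.HeapOrdered v ∧ r.HeapOrdered v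

/-- The rightmost leaf. -/
def lastLeaf : BinTree → Node
  | leaf a => a
  | node _ _ r => r.lastLeaf

/-- Add a maximum `b` and a minimum `a`, in this order, to the right of all nodes of the tree. -/
def addRight (v : Node → ℝ) (b a : Node) : BinTree → BinTree
  | leaf x => node (leaf x) b (leaf a)
  | node l b' r =>
      if v b < v b' then node l b' (addRight v b a r) else node (node l b' r) b (leaf a)

/-- Add alternating maxima and minima from left to right. -/
def addAll (v : Node → ℝ) : BinTree → List Node → BinTree
  | T, b :: a :: rest => addAll v (addRight v b a T) rest
  | T, _ => T

theorem inorder_addRight (v : Node → ℝ) (b a : Node) (T : BinTree) :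
    (addRight v b a T).inorder = T.inorder ++ [b, a] := by
  induction T with
  | leaf x => rfl
  | node l b' r _ ihr =>
    unfold addRight
    split_ifs
    · simp [inorder, ihr]
    · simp [inorder]

theorem heapOrdered_addRight (v : Node → ℝ) (b a : Node) (T : BinTree) (hT : T.HeapOrdered v)
    (hlast : v T.lastLeaf < v b) (ha : v a < v b) (hne : ∀ x ∈ T.inorder, v x ≠ v b) :
    (addRight v b a T).HeapOrdered v := by
  induction T with
  | leaf x => exact ⟨hlast, ha, trivial, trivial⟩
  | node l b' r _ ihr =>
    obtain ⟨h1, h2, h3, h4⟩ := hT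
    unfold addRight
    split_ifs with h
    · refine ⟨h1, ?_, h3, ihr h4 hlast fun x hx => hne x (by simp [inorder, hx])⟩
      cases r with
      | leaf y => exact h
      | node l2 b2 r2 =>
        unfold addRight
        split_ifs
        · exact h2
        · exact h
    · have := hne b' (by simp [inorder])
      exact ⟨lt_of_le_of_ne (not_lt.mp h) this, ha, ⟨h1, h2, h3, h4⟩, trivial⟩

end BinTree

/-- The full binary tree on an alternating sequence of minima and maxima that is determined by:
its in-order sequence is the given one, and values increase from the leaves to the root. -/
def binaryTree (v : Node → ℝ) : List Node → BinTree
  | [] => .leaf .dummy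
  | a :: rest => BinTree.addAll v (.leaf a) rest

/-! ### Second and third step: paths and trails -/

/-- A banana: its lower end (a minimum), its upper end (a maximum or a special root), and the
interior nodes of its left and its right trail, each listed from bottom to top. If the lower end
is to the left of the upper end, then the in-trail is the left and the mid-trail the right trail;
otherwise the in-trail is the right and the mid-trail the left trail. -/
@[ext]
structure Banana : Type where
  lower : Node
  upper : Node
  trail : Side → List Node

/-- The part inside a subtree of the path that starts at the leaf `lower`, split into trails. -/
structure OpenPath : Type where
  lower : Node
  trail : Side → List Node

/-- Add a new top node to one of the two trails. -/
def OpenPath.extend (P : OpenPath) (d : Side) (b : Node) : OpenPath :=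
  ⟨P.lower, fun d' => if d' = d then P.trail d' ++ [b] else P.trail d'⟩

/-- End the path at the upper end `b`. -/
def OpenPath.close (P : OpenPath) (b : Node) : Banana := ⟨P.lower, b, P.trail⟩

/-- Decompose a binary tree into paths, where the path of a leaf ends at the nearest ancestor in
whose subtree the leaf is not the smallest. The first component is the path of the smallest leaf,
which is still open at the root. An interior node `b` of a path is on the left trail if the path
comes from its right child, and on the right trail if the path comes from its left child. -/
def decompose (v : Node → ℝ) : BinTree → OpenPath × List Banana
  | .leaf a => (⟨a, fun _ => []⟩, [])
  | .node l b r =>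
      let L := decompose v l
      let R := decompose v r
      if v L.1.lower < v R.1.lower then
        (L.1.extend .right b, R.1.close b :: (L.2 ++ R.2))
      else
        (R.1.extend .left b, L.1.close b :: (L.2 ++ R.2))

/-- The up-tree of the map of the list `c s, …, c t` with special root `β`, given by its bananas.
The order in which the bananas are listed is irrelevant. -/
def upTree (c : ℕ → ℝ) (s t : ℕ) (ε : ℝ) (β : Node) : List Banana :=
  let v := nodeValue (hookedMap c s t ε)
  let D := decompose v (binaryTree v (criticals c s t ε))
  D.1.close β :: D.2

/-! ### Pointers and spines

A list of bananas may hold several trees; a tree consists of the bananas that can be reached from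
its special root. -/

/-- The banana with lower end `a`. -/
def bananaAt (S : List Banana) (a : Node) : Option Banana := S.find? fun B => B.lower = a

/-- The pointer `Dth` from a lower end to the upper end of its banana. -/
def dth (S : List Banana) (a : Node) : Option Node := (bananaAt S a).map Banana.upper

/-- The pointer `Birth` from an upper end to the lower end of its banana. -/
def birth (S : List Banana) (b : Node) : Option Node :=
  (S.find? fun B => B.upper = b).map Banana.lower

/-- The pointer `Low` from a node of a banana other than its upper end to its lower end; it is nil
for special roots. -/
def low (S : List Banana) (p : Node) : Option Node :=
  (S.find? fun B => p = B.lower ∨ p ∈ B.trail .left ∨ p ∈ B.trail .right).map Banana.lower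

/-- The first node below the upper end `b` on the trail of its banana on side `d`. Thus
`below S b left` and `below S b right` are, in some order, the pointers `In` and `Mid` of `b`. -/
def below (S : List Banana) (b : Node) (d : Side) : Option Node :=
  (S.find? fun B => B.upper = b).map fun B => ((B.trail d).getLast?).getD B.lower

/-- The spine on side `d` of the tree with special root `β`: it contains `β` and the topmost
interior node of every trail on side `d` whose upper end it contains. -/
inductive InSpine (S : List Banana) (β : Node) (d : Side) : Node → Prop
  | root : InSpine S β d β
  | next {B : Banana} {u : Node} : B ∈ S → InSpine S β d B.upper →
      (B.trail d).getLast? = some u → InSpine S β d u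

/-- Replace the banana with lower end `a`. -/
def modify (S : List Banana) (a : Node) (φ : Banana → Banana) : List Banana :=
  S.map fun B => if B.lower = a then φ B else B

/-- The pair of trails with `x` on side `d` and `y` on the other side. -/
def trails (d : Side) (x y : List Node) : Side → List Node := fun d' => if d' = d then x else y

/-! ### The algorithm -/

/-- The data on which gluing works: the bananas of the left and the right tree, the current value
of the dummy leaf, and the current maxima `q` (in the left tree) and `q'` (in the right tree). -/
@[ext]
structure GlueState : Type where
  bananas : List Banana
  alpha : ℝ
  cur : Side → Node

/-- The value of a node or of nil, with the conventions
`f(nil) = -∞ < (values of items, hooks and the dummy leaf) < f(β_h) < f(β_g)`. -/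
def height (f : ℕ → ℝ) (alpha : ℝ) : Option Node → ℤ ×ₗ ℝ
  | none => toLex (-1, 0)
  | some (.item i) => toLex (0, f i)
  | some (.hook i) => toLex (0, f i)
  | some .dummy => toLex (0, alpha)
  | some (.root .right) => toLex (1, 0)
  | some (.root .left) => toLex (2, 0)

/-- `f(u) < f(w)` for nodes, in a given state. -/
def GlueState.Below (f : ℕ → ℝ) (σ : GlueState) (u w : Option Node) : Prop :=
  height f σ.alpha u < height f σ.alpha w

instance (f : ℕ → ℝ) (σ : GlueState) (u w : Option Node) : Decidable (σ.Below f u w) := by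
  unfold GlueState.Below; infer_instance

/-- Undo an injury of the banana spanned by `κ` and `q` in tree `s`. In tree `s`, the node `q` is
on the spine that faces the other tree, so the in-trail of `κ` is on side `s.opp`; in the other
tree, the mid-trail of the dummy leaf is also on side `s.opp`. The nodes with value less than that
of `q` are removed from the mid-trail of the dummy leaf and inserted at the upper end of the
in-trail between `κ` and `q`. -/
def undoInjury (f : ℕ → ℝ) (σ : GlueState) (s : Side) (κ q : Node) : Option GlueState := do
  let A ← bananaAt σ.bananas .dummy
  let K ← bananaAt σ.bananas κ
  let t := s.opp
  let moved := (A.trail t).filter fun j => σ.Below f (some j) (some q)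
  let rest := (A.trail t).filter fun j => ¬ σ.Below f (some j) (some q)
  let S₁ := modify σ.bananas .dummy fun _ => ⟨.dummy, A.upper, trails t rest (A.trail s)⟩
  let S₂ := modify S₁ κ fun _ => ⟨κ, K.upper, trails t (K.trail t ++ moved) (K.trail s)⟩
  return { σ with bananas := S₂ }

/-- Undo a fatality of the banana spanned by `κ` and `q`, where `q` is in tree `s` and spans a
banana with the dummy leaf, while `κ` spans a banana with `q'` in the other tree, with in-trail on
side `s` and mid-trail on side `s.opp`. The lower end `κ`, the nodes of its in-trail, and the nodes
with value less than that of `q` of its mid-trail are exchanged with the dummy leaf: the former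
in-trail extends the mid-trail of `q` (on side `s`) at its lower end, the nodes from the mid-trail
extend the in-trail of `q` (on side `s.opp`), and the dummy leaf is left with `q'`, an empty
in-trail, and the rest of the mid-trail. -/
def undoFatality (f : ℕ → ℝ) (σ : GlueState) (s : Side) (κ q : Node) : Option GlueState := do
  let A ← bananaAt σ.bananas .dummy
  let K ← bananaAt σ.bananas κ
  let t := s.opp
  let moved := (K.trail t).filter fun j => σ.Below f (some j) (some q)
  let rest := (K.trail t).filter fun j => ¬ σ.Below f (some j) (some q)
  let S₁ := modify σ.bananas .dummy fun _ => ⟨.dummy, K.upper, trails t rest []⟩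
  let S₂ := modify S₁ κ fun _ =>
    ⟨κ, A.upper, trails t (A.trail t ++ moved) (K.trail s ++ A.trail s)⟩
  return { σ with bananas := S₂ }

/-- The interchange of minima `i` and `p`, which is structural if `j = Dth i` is interior to a
trail, on side `d`, of the banana spanned by `p` and its upper end. Both trails of `p` are split
at the value of `j`; the upper parts are put on top of the trails of `i`, with `j` in between on
the side other than `d`, and the lower parts become the trails between `p` and `j`. -/
def interchangeMinima (f : ℕ → ℝ) (σ : GlueState) (i p : Node) : Option GlueState := do
  let I ← bananaAt σ.bananas i
  let P ← bananaAt σ.bananas p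
  let j := I.upper
  if j ∈ P.trail .left ∨ j ∈ P.trail .right then
    let d : Side := if j ∈ P.trail .left then .left else .right
    let lo : Side → List Node := fun e =>
      (P.trail e).filter fun u => σ.Below f (some u) (some j)
    let up : Side → List Node := fun e =>
      (P.trail e).filter fun u => σ.Below f (some j) (some u)
    let S₁ := modify σ.bananas i fun _ =>
      ⟨i, P.upper, trails d (I.trail d ++ up d) (I.trail d.opp ++ j :: up d.opp)⟩
    let S₂ := modify S₁ p fun _ => ⟨p, j, lo⟩
    return { σ with bananas := S₂ }
  else
    return σ

/-- Undo a scare: lower the value of the dummy leaf to just below that of the minimum `μ`, and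
interchange the two minima. -/
def undoScare (f : ℕ → ℝ) (ε : ℝ) (σ : GlueState) (μ : Node) : Option GlueState :=
  interchangeMinima f { σ with alpha := nodeValue f μ - ε } .dummy μ

/-- One iteration of the loop. With `q` the lower of the two current maxima and `q'` the other,
the candidate minima are `μ = Low q` and `κ = Birth q`, or `κ = Birth q'` if `Birth q` is the dummy
leaf. Afterwards `q` is replaced by `Dth (Low q)`. The value is `none` if a pointer that is needed
does not exist or if none of the three cases applies. -/
def glueStep (f : ℕ → ℝ) (ε : ℝ) (σ : GlueState) : Option GlueState := do
  let s : Side := if σ.Below f (some (σ.cur .left)) (some (σ.cur .right)) then .left else .right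
  let q := σ.cur s
  let q' := σ.cur s.opp
  let μ := low σ.bananas q
  let a ← birth σ.bananas q
  let a' ← birth σ.bananas q'
  let κ := if a ≠ .dummy then a else a'
  let τ ←
    if σ.Below f μ (some κ) ∧ κ = a then undoInjury f σ s κ q
    else if σ.Below f μ (some κ) ∧ κ = a' then undoFatality f σ s κ q
    else if σ.Below f (some κ) μ then μ.bind (undoScare f ε σ)
    else none
  let qnext := ((low τ.bananas q).bind (dth τ.bananas)).getD q
  return { τ with cur := fun d => if d = s then qnext else σ.cur d }

/-- Tree `s` consists only of its special root and the dummy leaf. -/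
def GlueState.Empty (σ : GlueState) (s : Side) : Prop :=
  below σ.bananas (.root s) .left = some .dummy ∧ below σ.bananas (.root s) .right = some .dummy

instance (σ : GlueState) (s : Side) : Decidable (σ.Empty s) := by
  unfold GlueState.Empty; infer_instance

/-- The tree whose special root is not discarded after the loop. -/
def GlueState.survivor (σ : GlueState) : Side := if σ.Empty .left then .right else .left

/-- The bananas that remain after the loop, when the special root of the empty tree and the dummy
leaf are discarded. -/
def GlueState.result (σ : GlueState) : List Banana :=
  σ.bananas.filter fun B => B.lower ≠ .dummy ∧ B.upper ≠ .root σ.survivor.opp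

/-! ### Pre-processing

The list `c 1, …, c m` is the concatenation of `c 1, …, c ℓ` and `c (ℓ+1), …, c m`. In the
following, `s` names one of the two parts. -/

/-- The first item of the part. -/
def firstItem (ℓ : ℕ) : Side → ℕ
  | .left => 1
  | .right => ℓ + 1

/-- The last item of the part. -/
def lastItem (ℓ m : ℕ) : Side → ℕ
  | .left => ℓ
  | .right => m

/-- The item of the part at which the parts are connected. -/
def endItem (ℓ : ℕ) : Side → ℕ
  | .left => ℓ
  | .right => ℓ + 1

/-- The position of the hook next to the end item. -/
def endHook (ℓ : ℕ) : Side → ℕ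
  | .left => ℓ + 1
  | .right => ℓ

/-- The end item is down-type, that is, its neighbor in the part has smaller value. -/
def IsDownType (c : ℕ → ℝ) (ℓ : ℕ) : Side → Prop
  | .left => c (ℓ - 1) < c ℓ
  | .right => c (ℓ + 2) < c (ℓ + 1)

instance (c : ℕ → ℝ) (ℓ : ℕ) (s : Side) : Decidable (IsDownType c ℓ s) := by
  cases s <;> unfold IsDownType <;> infer_instance

/-- The minimum of the part, among its items, that is closest to the connection. -/
def closestMin (c : ℕ → ℝ) (ℓ m : ℕ) (ε : ℝ) (s : Side) : Option ℕ :=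
  let x := firstItem ℓ s
  let y := lastItem ℓ m s
  let mins := (List.range' x (y + 1 - x)).filter fun i => IsMinAt (hookedMap c x y ε) x y i
  match s with
  | .left => mins.getLast?
  | .right => mins.head?

/-- The part whose end item has the smaller value. -/
def lowerPart (c : ℕ → ℝ) (ℓ : ℕ) : Side := if c ℓ < c (ℓ + 1) then .left else .right

/-- Pre-processing of the tree `T` of the part with the lower end item: a down-type end item becomes
non-critical and is removed together with its hook. -/
def prepareLower (c : ℕ → ℝ) (ℓ : ℕ) (s : Side) (T : List Banana) : List Banana :=
  if IsDownType c ℓ s then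
    (T.filter fun B => B.lower ≠ .hook (endHook ℓ s)).map fun B =>
      { B with trail := fun d => (B.trail d).filter fun u => u ≠ .item (endItem ℓ s) }
  else T

/-- The leaf of the tree of the part with the higher end item that is replaced by the dummy leaf:
the hook of a down-type end item, and an up-type end item (which becomes non-critical) itself. -/
def dummyLeaf (c : ℕ → ℝ) (ℓ : ℕ) (s : Side) : Node :=
  if IsDownType c ℓ s then .hook (endHook ℓ s) else .item (endItem ℓ s)

/-- The state before the first iteration: the two trees are pre-processed, the dummy leaf takes
over the value of the leaf that it replaces, and the current maxima are the upper ends of the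
bananas of the minimum `a₀` closest to the connection in the lower part and of the dummy leaf in
the higher part. -/
def glueInit (c : ℕ → ℝ) (ℓ m : ℕ) (ε : ℝ) (T : Side → List Banana) : Option GlueState := do
  let s := lowerPart c ℓ
  let t := s.opp
  let x := dummyLeaf c ℓ t
  let S := prepareLower c ℓ s (T s) ++ modify (T t) x fun B => { B with lower := .dummy }
  let a₀ ← closestMin c ℓ m ε s
  let b₀ ← dth S (.item a₀)
  let b₀' ← dth S .dummy
  return {
    bananas := S
    alpha := nodeValue (hookedMap c (firstItem ℓ t) (lastItem ℓ m t) ε) x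
    cur := fun d => if d = s then b₀ else b₀' }

/-- A complete run of `Glue` with `N` iterations, applied to the trees `T left` and `T right`: the
loop body is executed at least once and repeated until one of the two trees is empty. -/
structure IsGlueRun (c : ℕ → ℝ) (ℓ m : ℕ) (ε : ℝ) (T : Side → List Banana) (N : ℕ)
    (run : ℕ → GlueState) : Prop where
  init : glueInit c ℓ m ε T = some (run 0)
  pos : 0 < N
  step : ∀ i < N, glueStep (hookedMap c 1 m ε) ε (run i) = some (run (i + 1))
  continues : ∀ i, 0 < i → i < N → ∀ s, ¬ (run i).Empty s
  stops : ∃ s, (run N).Empty s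

end BananaTree

end

noncomputable section

namespace BananaTree

/-! Cut a heap-ordered tree along the spine that descends to the connection: it becomes a leaf on
which entries are stacked (`build`), each entry being a spine maximum together with the subtree on
its outer side. Let `k` be the minimum of the lower part closest to the connection, and let `W` give
the entry lists of the two pre-processed trees. A heap-ordered tree is determined by its in-order
sequence (`BinTree.HeapOrdered.unique`), and the in-order sequence of a stack depends only on its
leaf and on its two one-sided sublists (`inorder_build_eq`, `outer_filter`). Hence the binary tree
of the concatenated list is `build (.leaf k) U`, where `U` merges the two lists by increasing value
of the maxima. The innermost leaf of the higher tree disappears; the dummy leaf holds its place in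
the meantime.

The up-tree of a stack is computed by a fold from bottom to top (`deco_build`). The path from the
smallest leaf so far passes an entry if all leaves of the hanging subtree are larger; otherwise it
ends there, and the path from the smallest leaf of that subtree takes over. Therefore the bananas
above such an end (`rest`) do not depend on anything below it (`foldl_step_append_close`).

Gluing is thus a merge of two sorted lists, carried out on bananas. The invariant `Stage` says: one
tree contains the finished merge `build (.leaf k) U`, the core, whose open path passes `A` and ends
at the first maximum of `TA`; in the other tree the path of the dummy leaf passes `B` and ends at
the first maximum of `TB`; and the bananas above these two ends are still those of the pre-processed
trees. Let `q` be the lower one of the two ends. If the core path ends at `q`, the part of `B` below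
`q` must be merged into it: an injury (`Stage.undoInjury_eq`). If the dummy path ends at `q` and the
subtree at `q` has a leaf below the minimum of the core, then the core path must end at `q` as well,
so the core changes trees: a fatality (`Stage.undoFatality_eq`). If that subtree has only larger
leaves, the core path will pass `q`, and the dummy path is made to pass it: a scare
(`Stage.undoScare_eq`). After an injury or a fatality at an ordinary maximum, `q` and its subtree
join the core (`Stage.advance`).

Every iteration shortens `TA` or `TB`, except when `q` is a special root, and then it leaves an
empty tree (`GlueInv.step`). Once a tree is empty, `B` and `TB` are empty and `U ++ (A ++ TA)` is
the complete merge (`GlueInv.result_eq`).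

Pointers cause no ambiguity, because every node lies in exactly one banana other than as its upper
end and is the upper end of at most one (`Stage.feet_eq`, `Stage.upper_nodup`). This allows lists of
bananas to be treated as multisets. -/

@[simp] theorem Side.opp_opp (s : Side) : s.opp.opp = s := by cases s <;> rfl

@[simp] theorem Side.opp_ne (s : Side) : s.opp ≠ s := by cases s <;> decide

@[simp] theorem Side.ne_opp (s : Side) : s ≠ s.opp := by cases s <;> decide

theorem Side.eq_or_eq_opp (s d : Side) : d = s ∨ d = s.opp := by
  cases s <;> cases d <;> simp [Side.opp]

/-! ### Trees along a spine -/

/-- A maximum on a spine together with the subtree that hangs off the spine on side `side`. -/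
structure Entry : Type where
  side : Side
  node : Node
  tree : BinTree

/-- The tree with root `b`, the subtree `O` on side `s` and the subtree `I` on the other side. -/
def BinTree.join (s : Side) (O : BinTree) (b : Node) (I : BinTree) : BinTree :=
  match s with
  | .left => .node O b I
  | .right => .node I b O

/-- Put the entries on top of a tree, one after the other. -/
def build (T : BinTree) (W : List Entry) : BinTree :=
  W.foldl (fun I e => .join e.side e.tree e.node I) T

theorem build_append (T : BinTree) (W W' : List Entry) :
    build T (W ++ W') = build (build T W) W' := by simp [build]

theorem build_concat (T : BinTree) (W : List Entry) (e : Entry) :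
    build T (W ++ [e]) = .join e.side e.tree e.node (build T W) := by simp [build]

/-- All nodes of a list of entries. -/
def nodes (W : List Entry) : Multiset Node :=
  (W.map fun e => e.node ::ₘ (e.tree.inorder : Multiset Node)).sum

@[simp] theorem nodes_nil : nodes [] = 0 := rfl

@[simp] theorem nodes_cons (e : Entry) (W : List Entry) :
    nodes (e :: W) = e.node ::ₘ ((e.tree.inorder : Multiset Node) + nodes W) := by
  rw [nodes, List.map_cons, List.sum_cons, Multiset.cons_add]; rfl

@[simp] theorem nodes_append (W W' : List Entry) : nodes (W ++ W') = nodes W + nodes W' := by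
  simp [nodes]

theorem nodes_perm {W W' : List Entry} (h : W.Perm W') : nodes W = nodes W' :=
  (h.map _).sum_eq

theorem mem_nodes {W : List Entry} {x : Node} :
    x ∈ nodes W ↔ ∃ e ∈ W, x = e.node ∨ x ∈ e.tree.inorder := by
  induction W with
  | nil => simp
  | cons e W ih => simp [ih, or_assoc]

theorem inorder_join (s : Side) (O : BinTree) (b : Node) (I : BinTree) :
    ((BinTree.join s O b I).inorder : Multiset Node) =
      b ::ₘ ((O.inorder : Multiset Node) + (I.inorder : Multiset Node)) := by
  cases s <;> simp only [BinTree.join, BinTree.inorder, ← Multiset.coe_add, ← Multiset.cons_coe,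
    Multiset.add_cons]
  rw [add_comm]

theorem inorder_build (T : BinTree) (W : List Entry) :
    ((build T W).inorder : Multiset Node) = (T.inorder : Multiset Node) + nodes W := by
  induction W generalizing T with
  | nil => simp [build]
  | cons e W ih =>
    have : build T (e :: W) = build (.join e.side e.tree e.node T) W := rfl
    rw [this, ih, inorder_join, nodes_cons]
    simp only [Multiset.cons_add, Multiset.add_cons]
    congr 1
    abel

/-! ### Decompositions as multisets -/

/-- An open path together with a multiset of bananas. -/
abbrev Deco := OpenPath × Multiset Banana

/-- The decomposition of a tree, where the order of the bananas is forgotten. -/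
def deco (v : Node → ℝ) (T : BinTree) : Deco :=
  ((decompose v T).1, ((decompose v T).2 : Multiset Banana))

/-- The smallest leaf. -/
def BinTree.minLeaf (v : Node → ℝ) (T : BinTree) : Node := (deco v T).1.lower

/-- The open path ends at the new maximum. -/
def Deco.turn (v : Node → ℝ) (X : Deco) (e : Entry) : Deco :=
  ((deco v e.tree).1.extend e.side.opp e.node,
    X.1.close e.node ::ₘ ((deco v e.tree).2 + X.2))

/-- The open path continues past the new maximum. -/
def Deco.pass (v : Node → ℝ) (X : Deco) (e : Entry) : Deco :=
  (X.1.extend e.side e.node, (deco v e.tree).1.close e.node ::ₘ ((deco v e.tree).2 + X.2))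

/-- The effect of a new entry on a decomposition. -/
def Deco.step (v : Node → ℝ) (X : Deco) (e : Entry) : Deco :=
  if v (e.tree.minLeaf v) < v X.1.lower then X.turn v e else X.pass v e

/-- A tie would be decided by `decompose` in favour of the right subtree, which is not symmetric
under reflection; with distinct minima both sides obey the same rule. -/
theorem deco_join (v : Node → ℝ) (e : Entry) (I : BinTree)
    (h : v (e.tree.minLeaf v) ≠ v (I.minLeaf v)) :
    deco v (.join e.side e.tree e.node I) = (deco v I).step v e := by
  obtain ⟨s, b, O⟩ := e
  rcases lt_or_gt_of_ne h with h' | h'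
  · refine Eq.trans ?_ (if_pos h').symm
    simp only [BinTree.minLeaf, deco] at h'
    cases s
    · simp [BinTree.join, deco, decompose, Deco.turn, Side.opp, if_pos h']
    · simp [BinTree.join, deco, decompose, Deco.turn, Side.opp, if_neg h'.not_gt,
        ← Multiset.coe_add, ← Multiset.cons_coe, add_comm]
  · refine Eq.trans ?_ (if_neg h'.not_gt).symm
    simp only [BinTree.minLeaf, deco] at h'
    cases s
    · simp [BinTree.join, deco, decompose, Deco.pass, if_neg h'.not_gt]
    · simp [BinTree.join, deco, decompose, Deco.pass, if_pos h',
        ← Multiset.coe_add, ← Multiset.cons_coe, add_comm]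

theorem minLeaf_mem (v : Node → ℝ) (T : BinTree) : T.minLeaf v ∈ T.inorder := by
  induction T with
  | leaf a => simp [BinTree.minLeaf, deco, decompose, BinTree.inorder]
  | node l b r ihl ihr =>
    simp only [BinTree.minLeaf, deco] at ihl ihr
    simp only [BinTree.minLeaf, deco, decompose, BinTree.inorder]
    split_ifs
    · exact List.mem_append_left _ ihl
    · exact List.mem_append_right _ (List.mem_cons_of_mem _ ihr)

/-- The entry stacked last is the root, so decomposing the root amounts to one more step on the
decomposition below it. Distinct values exclude ties at every level. -/
theorem deco_build {v : Node → ℝ} {T : BinTree} {W : List Entry}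
    (h : (((T.inorder : Multiset Node) + nodes W).map v).Nodup) :
    deco v (build T W) = W.foldl (Deco.step v) (deco v T) := by
  induction W using List.reverseRecOn with
  | nil => rfl
  | append_singleton W e ih =>
    have h' : (((T.inorder : Multiset Node) + nodes W).map v +
        ((e.tree.inorder : Multiset Node).map v)).Nodup := by
      refine Multiset.nodup_of_le ?_ h
      rw [nodes_append, nodes_cons, ← Multiset.map_add]
      refine Multiset.map_le_map ?_
      rw [← add_assoc, nodes_nil, add_zero]
      exact add_le_add le_rfl (Multiset.le_cons_self _ _)
    obtain ⟨h1, -, h3⟩ := Multiset.nodup_add.mp h'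
    rw [build_concat, deco_join, ih h1, List.foldl_append]
    · rfl
    · intro he
      have hm : v (e.tree.minLeaf v) ∈
          ((T.inorder : Multiset Node) + nodes W).map v := by
        rw [he, ← inorder_build]
        exact Multiset.mem_map_of_mem v (minLeaf_mem v _)
      exact Multiset.disjoint_left.mp h3 hm (Multiset.mem_map_of_mem v (minLeaf_mem v _))

/-- Extend an open path by all entries of a list, each on its side. -/
def OpenPath.addAll (P : OpenPath) (W : List Entry) : OpenPath :=
  ⟨P.lower, fun d => P.trail d ++ (W.filter fun e => e.side = d).map Entry.node⟩

@[simp] theorem OpenPath.addAll_nil (P : OpenPath) : P.addAll [] = P := by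
  simp [OpenPath.addAll]

theorem OpenPath.addAll_cons (P : OpenPath) (e : Entry) (W : List Entry) :
    P.addAll (e :: W) = (P.extend e.side e.node).addAll W := by
  simp only [OpenPath.addAll, OpenPath.extend, OpenPath.mk.injEq, true_and]
  funext d
  by_cases h : e.side = d
  · simp [h]
  · simp [h, Ne.symm h]

/-- The bananas that hang off a list of entries on a path. -/
def hang (v : Node → ℝ) (W : List Entry) : Multiset Banana :=
  (W.map fun e => (deco v e.tree).1.close e.node ::ₘ (deco v e.tree).2).sum

@[simp] theorem hang_nil (v : Node → ℝ) : hang v [] = 0 := rfl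

@[simp] theorem hang_cons (v : Node → ℝ) (e : Entry) (W : List Entry) :
    hang v (e :: W) = (deco v e.tree).1.close e.node ::ₘ ((deco v e.tree).2 + hang v W) := by
  simp [hang]

@[simp] theorem hang_append (v : Node → ℝ) (W W' : List Entry) :
    hang v (W ++ W') = hang v W + hang v W' := by
  simp [hang]

theorem hang_perm (v : Node → ℝ) {W W' : List Entry} (h : W.Perm W') : hang v W = hang v W' :=
  (h.map _).sum_eq

/-- The lower end of the open path does not change when an entry is passed, so every comparison is
made with the same minimum. -/
theorem foldl_step_of_lt {v : Node → ℝ} (X : Deco) {W : List Entry}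
    (h : ∀ e ∈ W, v X.1.lower < v (e.tree.minLeaf v)) :
    W.foldl (Deco.step v) X = (X.1.addAll W, X.2 + hang v W) := by
  induction W generalizing X with
  | nil => simp
  | cons e W ih =>
    have he := h e (by simp)
    have : X.step v e = X.pass v e := if_neg he.not_gt
    rw [List.foldl_cons, this, ih]
    · simp only [Deco.pass, OpenPath.addAll_cons, hang_cons, Multiset.cons_add, Multiset.add_cons]
      congr 2
      abel
    · exact fun e' he' => h e' (by simp [he'])

/-- Completed bananas are inert: the decisions of the fold depend on the open path only. -/
theorem foldl_step_add (v : Node → ℝ) (P : OpenPath) (Y Z : Multiset Banana) (W : List Entry) :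
    W.foldl (Deco.step v) (P, Y + Z) =
      ((W.foldl (Deco.step v) (P, Y)).1, (W.foldl (Deco.step v) (P, Y)).2 + Z) := by
  induction W generalizing P Y with
  | nil => rfl
  | cons e W ih =>
    simp only [List.foldl_cons, Deco.step]
    split_ifs
    · simp only [Deco.turn]
      rw [← ih, Multiset.cons_add, add_assoc]
    · simp only [Deco.pass]
      rw [← ih, Multiset.cons_add, add_assoc]

/-- The node at the beginning of a spine with special root `root s`. -/
def top (s : Side) : List Entry → Node
  | [] => .root s
  | e :: _ => e.node

/-- The bananas of a tree above the path that ends at the first entry of the list. -/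
def rest (v : Node → ℝ) (s : Side) : List Entry → Multiset Banana
  | [] => 0
  | e :: W =>
    let Z := W.foldl (Deco.step v) ((deco v e.tree).1.extend e.side.opp e.node, (deco v e.tree).2)
    Z.1.close (.root s) ::ₘ Z.2

/-- The entries that a path from `a` passes. -/
def near (v : Node → ℝ) (a : Node) (W : List Entry) : List Entry :=
  W.takeWhile fun e => v a < v (e.tree.minLeaf v)

/-- The entries from the upper end of a path from `a` on. -/
def far (v : Node → ℝ) (a : Node) (W : List Entry) : List Entry :=
  W.dropWhile fun e => v a < v (e.tree.minLeaf v)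

theorem near_append_far (v : Node → ℝ) (a : Node) (W : List Entry) :
    near v a W ++ far v a W = W := List.takeWhile_append_dropWhile

theorem lt_of_mem_near {v : Node → ℝ} {a : Node} {W : List Entry} {e : Entry}
    (h : e ∈ near v a W) : v a < v (e.tree.minLeaf v) := by
  simpa using List.mem_takeWhile_imp h

theorem le_of_mem_head_far {v : Node → ℝ} {a : Node} {W : List Entry} {e : Entry}
    (h : e ∈ (far v a W).head?) : v (e.tree.minLeaf v) ≤ v a := by
  have := List.head?_dropWhile_not (fun e : Entry => decide (v a < v (e.tree.minLeaf v))) W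
  unfold far at h
  rw [Option.mem_def.mp h] at this
  simpa using this

/-- After the path has ended at the head of `T`, the fold continues with data of that entry alone,
and this continuation is `rest`. For `T = []` the path runs up to the special root. This is what
allows the part of a tree below such an end to be exchanged while `rest` stays fixed. -/
theorem foldl_step_append_close {v : Node → ℝ} (s : Side) (X : Deco) {A T : List Entry}
    (hA : ∀ e ∈ A, v X.1.lower < v (e.tree.minLeaf v))
    (hT : ∀ e ∈ T.head?, v (e.tree.minLeaf v) < v X.1.lower) :
    ((A ++ T).foldl (Deco.step v) X).1.close (.root s) ::ₘ
        ((A ++ T).foldl (Deco.step v) X).2 =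
      (X.1.addAll A).close (top s T) ::ₘ (X.2 + hang v A + rest v s T) := by
  rw [List.foldl_append, foldl_step_of_lt X hA]
  cases T with
  | nil => simp [top, rest]
  | cons e T =>
    have : Deco.step v (X.1.addAll A, X.2 + hang v A) e =
        Deco.turn v (X.1.addAll A, X.2 + hang v A) e := if_pos (hT e rfl)
    rw [List.foldl_cons, this]
    simp only [Deco.turn, top, rest]
    rw [← Multiset.add_cons, foldl_step_add]
    simp only [Multiset.add_cons]
    rw [Multiset.cons_swap, add_comm]

theorem foldl_step_close {v : Node → ℝ} (s : Side) (X : Deco) {W : List Entry}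
    (h : ∀ e ∈ W, v (e.tree.minLeaf v) ≠ v X.1.lower) :
    (W.foldl (Deco.step v) X).1.close (.root s) ::ₘ (W.foldl (Deco.step v) X).2 =
      (X.1.addAll (near v X.1.lower W)).close (top s (far v X.1.lower W)) ::ₘ
        (X.2 + hang v (near v X.1.lower W) + rest v s (far v X.1.lower W)) := by
  rw [← foldl_step_append_close s X (fun e he => lt_of_mem_near he), near_append_far]
  intro e he
  refine lt_of_le_of_ne (le_of_mem_head_far he) (h e ?_)
  rw [← near_append_far v X.1.lower W]
  exact List.mem_append_right _ (List.mem_of_mem_head? he)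

/-- The path that takes over at `e` starts at the smallest leaf of its subtree and has `e.node` on
the side facing the connection; above `e` the same analysis applies to it. -/
theorem rest_cons {v : Node → ℝ} (s : Side) (e : Entry) {W : List Entry}
    (h : ∀ e' ∈ W, v (e'.tree.minLeaf v) ≠ v (e.tree.minLeaf v)) :
    rest v s (e :: W) =
      (((deco v e.tree).1.extend e.side.opp e.node).addAll
        (near v (e.tree.minLeaf v) W)).close (top s (far v (e.tree.minLeaf v) W)) ::ₘ
        ((deco v e.tree).2 + hang v (near v (e.tree.minLeaf v) W) +
          rest v s (far v (e.tree.minLeaf v) W)) :=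
  foldl_step_close s ((deco v e.tree).1.extend e.side.opp e.node, (deco v e.tree).2) h

/-! ### Nodes of decompositions -/

/-- The nodes of an open path. -/
def OpenPath.foot (P : OpenPath) : Multiset Node :=
  P.lower ::ₘ ((P.trail .left : Multiset Node) + (P.trail .right : Multiset Node))

/-- The nodes of a banana other than its upper end. -/
def Banana.foot (B : Banana) : Multiset Node :=
  B.lower ::ₘ ((B.trail .left : Multiset Node) + (B.trail .right : Multiset Node))

@[simp] theorem OpenPath.foot_close (P : OpenPath) (b : Node) : (P.close b).foot = P.foot := rfl

theorem Banana.mem_foot {B : Banana} {x : Node} :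
    x ∈ B.foot ↔ x = B.lower ∨ x ∈ B.trail .left ∨ x ∈ B.trail .right := by
  simp [Banana.foot]

theorem Banana.mem_foot_of_mem_trail {B : Banana} {x : Node} {d : Side} (h : x ∈ B.trail d) :
    x ∈ B.foot := by
  rw [Banana.mem_foot]; cases d <;> simp [h]

theorem OpenPath.mem_foot_of_mem_trail {P : OpenPath} {x : Node} {d : Side} (h : x ∈ P.trail d) :
    x ∈ P.foot := Banana.mem_foot_of_mem_trail (B := P.close x) h

@[simp] theorem OpenPath.foot_extend (P : OpenPath) (d : Side) (b : Node) :
    (P.extend d b).foot = b ::ₘ P.foot := by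
  cases d <;> simp [OpenPath.foot, OpenPath.extend, ← Multiset.coe_add,
    ← Multiset.singleton_add, add_assoc, add_left_comm, add_comm]

theorem OpenPath.foot_addAll (P : OpenPath) (W : List Entry) :
    (P.addAll W).foot = P.foot + (W.map Entry.node : Multiset Node) := by
  induction W generalizing P with
  | nil => simp
  | cons e W ih =>
    rw [OpenPath.addAll_cons, ih, OpenPath.foot_extend, List.map_cons, ← Multiset.cons_coe,
      Multiset.cons_add, Multiset.add_cons]

/-- The nodes of a multiset of bananas, without the upper ends. -/
def feet (S : Multiset Banana) : Multiset Node := (S.map Banana.foot).sum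

@[simp] theorem feet_zero : feet 0 = 0 := rfl

@[simp] theorem feet_cons (B : Banana) (S : Multiset Banana) :
    feet (B ::ₘ S) = B.foot + feet S := by simp [feet]

@[simp] theorem feet_add (S S' : Multiset Banana) : feet (S + S') = feet S + feet S' := by
  simp [feet]

/-- Each node is the lower end or an interior trail node of exactly one path. This makes `Low` and
`Dth` well defined. -/
theorem feet_deco (v : Node → ℝ) (T : BinTree) :
    (deco v T).1.foot + feet (deco v T).2 = (T.inorder : Multiset Node) := by
  induction T with
  | leaf a => simp [deco, decompose, OpenPath.foot, BinTree.inorder]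
  | node l b r ihl ihr =>
    simp only [deco] at ihl ihr
    simp only [deco, decompose, BinTree.inorder]
    rw [← Multiset.coe_add, ← Multiset.cons_coe, ← ihl, ← ihr]
    split_ifs <;>
    · simp only [OpenPath.foot_extend, ← Multiset.cons_coe, ← Multiset.coe_add, feet_cons,
        feet_add, OpenPath.foot_close]
      simp only [← Multiset.singleton_add]
      abel

/-- Each maximum ends at most one of the listed bananas, and leaves end none. This makes `Birth`
well defined. -/
theorem upper_deco_le (v : Node → ℝ) (T : BinTree) :
    (deco v T).2.map Banana.upper ≤ (T.inorder : Multiset Node) := by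
  induction T with
  | leaf a => simp [deco, decompose]
  | node l b r ihl ihr =>
    simp only [deco] at ihl ihr
    have key : b ::ₘ (((decompose v l).2 : Multiset Banana).map Banana.upper +
        ((decompose v r).2 : Multiset Banana).map Banana.upper) ≤
        ((BinTree.node l b r).inorder : Multiset Node) := by
      rw [BinTree.inorder, ← Multiset.coe_add, ← Multiset.cons_coe, Multiset.add_cons]
      exact Multiset.cons_le_cons _ (add_le_add ihl ihr)
    simp only [deco, decompose]
    split_ifs <;>
    · rw [← Multiset.cons_coe, ← Multiset.coe_add, Multiset.map_cons, Multiset.map_add]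
      exact key

theorem feet_hang (v : Node → ℝ) (W : List Entry) :
    (W.map Entry.node : Multiset Node) + feet (hang v W) = nodes W := by
  induction W with
  | nil => simp
  | cons e W ih =>
    rw [hang_cons, nodes_cons, ← ih, ← feet_deco v e.tree]
    simp only [feet_cons, feet_add, OpenPath.foot_close, List.map_cons, ← Multiset.cons_coe]
    simp only [← Multiset.singleton_add]
    abel

theorem upper_hang_le (v : Node → ℝ) (W : List Entry) :
    (hang v W).map Banana.upper ≤ nodes W := by
  induction W with
  | nil => simp
  | cons e W ih =>
    rw [hang_cons, nodes_cons, Multiset.map_cons, Multiset.map_add]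
    exact Multiset.cons_le_cons _ (add_le_add (upper_deco_le v _) ih)

theorem feet_foldl (v : Node → ℝ) (X : Deco) (W : List Entry) :
    (W.foldl (Deco.step v) X).1.foot + feet (W.foldl (Deco.step v) X).2 =
      X.1.foot + feet X.2 + nodes W := by
  induction W generalizing X with
  | nil => simp
  | cons e W ih =>
    rw [List.foldl_cons, ih, nodes_cons, ← feet_deco v e.tree]
    unfold Deco.step
    split_ifs <;>
    · simp only [Deco.turn, Deco.pass, feet_cons, feet_add, OpenPath.foot_close,
        OpenPath.foot_extend]
      simp only [← Multiset.singleton_add]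
      abel

theorem upper_foldl_le (v : Node → ℝ) (X : Deco) (W : List Entry) :
    (W.foldl (Deco.step v) X).2.map Banana.upper ≤ X.2.map Banana.upper + nodes W := by
  induction W generalizing X with
  | nil => simp
  | cons e W ih =>
    rw [List.foldl_cons]
    refine (ih _).trans ?_
    rw [nodes_cons]
    have h := upper_deco_le v e.tree
    have key : e.node ::ₘ ((deco v e.tree).2.map Banana.upper + X.2.map Banana.upper) + nodes W ≤
        X.2.map Banana.upper + e.node ::ₘ ((e.tree.inorder : Multiset Node) + nodes W) := by
      rw [Multiset.cons_add, Multiset.add_cons]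
      refine Multiset.cons_le_cons _ ?_
      rw [add_comm (Multiset.map _ _), add_assoc]
      gcongr
    unfold Deco.step
    split_ifs <;> simpa [Deco.turn, Deco.pass, OpenPath.close] using key

theorem feet_rest (v : Node → ℝ) (s : Side) (W : List Entry) : feet (rest v s W) = nodes W := by
  cases W with
  | nil => simp [rest]
  | cons e W =>
    simp only [rest, feet_cons, OpenPath.foot_close]
    rw [feet_foldl, nodes_cons, OpenPath.foot_extend, Multiset.cons_add, feet_deco,
      Multiset.cons_add]

theorem upper_rest_le (v : Node → ℝ) (s : Side) (W : List Entry) :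
    top s W ::ₘ (rest v s W).map Banana.upper ≤ .root s ::ₘ nodes W := by
  cases W with
  | nil => simp [rest, top]
  | cons e W =>
    simp only [rest, Multiset.map_cons, top, nodes_cons]
    rw [Multiset.cons_swap]
    refine Multiset.cons_le_cons _ (Multiset.cons_le_cons _ ((upper_foldl_le v _ W).trans ?_))
    gcongr
    exact upper_deco_le v e.tree

/-! ### Following pointers -/

/-- Pointers are found by searching a list; uniqueness of the match makes the answer independent of
the order of the list. -/
theorem find?_eq_some_of_unique {α : Type*} {p : α → Bool} {S : List α} {B : α} (hB : B ∈ S)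
    (hp : p B) (h : ∀ B' ∈ S, p B' → B' = B) : S.find? p = some B := by
  cases hf : S.find? p with
  | none => exact absurd hp (by simpa using List.find?_eq_none.mp hf B hB)
  | some B' => rw [h B' (List.mem_of_find?_eq_some hf) (List.find?_some hf)]

theorem mem_feet {S : Multiset Banana} {x : Node} : x ∈ feet S ↔ ∃ B ∈ S, x ∈ B.foot := by
  induction S using Multiset.induction_on with
  | empty => simp
  | cons B S ih => simp [ih]

theorem eq_of_mem_foot {S : Multiset Banana} (h : (feet S).Nodup) {B B' : Banana} (hB : B ∈ S)
    (hB' : B' ∈ S) {x : Node} (hx : x ∈ B.foot) (hx' : x ∈ B'.foot) : B = B' := by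
  by_contra hne
  obtain ⟨R, rfl⟩ := Multiset.exists_cons_of_mem hB
  have hR : B' ∈ R := (Multiset.mem_cons.mp hB').resolve_left (Ne.symm hne)
  rw [feet_cons] at h
  exact Multiset.disjoint_left.mp (Multiset.nodup_add.mp h).2.2 hx (mem_feet.mpr ⟨B', hR, hx'⟩)

theorem Banana.lower_mem_foot (B : Banana) : B.lower ∈ B.foot := Multiset.mem_cons_self _ _

theorem bananaAt_lower {S : List Banana} (h : (feet (S : Multiset Banana)).Nodup) {B : Banana}
    (hB : B ∈ S) : bananaAt S B.lower = some B := by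
  refine find?_eq_some_of_unique hB (by simp) fun B' hB' hp => ?_
  have hp : B'.lower = B.lower := by simpa using hp
  exact eq_of_mem_foot h hB' hB B'.lower_mem_foot (hp ▸ B.lower_mem_foot)

theorem dth_lower {S : List Banana} (h : (feet (S : Multiset Banana)).Nodup) {B : Banana}
    (hB : B ∈ S) : dth S B.lower = some B.upper := by
  rw [dth, bananaAt_lower h hB]; rfl

theorem low_eq_lower {S : List Banana} (h : (feet (S : Multiset Banana)).Nodup) {B : Banana}
    (hB : B ∈ S) {x : Node} (hx : x ∈ B.foot) : low S x = some B.lower := by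
  rw [low, find?_eq_some_of_unique hB (by simpa [Banana.mem_foot] using hx)
    fun B' hB' hp => eq_of_mem_foot h hB' hB (x := x) ?_ hx]
  · rfl
  · simpa [Banana.mem_foot] using hp

theorem low_eq_none {S : List Banana} {x : Node} (hx : x ∉ feet (S : Multiset Banana)) :
    low S x = none := by
  rw [low, List.find?_eq_none.mpr]
  · rfl
  · intro B hB hp
    exact hx (mem_feet.mpr ⟨B, hB, by simpa [Banana.mem_foot] using hp⟩)

theorem find?_upper {S : List Banana} (h : ((S : Multiset Banana).map Banana.upper).Nodup)
    {B : Banana} (hB : B ∈ S) : (S.find? fun B' => B'.upper = B.upper) = some B :=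
  find?_eq_some_of_unique hB (by simp) fun B' hB' hp =>
    Multiset.inj_on_of_nodup_map h B' hB' B hB (by simpa using hp)

theorem birth_upper {S : List Banana} (h : ((S : Multiset Banana).map Banana.upper).Nodup)
    {B : Banana} (hB : B ∈ S) : birth S B.upper = some B.lower := by
  rw [birth, find?_upper h hB]; rfl

theorem below_upper {S : List Banana} (h : ((S : Multiset Banana).map Banana.upper).Nodup)
    {B : Banana} (hB : B ∈ S) (d : Side) :
    below S B.upper d = some (((B.trail d).getLast?).getD B.lower) := by
  rw [below, find?_upper h hB]; rfl

theorem modify_cons {S : List Banana} {B : Banana} {R : Multiset Banana} {a : Node}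
    (hS : (S : Multiset Banana) = B ::ₘ R) (ha : B.lower = a) (hR : ∀ B' ∈ R, B'.lower ≠ a)
    (φ : Banana → Banana) : (modify S a φ : Multiset Banana) = φ B ::ₘ R := by
  rw [modify, ← Multiset.map_coe, hS, Multiset.map_cons, if_pos ha]
  congr 1
  conv_rhs => rw [← Multiset.map_id R]
  exact Multiset.map_congr rfl fun B' hB' => if_neg (hR B' hB')

theorem lower_ne_of_feet_nodup {B : Banana} {R : Multiset Banana}
    (h : (feet (B ::ₘ R)).Nodup) : ∀ B' ∈ R, B'.lower ≠ B.lower := by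
  intro B' hB' he
  rw [feet_cons] at h
  exact Multiset.disjoint_left.mp (Multiset.nodup_add.mp h).2.2 B.lower_mem_foot
    (mem_feet.mpr ⟨B', hB', he ▸ B'.lower_mem_foot⟩)

/-- The second replacement cannot touch the first one, because `A'` keeps its lower end and the
lower ends of `A` and `K` differ. Both an exchange of trails and an interchange of minima have this
form. -/
theorem modify_modify {S : List Banana} {A K A' K' : Banana} {R : Multiset Banana} {a b : Node}
    (hS : (S : Multiset Banana) = A ::ₘ K ::ₘ R) (h : (feet (S : Multiset Banana)).Nodup)
    (ha : A.lower = a) (hb : K.lower = b) (hA' : A'.lower = a) :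
    (modify (modify S a fun _ => A') b fun _ => K' : Multiset Banana) =
      A' ::ₘ K' ::ₘ R := by
  subst ha hb
  rw [hS] at h
  have hA := lower_ne_of_feet_nodup h
  have h' : (feet (K ::ₘ R)).Nodup := by
    rw [feet_cons] at h
    exact (Multiset.nodup_add.mp h).2.1
  have hK := lower_ne_of_feet_nodup h'
  rw [Multiset.cons_swap]
  refine modify_cons ?_ rfl ?_ _
  · rw [modify_cons hS rfl hA, Multiset.cons_swap]
  · intro B hB
    rcases Multiset.mem_cons.mp hB with rfl | hB
    · rw [hA']
      exact (hA K (Multiset.mem_cons_self _ _)).symm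
    · exact hK B hB

/-! ### Comparing nodes -/

/-- Items and hooks. -/
def Node.IsReal : Node → Prop
  | .item _ => True
  | .hook _ => True
  | _ => False

theorem Node.IsReal.ne_dummy {x : Node} (h : x.IsReal) : x ≠ .dummy := by
  rintro rfl; exact h

theorem Node.IsReal.ne_root {x : Node} (h : x.IsReal) (s : Side) : x ≠ .root s := by
  rintro rfl; exact h

/-- The current value of the dummy leaf does not enter. All comparisons met during the loop are
between items, hooks, special roots and nil, so lowering that value in a scare affects none of them.
-/
theorem GlueState.below_real {f : ℕ → ℝ} {σ : GlueState} {x y : Node} (hx : x.IsReal)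
    (hy : y.IsReal) : σ.Below f (some x) (some y) ↔ nodeValue f x < nodeValue f y := by
  unfold GlueState.Below
  cases x <;> cases y <;> simp_all [Node.IsReal, height, nodeValue, Prod.Lex.toLex_lt_toLex]

theorem GlueState.below_root {f : ℕ → ℝ} {σ : GlueState} {x : Node} (hx : x.IsReal) (s : Side) :
    σ.Below f (some x) (some (.root s)) := by
  unfold GlueState.Below
  cases x <;> cases s <;> simp_all [Node.IsReal, height, Prod.Lex.toLex_lt_toLex]

theorem GlueState.none_below {f : ℕ → ℝ} {σ : GlueState} {x : Node} (hx : x.IsReal) :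
    σ.Below f none (some x) := by
  unfold GlueState.Below
  cases x <;> simp_all [Node.IsReal, height, Prod.Lex.toLex_lt_toLex]

theorem GlueState.below_roots {f : ℕ → ℝ} {σ : GlueState} {s : Side} :
    σ.Below f (some (.root s)) (some (.root s.opp)) ↔ s = .right := by
  unfold GlueState.Below
  cases s <;> simp [height, Side.opp, Prod.Lex.toLex_lt_toLex]

/-! ### Lists of entries -/

theorem filter_append_filter {α : Type*} {p : α → Prop} [DecidablePred p] {l : List α}
    (h : l.Pairwise fun a b => p b → p a) :
    (l.filter fun a => p a) ++ (l.filter fun a => ¬ p a) = l := by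
  induction l with
  | nil => rfl
  | cons a l ih =>
    rw [List.pairwise_cons] at h
    by_cases ha : p a
    · simpa [ha] using ih h.2
    · have : ∀ b ∈ l, ¬ p b := fun b hb hpb => ha (h.1 b hb hpb)
      rw [List.filter_eq_nil_iff.mpr, List.filter_eq_self.mpr]
      · rfl
      · simpa [ha] using this
      · simpa [ha] using this

theorem filter_side_perm (t : Side) (U : List Entry) :
    (U.filter (fun e => e.side = t) ++ U.filter (fun e => e.side = t.opp)).Perm U := by
  have : U.filter (fun e => e.side = t.opp) = U.filter (fun e => !decide (e.side = t)) := by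
    refine List.filter_congr fun e _ => ?_
    rcases Side.eq_or_eq_opp t e.side with h | h <;> simp [h]
  rw [this]
  exact List.filter_append_perm _ U

/-- The ordinary merge of sorted lists. Since the side of an entry records its origin, both lists
can be recovered from the result by filtering. -/
theorem exists_merge (v : Node → ℝ) (t : Side) {A B : List Entry}
    (hA : A.Pairwise fun e e' => v e.node < v e'.node)
    (hB : B.Pairwise fun e e' => v e.node < v e'.node)
    (hAB : ∀ a ∈ A, ∀ b ∈ B, v a.node ≠ v b.node)
    (sA : ∀ a ∈ A, a.side = t) (sB : ∀ b ∈ B, b.side = t.opp) :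
    ∃ C : List Entry, C.Pairwise (fun e e' => v e.node < v e'.node) ∧
      C.filter (fun e => e.side = t) = A ∧ C.filter (fun e => e.side = t.opp) = B := by
  have mem : ∀ {A B C : List Entry}, C.filter (fun e => e.side = t) = A →
      C.filter (fun e => e.side = t.opp) = B → ∀ c ∈ C, c ∈ A ∨ c ∈ B := by
    rintro A B C rfl rfl c hc
    rcases Side.eq_or_eq_opp t c.side with h | h <;> simp [h, hc]
  induction A generalizing B with
  | nil =>
    refine ⟨B, hB, ?_, ?_⟩
    · simpa using fun b hb => by simp [sB b hb]
    · simpa using sB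
  | cons a A ihA =>
    induction B with
    | nil =>
      refine ⟨a :: A, hA, ?_, ?_⟩
      · simpa using sA
      · rw [List.filter_eq_nil_iff]
        exact fun b hb => by simp [sA b hb]
    | cons b B ihB =>
      have ha := sA a (by simp)
      have hb := sB b (by simp)
      have hA' := List.pairwise_cons.mp hA
      have hB' := List.pairwise_cons.mp hB
      rcases lt_or_gt_of_ne (hAB a (by simp) b (by simp)) with h | h
      · obtain ⟨C, h1, h2, h3⟩ := ihA hA'.2 hB (fun a ha b hb => hAB a (by simp [ha]) b hb)
          (fun a ha => sA a (by simp [ha])) sB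
        refine ⟨a :: C, List.pairwise_cons.mpr ⟨fun c hc => ?_, h1⟩, ?_, ?_⟩
        · rcases mem h2 h3 c hc with hc | hc
          · exact hA'.1 c hc
          · rcases List.mem_cons.mp hc with rfl | hc
            · exact h
            · exact h.trans (hB'.1 c hc)
        · simp [ha, h2]
        · simp [ha, h3]
      · obtain ⟨C, h1, h2, h3⟩ := ihB hB'.2 (fun a ha b hb => hAB a ha b (by simp [hb]))
          (fun b hb => sB b (by simp [hb]))
        refine ⟨b :: C, List.pairwise_cons.mpr ⟨fun c hc => ?_, h1⟩, ?_, ?_⟩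
        · rcases mem h2 h3 c hc with hc | hc
          · rcases List.mem_cons.mp hc with rfl | hc
            · exact h
            · exact h.trans (hA'.1 c hc)
          · exact hB'.1 c hc
        · simp [hb, h2]
        · simp [hb, h3]

theorem nodes_filter_add (t : Side) (U : List Entry) :
    nodes (U.filter fun e => e.side = t) + nodes (U.filter fun e => e.side = t.opp) = nodes U := by
  rw [← nodes_append, nodes_perm (filter_side_perm t U)]

theorem hang_filter_add (v : Node → ℝ) (t : Side) (U : List Entry) :
    hang v (U.filter fun e => e.side = t) + hang v (U.filter fun e => e.side = t.opp) =
      hang v U := by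
  rw [← hang_append, hang_perm v (filter_side_perm t U)]

theorem OpenPath.addAll_trail_of_side {P : OpenPath} {W : List Entry} {d : Side}
    (h : ∀ e ∈ W, e.side = d) : (P.addAll W).trail d = P.trail d ++ W.map Entry.node := by
  simp only [OpenPath.addAll]
  rw [List.filter_eq_self.mpr]
  simpa using h

theorem OpenPath.addAll_trail_of_side_ne {P : OpenPath} {W : List Entry} {d d' : Side}
    (h : ∀ e ∈ W, e.side = d) (hd : d ≠ d') : (P.addAll W).trail d' = P.trail d' := by
  simp only [OpenPath.addAll]
  rw [List.filter_eq_nil_iff.mpr]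
  · simp
  · intro e he
    simp [h e he, hd]

/-! ### Frames and stages -/

/-- The leaf `k` at which two trees are glued, and the two spines that are merged, from bottom
to top. -/
structure Frame (f : ℕ → ℝ) (k : Node) (W : Side → List Entry) : Prop where
  side : ∀ d, ∀ e ∈ W d, e.side = d
  real : ∀ x ∈ k ::ₘ (nodes (W .left) + nodes (W .right)), x.IsReal
  nodup : ((k ::ₘ (nodes (W .left) + nodes (W .right))).map (nodeValue f)).Nodup
  sorted : ∀ d, (W d).Pairwise fun e e' => nodeValue f e.node < nodeValue f e'.node
  heap : ∀ d, ∀ e ∈ W d, ∀ x ∈ e.tree.inorder, nodeValue f x < nodeValue f e.node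
  leaf : ∀ d, ∀ e ∈ W d, nodeValue f k < nodeValue f e.node

/-- The open path of the dummy leaf. -/
def dummyPath : OpenPath := ⟨.dummy, fun _ => []⟩

/-- A stage of gluing. Tree `t` contains the merged part `build (.leaf k) U`, from whose smallest
leaf a path passes `A` and ends at the beginning of `TA`. In the other tree the path of the dummy
leaf passes `B` and ends at the beginning of `TB`. -/
structure Stage (f : ℕ → ℝ) (k : Node) (W : Side → List Entry) (S₀ : Multiset Banana)
    (S : List Banana) (t : Side) (U A B TA TB : List Entry) : Prop where
  splitA : U.filter (fun e => e.side = t) ++ (A ++ TA) = W t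
  splitB : U.filter (fun e => e.side = t.opp) ++ (B ++ TB) = W t.opp
  sorted : U.Pairwise fun e e' => nodeValue f e.node < nodeValue f e'.node
  sep : ∀ u ∈ U, ∀ e ∈ A ++ TA ++ (B ++ TB), nodeValue f u.node < nodeValue f e.node
  passed : ∀ e ∈ A ++ B, nodeValue f ((build (.leaf k) U).minLeaf (nodeValue f)) <
    nodeValue f (e.tree.minLeaf (nodeValue f))
  bananas : (S : Multiset Banana) =
    (dummyPath.addAll B).close (top t.opp TB) ::ₘ
    ((deco (nodeValue f) (build (.leaf k) U)).1.addAll A).close (top t TA) ::ₘ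
      ((deco (nodeValue f) (build (.leaf k) U)).2 + hang (nodeValue f) A + hang (nodeValue f) B +
        rest (nodeValue f) t TA + rest (nodeValue f) t.opp TB)
  restA : rest (nodeValue f) t TA ≤ S₀
  restB : rest (nodeValue f) t.opp TB ≤ S₀

/-! ### Consequences of the invariant: unique pointers, spines, and merging into the core -/

section

variable {f : ℕ → ℝ} {k : Node} {W : Side → List Entry} {S₀ : Multiset Banana} {S : List Banana}
  {t : Side} {U A B TA TB : List Entry}

theorem Frame.nodes_eq (W : Side → List Entry) (t : Side) :
    nodes (W t) + nodes (W t.opp) = nodes (W .left) + nodes (W .right) := by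
  cases t
  · rfl
  · exact add_comm _ _

theorem Stage.nodes_eq (h : Stage f k W S₀ S t U A B TA TB) :
    nodes U + nodes A + nodes B + nodes TA + nodes TB =
      nodes (W .left) + nodes (W .right) := by
  rw [← Frame.nodes_eq W t, ← h.splitA, ← h.splitB, ← nodes_filter_add t U]
  simp only [nodes_append]
  abel

/-- The right side does not mention the stage: gluing only redistributes a fixed set of nodes among
the bananas. -/
theorem Stage.feet_eq (h : Stage f k W S₀ S t U A B TA TB) :
    feet (S : Multiset Banana) = .dummy ::ₘ k ::ₘ (nodes (W .left) + nodes (W .right)) := by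
  have h1 := feet_deco (nodeValue f) (build (.leaf k) U)
  rw [inorder_build] at h1
  rw [h.bananas, ← h.nodes_eq]
  simp only [feet_cons, feet_add, OpenPath.foot_close, OpenPath.foot_addAll, feet_rest,
    ← feet_hang (nodeValue f) A, ← feet_hang (nodeValue f) B]
  have h2 : dummyPath.foot = {.dummy} := rfl
  have h3 : ((BinTree.leaf k).inorder : Multiset Node) = {k} := rfl
  rw [h3] at h1
  rw [h2]
  simp only [← Multiset.singleton_add]
  calc _ = {Node.dummy} + ((deco (nodeValue f) (build (.leaf k) U)).1.foot +
      feet (deco (nodeValue f) (build (.leaf k) U)).2) + (A.map Entry.node : Multiset Node) +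
      (B.map Entry.node : Multiset Node) + feet (hang (nodeValue f) A) +
      feet (hang (nodeValue f) B) + nodes TA + nodes TB := by abel
    _ = _ := by rw [h1]; abel

theorem Frame.nodup_nodes (hF : Frame f k W) :
    (k ::ₘ (nodes (W .left) + nodes (W .right))).Nodup := Multiset.Nodup.of_map _ hF.nodup

theorem Stage.feet_nodup (hF : Frame f k W) (h : Stage f k W S₀ S t U A B TA TB) :
    (feet (S : Multiset Banana)).Nodup := by
  rw [h.feet_eq, Multiset.nodup_cons]
  exact ⟨fun hd => (hF.real _ hd).ne_dummy rfl, hF.nodup_nodes⟩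

/-- The upper ends are bounded by the two special roots together with all nodes of the frame, which
are distinct and real. Only an inequality holds because minima are never upper ends. -/
theorem Stage.upper_nodup (hF : Frame f k W) (h : Stage f k W S₀ S t U A B TA TB) :
    ((S : Multiset Banana).map Banana.upper).Nodup := by
  have key : (S : Multiset Banana).map Banana.upper ≤
      .root t.opp ::ₘ .root t ::ₘ k ::ₘ (nodes (W .left) + nodes (W .right)) := by
    rw [h.bananas, ← h.nodes_eq]
    have h1 := upper_deco_le (nodeValue f) (build (.leaf k) U)
    rw [inorder_build] at h1
    have h2 := upper_rest_le (nodeValue f) t TA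
    have h3 := upper_rest_le (nodeValue f) t.opp TB
    have h4 := upper_hang_le (nodeValue f) A
    have h5 := upper_hang_le (nodeValue f) B
    have h6 : ((BinTree.leaf k).inorder : Multiset Node) = {k} := rfl
    rw [h6] at h1
    have h7 := add_le_add (add_le_add (add_le_add (add_le_add h1 h4) h5) h2) h3
    refine le_trans (le_of_eq ?_) (h7.trans (le_of_eq ?_))
    · simp only [Multiset.map_cons, Multiset.map_add, OpenPath.close]
      simp only [← Multiset.singleton_add]
      abel
    · simp only [← Multiset.singleton_add]
      abel
  refine Multiset.nodup_of_le key ?_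
  simp only [Multiset.nodup_cons]
  refine ⟨?_, ?_, Multiset.nodup_cons.mp hF.nodup_nodes⟩
  · intro hd
    rcases Multiset.mem_cons.mp hd with hd | hd
    · simp at hd
    · exact (hF.real _ hd).ne_root _ rfl
  · exact fun hd => (hF.real _ hd).ne_root _ rfl

theorem Frame.real_of_mem (hF : Frame f k W) {d : Side} {e : Entry} (he : e ∈ W d) :
    e.node.IsReal ∧ ∀ x ∈ e.tree.inorder, x.IsReal := by
  have : ∀ x, (x = e.node ∨ x ∈ e.tree.inorder) → x.IsReal := by
    intro x hx
    refine hF.real x (Multiset.mem_cons_of_mem ?_)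
    rw [← Frame.nodes_eq W d]
    exact Multiset.mem_add.mpr (Or.inl (mem_nodes.mpr ⟨e, he, hx⟩))
  exact ⟨this _ (Or.inl rfl), fun x hx => this x (Or.inr hx)⟩

theorem Stage.memA (h : Stage f k W S₀ S t U A B TA TB) {e : Entry} (he : e ∈ A) : e ∈ W t := by
  rw [← h.splitA]; simp [he]

theorem Stage.memTA (h : Stage f k W S₀ S t U A B TA TB) {e : Entry} (he : e ∈ TA) :
    e ∈ W t := by
  rw [← h.splitA]; simp [he]

theorem Stage.memB (h : Stage f k W S₀ S t U A B TA TB) {e : Entry} (he : e ∈ B) :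
    e ∈ W t.opp := by
  rw [← h.splitB]; simp [he]

theorem Stage.memTB (h : Stage f k W S₀ S t U A B TA TB) {e : Entry} (he : e ∈ TB) :
    e ∈ W t.opp := by
  rw [← h.splitB]; simp [he]

theorem Stage.memU (h : Stage f k W S₀ S t U A B TA TB) {e : Entry} (he : e ∈ U) :
    e ∈ W e.side := by
  rcases Side.eq_or_eq_opp t e.side with hs | hs
  · rw [hs, ← h.splitA]; simp [he, hs]
  · rw [hs, ← h.splitB]; simp [he, hs]

theorem Stage.nodup (hF : Frame f k W) (h : Stage f k W S₀ S t U A B TA TB) :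
    ((k ::ₘ nodes U).map (nodeValue f) + (nodes A).map (nodeValue f) +
      (nodes B).map (nodeValue f) + (nodes TA).map (nodeValue f) +
      (nodes TB).map (nodeValue f)).Nodup := by
  have := hF.nodup
  rw [← h.nodes_eq] at this
  simpa only [← Multiset.map_add, Multiset.cons_add] using this

theorem Frame.ne_of_mem_tail (hF : Frame f k W) {d : Side} {e : Entry} {V V' : List Entry}
    (hV : V' ++ e :: V = W d) : ∀ e' ∈ V,
    nodeValue f (e'.tree.minLeaf (nodeValue f)) ≠ nodeValue f (e.tree.minLeaf (nodeValue f)) := by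
  intro e' he' heq
  have h1 := hF.nodup
  rw [Multiset.map_cons, ← Frame.nodes_eq W d, ← hV] at h1
  simp only [nodes_append, nodes_cons, Multiset.map_add, Multiset.map_cons] at h1
  have h2 := (Multiset.nodup_add.mp (Multiset.nodup_add.mp (Multiset.nodup_cons.mp h1).2).1).2.1
  have h3 := (Multiset.nodup_add.mp (Multiset.nodup_cons.mp h2).2).2.2
  refine Multiset.disjoint_left.mp h3
    (Multiset.mem_map_of_mem _ (minLeaf_mem (nodeValue f) e.tree)) ?_
  rw [← heq]
  exact Multiset.mem_map_of_mem _ (mem_nodes.mpr ⟨e', he', Or.inr (minLeaf_mem _ _)⟩)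

/-- A tree contains everything that is needed to follow its spine. -/
theorem inSpine_top (hF : Frame f k W) {d : Side} {T V : List Entry} (hT : V ++ T = W d)
    (hS : rest (nodeValue f) d T ≤ (S : Multiset Banana)) :
    InSpine S (.root d) d.opp (top d T) := by
  -- The banana that contains the head of `T` ends at the head of the `far` part, which may be
  -- several entries higher; hence strong induction on the length.
  induction hn : T.length using Nat.strong_induction_on generalizing T V with
  | _ n ih =>
  cases T with
  | nil => exact .root
  | cons e T =>
    rw [rest_cons d e (hF.ne_of_mem_tail hT)] at hS
    have hlen : (far (nodeValue f) (e.tree.minLeaf (nodeValue f)) T).length < n := by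
      have := congrArg List.length (near_append_far (nodeValue f)
        (e.tree.minLeaf (nodeValue f)) T)
      simp only [List.length_append] at this
      simp only [List.length_cons] at hn
      omega
    have hsplit := near_append_far (nodeValue f) (e.tree.minLeaf (nodeValue f)) T
    have hspine := ih _ hlen (V := V ++ e :: near (nodeValue f) (e.tree.minLeaf (nodeValue f)) T)
      (T := far (nodeValue f) (e.tree.minLeaf (nodeValue f)) T)
      (by rw [List.append_assoc, List.cons_append, hsplit, hT])
      (le_trans (le_trans (Multiset.le_add_left _ _) (Multiset.le_cons_self _ _)) hS) rfl
    refine .next (Multiset.mem_coe.mp (Multiset.mem_of_le hS (Multiset.mem_cons_self _ _)))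
      hspine ?_
    have hs : ∀ e' ∈ near (nodeValue f) (e.tree.minLeaf (nodeValue f)) T, e'.side = d := by
      intro e' he'
      refine hF.side d e' ?_
      rw [← hT, ← hsplit]
      simp [he']
    simp only [OpenPath.close]
    -- The entries passed by this path all hang on side `d`, so they lengthen only the trail on side
    -- `d`, and `e.node` remains the topmost node of the trail on side `d.opp`.
    rw [OpenPath.addAll_trail_of_side_ne hs (Side.ne_opp d), hF.side d e (by rw [← hT]; simp)]
    simp [OpenPath.extend, top]

/-- Only the bananas in `rest` are needed to go from a current maximum to its successor, so the
successor can be read off while the part below changes. -/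
theorem low_of_rest (hF : Frame f k W) (hnd : (feet (S : Multiset Banana)).Nodup) {d : Side}
    {e : Entry} {T V : List Entry} (hT : V ++ e :: T = W d)
    (hS : rest (nodeValue f) d (e :: T) ≤ (S : Multiset Banana)) :
    low S e.node = some (e.tree.minLeaf (nodeValue f)) ∧
      dth S (e.tree.minLeaf (nodeValue f)) =
        some (top d (far (nodeValue f) (e.tree.minLeaf (nodeValue f)) T)) := by
  rw [rest_cons d e (hF.ne_of_mem_tail hT)] at hS
  have hmem := Multiset.mem_coe.mp (Multiset.mem_of_le hS (Multiset.mem_cons_self _ _))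
  refine ⟨low_eq_lower hnd hmem ?_, dth_lower hnd hmem⟩
  rw [OpenPath.foot_close, OpenPath.foot_addAll, OpenPath.foot_extend]
  simp

theorem Stage.low_root (hF : Frame f k W) (h : Stage f k W S₀ S t U A B TA TB) (d : Side) :
    low S (.root d) = none := by
  refine low_eq_none ?_
  rw [h.feet_eq, Multiset.mem_cons]
  rintro (hd | hd)
  · cases hd
  · exact (hF.real _ hd).ne_root d rfl

theorem build_leaf_inorder (k : Node) (U : List Entry) :
    ((build (.leaf k) U).inorder : Multiset Node) = k ::ₘ nodes U := by
  rw [inorder_build]; rfl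

theorem Stage.minLeaf_ne (hF : Frame f k W) (h : Stage f k W S₀ S t U A B TA TB) {e : Entry}
    (he : e ∈ TA ∨ e ∈ TB) :
    nodeValue f (e.tree.minLeaf (nodeValue f)) ≠
      nodeValue f ((build (.leaf k) U).minLeaf (nodeValue f)) := by
  intro heq
  have h1 := h.nodup hF
  have h2 : nodeValue f (e.tree.minLeaf (nodeValue f)) ∈
      (k ::ₘ nodes U).map (nodeValue f) := by
    rw [heq, ← build_leaf_inorder]
    exact Multiset.mem_map_of_mem _ (minLeaf_mem _ _)
  have h3 : ∀ {T : List Entry}, e ∈ T → nodeValue f (e.tree.minLeaf (nodeValue f)) ∈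
      (nodes T).map (nodeValue f) := fun he =>
    Multiset.mem_map_of_mem _ (mem_nodes.mpr ⟨e, he, Or.inr (minLeaf_mem _ _)⟩)
  have h4 := Multiset.nodup_add.mp h1
  have h5 := Multiset.nodup_add.mp h4.1
  rcases he with he | he
  · exact Multiset.disjoint_left.mp h5.2.2 (by simp only [Multiset.mem_add]; tauto) (h3 he)
  · exact Multiset.disjoint_left.mp h4.2.2 (by simp only [Multiset.mem_add]; tauto) (h3 he)

theorem Stage.node_ne (hF : Frame f k W) (h : Stage f k W S₀ S t U A B TA TB) {a b : Entry}
    (ha : a ∈ A ++ TA) (hb : b ∈ B ++ TB) : nodeValue f a.node ≠ nodeValue f b.node := by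
  intro heq
  have h1 := hF.nodup
  rw [Multiset.map_cons, ← Frame.nodes_eq W t, Multiset.map_add] at h1
  have h2 := (Multiset.nodup_add.mp (Multiset.nodup_cons.mp h1).2).2.2
  have ha' : nodeValue f a.node ∈ (nodes (W t)).map (nodeValue f) :=
    Multiset.mem_map_of_mem _ (mem_nodes.mpr ⟨a, by rw [← h.splitA]; simp_all, Or.inl rfl⟩)
  have hb' : nodeValue f b.node ∈ (nodes (W t.opp)).map (nodeValue f) :=
    Multiset.mem_map_of_mem _ (mem_nodes.mpr ⟨b, by rw [← h.splitB]; simp_all, Or.inl rfl⟩)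
  exact Multiset.disjoint_left.mp h2 ha' (heq ▸ hb')

/-- The entries of `A₁` and `B₁` all have minima above that of the core, so the core path passes
their merge `C`. Its minimum is kept, its two trails grow by `A₁` and `B₁`, respectively, and the
bananas hanging off these entries are taken along. This is exactly the movement of nodes in an
injury or a fatality. -/
theorem Stage.exists_absorb (hF : Frame f k W) (h : Stage f k W S₀ S t U A B TA TB)
    {A₁ A₂ B₁ B₂ : List Entry} (hA : A₁ ++ A₂ = A) (hB : B₁ ++ B₂ = B)
    (hsep : ∀ x ∈ A₁ ++ B₁, ∀ e ∈ A₂ ++ TA ++ (B₂ ++ TB),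
      nodeValue f x.node < nodeValue f e.node) :
    ∃ C : List Entry, C.filter (fun e => e.side = t) = A₁ ∧
      C.filter (fun e => e.side = t.opp) = B₁ ∧
      (U ++ C).Pairwise (fun e e' => nodeValue f e.node < nodeValue f e'.node) ∧
      (∀ u ∈ U ++ C, ∀ e ∈ A₂ ++ TA ++ (B₂ ++ TB), nodeValue f u.node < nodeValue f e.node) ∧
      deco (nodeValue f) (build (.leaf k) (U ++ C)) =
        ((deco (nodeValue f) (build (.leaf k) U)).1.addAll C,
          (deco (nodeValue f) (build (.leaf k) U)).2 +
            (hang (nodeValue f) A₁ + hang (nodeValue f) B₁)) := by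
  have sA : A₁.Pairwise fun e e' => nodeValue f e.node < nodeValue f e'.node := by
    refine (hF.sorted t).sublist ?_
    rw [← h.splitA, ← hA]
    exact ((List.sublist_append_left _ _).trans (List.sublist_append_left _ _)).trans
      (List.sublist_append_right _ _)
  have sB : B₁.Pairwise fun e e' => nodeValue f e.node < nodeValue f e'.node := by
    refine (hF.sorted t.opp).sublist ?_
    rw [← h.splitB, ← hB]
    exact ((List.sublist_append_left _ _).trans (List.sublist_append_left _ _)).trans
      (List.sublist_append_right _ _)
  obtain ⟨C, hC, hCA, hCB⟩ := exists_merge (nodeValue f) t sA sB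
    (fun a ha b hb => h.node_ne hF (by simp [← hA, ha]) (by simp [← hB, hb]))
    (fun a ha => hF.side t a (h.memA (by simp [← hA, ha])))
    (fun b hb => hF.side t.opp b (h.memB (by simp [← hB, hb])))
  have hmem : ∀ c ∈ C, c ∈ A₁ ++ B₁ := fun c hc => by
    rw [← hCA, ← hCB]; exact (filter_side_perm t C).mem_iff.mpr hc
  have hmem' : ∀ c ∈ C, c ∈ A ++ B := fun c hc => by
    have := hmem c hc
    rw [← hA, ← hB]
    simp only [List.mem_append] at this ⊢
    tauto
  have hsub : nodes C ≤ nodes A + nodes B := by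
    rw [← nodes_filter_add t C, hCA, hCB, ← hA, ← hB, nodes_append, nodes_append]
    gcongr <;> exact Multiset.le_add_right _ _
  refine ⟨C, hCA, hCB, ?_, ?_, ?_⟩
  · rw [List.pairwise_append]
    refine ⟨h.sorted, hC, fun u hu c hc => h.sep u hu c ?_⟩
    have := hmem' c hc
    simp only [List.mem_append] at this ⊢
    tauto
  · intro u hu e he
    rcases List.mem_append.mp hu with hu | hu
    · refine h.sep u hu e ?_
      rw [← hA, ← hB]
      simp only [List.mem_append] at he ⊢
      tauto
    · exact hsep u (hmem u hu) e he
  · have hnd : (((build (.leaf k) U).inorder + nodes C : Multiset Node).map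
        (nodeValue f)).Nodup := by
      refine Multiset.nodup_of_le ?_ hF.nodup
      rw [build_leaf_inorder, ← h.nodes_eq]
      refine Multiset.map_le_map ?_
      rw [Multiset.cons_add]
      refine Multiset.cons_le_cons _ ?_
      calc nodes U + nodes C ≤ nodes U + (nodes A + nodes B) := by gcongr
        _ ≤ _ := by
          rw [← add_assoc, add_assoc (nodes U + nodes A + nodes B)]
          exact Multiset.le_add_right _ _
    rw [build_append, deco_build hnd, foldl_step_of_lt]
    · rw [← hang_filter_add (nodeValue f) t C, hCA, hCB]
    · exact fun c hc => h.passed c (hmem' c hc)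

end

/-! ### Moving the core past a maximum, and undoing an injury -/

section

variable {f : ℕ → ℝ} {k : Node} {W : Side → List Entry} {S₀ : Multiset Banana} {S : List Banana}
  {t : Side} {U A B TA TB : List Entry}

/-- The multiset of bananas does not change; only its description does. The core path, with nothing
left to pass, ends at `e`, so `e` and its subtree can be counted as part of the core, with the
smallest leaf of that subtree as the new minimum. The requirement on `B ++ TB` keeps the merge
sorted. -/
theorem Stage.advance {e : Entry} {V : List Entry} (hF : Frame f k W)
    (h : Stage f k W S₀ S t U [] B (e :: V) TB)
    (he : nodeValue f (e.tree.minLeaf (nodeValue f)) <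
      nodeValue f ((build (.leaf k) U).minLeaf (nodeValue f)))
    (hsep : ∀ e' ∈ B ++ TB, nodeValue f e.node < nodeValue f e'.node) :
    Stage f k W S₀ S t (U ++ [e]) (near (nodeValue f) (e.tree.minLeaf (nodeValue f)) V) B
      (far (nodeValue f) (e.tree.minLeaf (nodeValue f)) V) TB ∧
    (build (.leaf k) (U ++ [e])).minLeaf (nodeValue f) = e.tree.minLeaf (nodeValue f) := by
  have hside : e.side = t := hF.side t e (h.memTA (by simp))
  have hdeco : deco (nodeValue f) (build (.leaf k) (U ++ [e])) =
      (deco (nodeValue f) (build (.leaf k) U)).turn (nodeValue f) e := by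
    rw [build_concat, deco_join _ _ _ he.ne]
    exact if_pos he
  have hmin : (build (.leaf k) (U ++ [e])).minLeaf (nodeValue f) =
      e.tree.minLeaf (nodeValue f) := by
    rw [BinTree.minLeaf, hdeco]; rfl
  have hsplit := near_append_far (nodeValue f) (e.tree.minLeaf (nodeValue f)) V
  have hW : U.filter (fun e => e.side = t) ++ e :: V = W t := h.splitA
  have hrest := rest_cons t e (hF.ne_of_mem_tail hW)
  have hfar : rest (nodeValue f) t (far (nodeValue f) (e.tree.minLeaf (nodeValue f)) V) ≤
      rest (nodeValue f) t (e :: V) := by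
    rw [hrest]
    exact (Multiset.le_add_left _ _).trans (Multiset.le_cons_self _ _)
  refine ⟨⟨?_, ?_, ?_, ?_, ?_, ?_, hfar.trans h.restA, h.restB⟩, hmin⟩
  · rw [hsplit, ← hW]
    simp [hside]
  · rw [← h.splitB]
    simp [hside]
  · rw [List.pairwise_append]
    refine ⟨h.sorted, List.pairwise_singleton _ _, fun u hu e' he' => ?_⟩
    rw [List.mem_singleton.mp he']
    exact h.sep u hu e (by simp)
  · rw [hsplit]
    intro u hu e' he'
    rcases List.mem_append.mp hu with hu | hu
    · refine h.sep u hu e' ?_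
      simp only [List.mem_append, List.mem_cons] at he' ⊢
      tauto
    · rw [List.mem_singleton.mp hu]
      rcases List.mem_append.mp he' with he' | he'
      · have hs := hF.sorted t
        rw [← hW, List.pairwise_append, List.pairwise_cons] at hs
        exact hs.2.1.1 e' he'
      · exact hsep e' he'
  · rw [hmin]
    intro e' he'
    rcases List.mem_append.mp he' with he' | he'
    · exact lt_of_mem_near he'
    · exact he.trans (h.passed e' (by simp [he']))
  · rw [hdeco, h.bananas, hrest]
    simp only [Deco.turn, OpenPath.addAll_nil, hang_nil, add_zero, top, hside,
      Multiset.cons_add, Multiset.add_cons]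
    congr 1
    rw [Multiset.cons_swap]
    congr 2
    abel

/-- The banana of the dummy leaf. -/
def dummyBanana (t : Side) (B TB : List Entry) : Banana :=
  (dummyPath.addAll B).close (top t.opp TB)

/-- The banana of the smallest leaf of the merged part. -/
def coreBanana (f : ℕ → ℝ) (k : Node) (t : Side) (U A TA : List Entry) : Banana :=
  ((deco (nodeValue f) (build (.leaf k) U)).1.addAll A).close (top t TA)

theorem Stage.dummyBanana_mem (h : Stage f k W S₀ S t U A B TA TB) :
    dummyBanana t B TB ∈ S := by
  rw [← Multiset.mem_coe, h.bananas]; exact Multiset.mem_cons_self _ _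

theorem Stage.coreBanana_mem (h : Stage f k W S₀ S t U A B TA TB) :
    coreBanana f k t U A TA ∈ S := by
  rw [← Multiset.mem_coe, h.bananas]
  exact Multiset.mem_cons_of_mem (Multiset.mem_cons_self _ _)

theorem Stage.rest_le (h : Stage f k W S₀ S t U A B TA TB) :
    rest (nodeValue f) t TA ≤ S ∧ rest (nodeValue f) t.opp TB ≤ S := by
  rw [h.bananas]
  have h1 : ∀ {X Y Z : Multiset Banana} {a b : Banana}, X ≤ a ::ₘ b ::ₘ (Z + X + Y) :=
    fun {X Y Z a b} => ((Multiset.le_add_left X Z).trans (Multiset.le_add_right _ Y)).trans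
      ((Multiset.le_cons_self _ _).trans (Multiset.le_cons_self _ _))
  refine ⟨h1, ?_⟩
  rw [add_right_comm]
  exact h1

theorem Stage.minLeaf_real (hF : Frame f k W) (h : Stage f k W S₀ S t U A B TA TB) :
    ((build (.leaf k) U).minLeaf (nodeValue f)).IsReal := by
  refine hF.real _ ?_
  have h1 : (build (.leaf k) U).minLeaf (nodeValue f) ∈ k ::ₘ nodes U := by
    rw [← build_leaf_inorder]; exact minLeaf_mem _ _
  rw [← h.nodes_eq]
  simp only [Multiset.mem_cons, Multiset.mem_add] at h1 ⊢
  tauto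

theorem top_real_or_root (hF : Frame f k W) {d : Side} {V T : List Entry}
    (hT : V ++ T = W d) : (T = [] ∧ top d T = .root d) ∨
      (∃ e T', T = e :: T' ∧ top d T = e.node ∧ e.node.IsReal) := by
  cases T with
  | nil => exact Or.inl ⟨rfl, rfl⟩
  | cons e T => exact Or.inr ⟨e, T, rfl, rfl, (hF.real_of_mem (by rw [← hT]; simp)).1⟩

/-- Two ordinary maxima differ because all values are distinct, an ordinary maximum is below either
special root, and two special roots are comparable by convention. -/
theorem Stage.below_or_below (hF : Frame f k W) (h : Stage f k W S₀ S t U A B TA TB)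
    (σ : GlueState) : σ.Below f (some (top t TA)) (some (top t.opp TB)) ∨
      σ.Below f (some (top t.opp TB)) (some (top t TA)) := by
  have hA := h.splitA
  have hB := h.splitB
  rw [← List.append_assoc] at hA hB
  rcases top_real_or_root hF hA with ⟨-, h1⟩ | ⟨e, T, h0, h1, h2⟩ <;>
  rcases top_real_or_root hF hB with ⟨-, h4⟩ | ⟨e', T', h3, h4, h5⟩ <;>
  rw [h1, h4]
  · rw [GlueState.below_roots]
    have := GlueState.below_roots (f := f) (σ := σ) (s := t.opp)
    rw [Side.opp_opp] at this
    rw [this]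
    cases t <;> simp [Side.opp]
  · exact Or.inr (GlueState.below_root h5 t)
  · exact Or.inl (GlueState.below_root h2 _)
  · rw [GlueState.below_real h2 h5, GlueState.below_real h5 h2]
    exact lt_or_gt_of_ne (h.node_ne hF (by simp [h0]) (by simp [h3]))

theorem GlueState.below_trans {σ : GlueState} {x y z : Option Node} (h : σ.Below f x y)
    (h' : σ.Below f y z) : σ.Below f x z := lt_trans h h'

theorem GlueState.below_irrefl {σ : GlueState} {x : Option Node} : ¬ σ.Below f x x := lt_irrefl _

/-- Split a sorted list at a node of the other tree. -/
theorem filter_below_split (hF : Frame f k W) (σ : GlueState) (q : Node) {d : Side}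
    {V B T : List Entry} (hB : V ++ (B ++ T) = W d) :
    (B.filter fun e => σ.Below f (some e.node) (some q)) ++
      (B.filter fun e => ¬ σ.Below f (some e.node) (some q)) = B := by
  refine filter_append_filter ?_
  have hs : B.Pairwise fun e e' => nodeValue f e.node < nodeValue f e'.node := by
    refine (hF.sorted d).sublist ?_
    rw [← hB]
    exact (List.sublist_append_left _ _).trans (List.sublist_append_right _ _)
  refine List.Pairwise.imp_of_mem ?_ hs
  intro a b ha hb hab hq
  have hW : ∀ {c : Entry}, c ∈ B → c ∈ W d := fun hc => by rw [← hB]; simp [hc]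
  exact GlueState.below_trans
    ((GlueState.below_real (hF.real_of_mem (hW ha)).1 (hF.real_of_mem (hW hb)).1).mpr hab) hq

theorem below_top (hF : Frame f k W) (σ : GlueState) {d : Side} {V X T : List Entry}
    (hT : V ++ (X ++ T) = W d) {x : Entry} (hx : x ∈ X) :
    σ.Below f (some x.node) (some (top d T)) := by
  have hxW : x ∈ W d := by rw [← hT]; simp [hx]
  rw [← List.append_assoc] at hT
  rcases top_real_or_root hF hT with ⟨-, h1⟩ | ⟨e, T', h0, h1, h2⟩ <;> rw [h1]
  · exact GlueState.below_root (hF.real_of_mem hxW).1 d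
  · rw [GlueState.below_real (hF.real_of_mem hxW).1 h2]
    have hs := hF.sorted d
    rw [← hT, List.pairwise_append] at hs
    exact hs.2.2 x (by simp [hx]) e (by simp [h0])

theorem not_below_top (hF : Frame f k W) (σ : GlueState) {d : Side} {V T : List Entry}
    (hT : V ++ T = W d) {x : Entry} (hx : x ∈ T) :
    ¬ σ.Below f (some x.node) (some (top d T)) := by
  have hxW : x ∈ W d := by rw [← hT]; simp [hx]
  cases T with
  | nil => simp at hx
  | cons e T =>
    simp only [top]
    rcases List.mem_cons.mp hx with rfl | hx
    · exact GlueState.below_irrefl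
    · have hs := hF.sorted d
      rw [← hT, List.pairwise_append, List.pairwise_cons] at hs
      intro hb
      refine GlueState.below_irrefl (GlueState.below_trans hb
        ((GlueState.below_real ?_ ?_).mpr (hs.2.1.1 x hx)))
      · exact (hF.real_of_mem (d := d) (by rw [← hT]; simp)).1
      · exact (hF.real_of_mem hxW).1

theorem Frame.lt_of_below (hF : Frame f k W) {σ : GlueState} {q : Option Node} {d d' : Side}
    {x y : Entry} (hx : x ∈ W d) (hy : y ∈ W d') (hxq : σ.Below f (some x.node) q)
    (hyq : ¬ σ.Below f (some y.node) q) : nodeValue f x.node < nodeValue f y.node := by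
  have hx' := (hF.real_of_mem hx).1
  have hy' := (hF.real_of_mem hy).1
  rw [← GlueState.below_real (σ := σ) hx' hy']
  exact lt_of_lt_of_le hxq (not_lt.mp hyq)

theorem Stage.dummy_trail (hF : Frame f k W) (h : Stage f k W S₀ S t U A B TA TB) :
    (dummyBanana t B TB).trail t = [] ∧
      (dummyBanana t B TB).trail t.opp = B.map Entry.node := by
  have hs : ∀ e ∈ B, e.side = t.opp := fun e he => hF.side _ e (h.memB he)
  constructor
  · exact OpenPath.addAll_trail_of_side_ne hs (Side.opp_ne t)
  · exact OpenPath.addAll_trail_of_side hs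

theorem Stage.core_trail (hF : Frame f k W) (h : Stage f k W S₀ S t U A B TA TB) :
    (coreBanana f k t U A TA).trail t =
      (deco (nodeValue f) (build (.leaf k) U)).1.trail t ++ A.map Entry.node ∧
    (coreBanana f k t U A TA).trail t.opp =
      (deco (nodeValue f) (build (.leaf k) U)).1.trail t.opp := by
  have hs : ∀ e ∈ A, e.side = t := fun e he => hF.side _ e (h.memA he)
  constructor
  · exact OpenPath.addAll_trail_of_side hs
  · exact OpenPath.addAll_trail_of_side_ne hs (Side.ne_opp t)

theorem Banana.ext_of_side {X Y : Banana} (t : Side) (h1 : X.lower = Y.lower)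
    (h2 : X.upper = Y.upper) (h3 : X.trail t = Y.trail t)
    (h4 : X.trail t.opp = Y.trail t.opp) : X = Y := by
  refine Banana.ext h1 h2 (funext fun d => ?_)
  rcases Side.eq_or_eq_opp t d with rfl | rfl
  · exact h3
  · exact h4

@[simp] theorem trails_self (d : Side) (x y : List Node) : trails d x y d = x := if_pos rfl

@[simp] theorem trails_opp (d : Side) (x y : List Node) : trails d x y d.opp = y :=
  if_neg (Side.opp_ne d)

theorem dummyBanana_eq {B TB : List Entry} (hs : ∀ e ∈ B, e.side = t.opp) :
    dummyBanana t B TB = ⟨.dummy, top t.opp TB, trails t [] (B.map Entry.node)⟩ := by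
  refine Banana.ext_of_side t rfl rfl ?_ ?_
  · exact (OpenPath.addAll_trail_of_side_ne hs (Side.opp_ne t)).trans (trails_self t _ _).symm
  · exact (OpenPath.addAll_trail_of_side hs).trans (trails_opp t _ _).symm

theorem filter_map_below (σ : GlueState) (q : Node) (B : List Entry) :
    ((B.map Entry.node).filter fun j => σ.Below f (some j) (some q)) =
      (B.filter fun e => σ.Below f (some e.node) (some q)).map Entry.node ∧
    ((B.map Entry.node).filter fun j => ¬ σ.Below f (some j) (some q)) =
      (B.filter fun e => ¬ σ.Below f (some e.node) (some q)).map Entry.node := by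
  simp only [List.filter_map]
  exact ⟨rfl, rfl⟩

/-- All of `A` lies below the end `q` of the core path and already belongs to its trail on side `t`.
What is missing from the merge below `q` is the part `B₁` of the dummy trail, and this is what the
operation moves. -/
theorem Stage.undoInjury_eq (hF : Frame f k W) (σ : GlueState)
    (h : Stage f k W S₀ σ.bananas t U A B TA TB)
    (hq : σ.Below f (some (top t TA)) (some (top t.opp TB))) :
    ∃ τ, undoInjury f σ t ((build (.leaf k) U).minLeaf (nodeValue f)) (top t TA) = some τ ∧
      ∃ C B₂, Stage f k W S₀ τ.bananas t (U ++ C) [] B₂ TA TB ∧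
        (build (.leaf k) (U ++ C)).minLeaf (nodeValue f) =
          (build (.leaf k) U).minLeaf (nodeValue f) ∧
        ∀ e ∈ B₂ ++ TB, ¬ σ.Below f (some e.node) (some (top t TA)) := by
  set B₁ := B.filter fun e => σ.Below f (some e.node) (some (top t TA)) with hB₁
  set B₂ := B.filter fun e => ¬ σ.Below f (some e.node) (some (top t TA)) with hB₂
  have hB : B₁ ++ B₂ = B := filter_below_split hF σ _ h.splitB
  have hTA := h.splitA
  have hTB := h.splitB
  rw [← List.append_assoc] at hTA hTB
  have hhigh : ∀ e ∈ B₂ ++ TB, ¬ σ.Below f (some e.node) (some (top t TA)) := by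
    intro e he
    rcases List.mem_append.mp he with he | he
    · simpa using (List.mem_filter.mp he).2
    · exact fun hb => not_below_top hF σ hTB he (GlueState.below_trans hb hq)
  -- The maximum `q` separates: entries of `A` and `B₁` are below it, those of `TA`, `B₂` and `TB`
  -- are not.
  have hsep : ∀ x ∈ A ++ B₁, ∀ e ∈ [] ++ TA ++ (B₂ ++ TB),
      nodeValue f x.node < nodeValue f e.node := by
    intro x hx e he
    have hx' : (∃ d, x ∈ W d) ∧ σ.Below f (some x.node) (some (top t TA)) := by
      rcases List.mem_append.mp hx with hx | hx
      · exact ⟨⟨t, h.memA hx⟩, below_top hF σ h.splitA hx⟩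
      · exact ⟨⟨t.opp, h.memB (by rw [← hB]; simp [hx])⟩, by simpa using (List.mem_filter.mp hx).2⟩
    have he' : (∃ d, e ∈ W d) ∧ ¬ σ.Below f (some e.node) (some (top t TA)) := by
      rw [List.nil_append] at he
      rcases List.mem_append.mp he with he | he
      · exact ⟨⟨t, h.memTA he⟩, not_below_top hF σ hTA he⟩
      · refine ⟨⟨t.opp, ?_⟩, hhigh e he⟩
        rw [← h.splitB, ← hB]
        simp only [List.mem_append] at he ⊢
        tauto
    obtain ⟨⟨d, hx1⟩, hx2⟩ := hx'
    obtain ⟨⟨d', he1⟩, he2⟩ := he'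
    exact hF.lt_of_below hx1 he1 hx2 he2
  obtain ⟨C, hCA, hCB, hsorted, hCsep, hdeco⟩ :=
    h.exists_absorb hF (List.append_nil A) hB hsep
  have hfeet := h.feet_nodup hF
  have hmin : (build (.leaf k) (U ++ C)).minLeaf (nodeValue f) =
      (build (.leaf k) U).minLeaf (nodeValue f) := by
    rw [BinTree.minLeaf, hdeco]; rfl
  have hA1 : bananaAt σ.bananas .dummy = some (dummyBanana t B TB) :=
    bananaAt_lower hfeet h.dummyBanana_mem
  have hK1 : bananaAt σ.bananas ((build (.leaf k) U).minLeaf (nodeValue f)) =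
      some (coreBanana f k t U A TA) := bananaAt_lower hfeet h.coreBanana_mem
  simp only [undoInjury, hA1, hK1, Option.bind_eq_bind, Option.bind_some, Option.pure_def]
  refine ⟨_, rfl, C, B₂, ⟨?_, ?_, hsorted, hCsep, ?_, ?_, h.restA, h.restB⟩, hmin, hhigh⟩
  · rw [List.filter_append, hCA, ← h.splitA]
    simp
  · rw [List.filter_append, hCB, ← h.splitB, ← hB]
    simp
  · rw [hmin]
    intro e he
    exact h.passed e (by rw [← hB]; simp only [List.mem_append] at he ⊢; tauto)
  · obtain ⟨hd1, hd2⟩ := h.dummy_trail hF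
    obtain ⟨hc1, hc2⟩ := h.core_trail hF
    have hm := filter_map_below (f := f) σ (top t TA) B
    refine (modify_modify h.bananas hfeet rfl rfl ?_).trans ?_
    · rfl
    rw [hdeco, hd1, hd2, hc1, hc2, hm.1, hm.2, ← hB₁, ← hB₂]
    congr 1
    · refine (Eq.trans ?_ (dummyBanana_eq (t := t) (B := B₂) (TB := TB) ?_).symm)
      · refine Banana.ext_of_side t rfl rfl ?_ ?_ <;> simp [trails]
      · exact fun e he => hF.side _ e (h.memB (by rw [← hB]; simp [he]))
    · congr 1
      · refine Banana.ext_of_side t rfl rfl ?_ ?_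
        · simp [trails, OpenPath.close, OpenPath.addAll, hCA]
        · simp [trails, OpenPath.close, OpenPath.addAll, hCB]
      · rw [← hB]
        simp only [hang_append, hang_nil, add_zero]
        abel

end

/-! ### Undoing a fatality and undoing a scare -/

section

variable {f : ℕ → ℝ} {k : Node} {W : Side → List Entry} {S₀ : Multiset Banana} {S : List Banana}
  {t : Side} {U A B TA TB : List Entry}

/-- Spine maxima of the core are below all remaining entries by `sep`, nodes of hanging subtrees are
below their spine maximum, and `k` is below every spine maximum. -/
theorem Stage.below_top_of_mem_core (hF : Frame f k W) (h : Stage f k W S₀ S t U A B TA TB)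
    (σ : GlueState) {d : Side} {V T : List Entry} (hT : V ++ T = W d)
    (hTm : ∀ e ∈ T, e ∈ TA ∨ e ∈ TB) {x : Node} (hx : x ∈ k ::ₘ nodes U) :
    σ.Below f (some x) (some (top d T)) := by
  have hxr : x.IsReal := by
    refine hF.real _ ?_
    rw [← h.nodes_eq]
    simp only [Multiset.mem_cons, Multiset.mem_add] at hx ⊢
    tauto
  rcases top_real_or_root hF hT with ⟨-, h1⟩ | ⟨e, T', h0, h1, h2⟩ <;> rw [h1]
  · exact GlueState.below_root hxr d
  · rw [GlueState.below_real hxr h2]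
    have he := hTm e (by simp [h0])
    rcases Multiset.mem_cons.mp hx with rfl | hx
    · exact hF.leaf d e (by rw [← hT]; simp [h0])
    · obtain ⟨u, hu, hxu⟩ := mem_nodes.mp hx
      have hue := h.sep u hu e (by simp only [List.mem_append]; tauto)
      rcases hxu with rfl | hxu
      · exact hue
      · exact (hF.heap _ u (h.memU hu) x hxu).trans hue

/-- Mirror image of the injury: now `B` lies entirely below `q`, and `A` is split at `q`. The lower
part `A₁` joins the core, the upper part `A₂` is left to the dummy leaf, and the two trees exchange
their roles, which accounts for `t.opp` in the new stage. -/
theorem Stage.undoFatality_eq (hF : Frame f k W) (σ : GlueState)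
    (h : Stage f k W S₀ σ.bananas t U A B TA TB)
    (hq : σ.Below f (some (top t.opp TB)) (some (top t TA))) :
    ∃ τ, undoFatality f σ t.opp ((build (.leaf k) U).minLeaf (nodeValue f)) (top t.opp TB) =
        some τ ∧
      ∃ C A₂, Stage f k W S₀ τ.bananas t.opp (U ++ C) [] A₂ TB TA ∧
        (build (.leaf k) (U ++ C)).minLeaf (nodeValue f) =
          (build (.leaf k) U).minLeaf (nodeValue f) ∧
        ∀ e ∈ A₂ ++ TA, ¬ σ.Below f (some e.node) (some (top t.opp TB)) := by
  set A₁ := A.filter fun e => σ.Below f (some e.node) (some (top t.opp TB)) with hA₁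
  set A₂ := A.filter fun e => ¬ σ.Below f (some e.node) (some (top t.opp TB)) with hA₂
  have hA : A₁ ++ A₂ = A := filter_below_split hF σ _ h.splitA
  have hTA := h.splitA
  have hTB := h.splitB
  rw [← List.append_assoc] at hTA hTB
  have hhigh : ∀ e ∈ A₂ ++ TA, ¬ σ.Below f (some e.node) (some (top t.opp TB)) := by
    intro e he
    rcases List.mem_append.mp he with he | he
    · simpa using (List.mem_filter.mp he).2
    · exact fun hb => not_below_top hF σ hTA he (GlueState.below_trans hb hq)
  have hsep : ∀ x ∈ A₁ ++ B, ∀ e ∈ A₂ ++ TA ++ ([] ++ TB),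
      nodeValue f x.node < nodeValue f e.node := by
    intro x hx e he
    have hx' : (∃ d, x ∈ W d) ∧ σ.Below f (some x.node) (some (top t.opp TB)) := by
      rcases List.mem_append.mp hx with hx | hx
      · exact ⟨⟨t, h.memA (by rw [← hA]; simp [hx])⟩, by simpa using (List.mem_filter.mp hx).2⟩
      · exact ⟨⟨t.opp, h.memB hx⟩, below_top hF σ h.splitB hx⟩
    have he' : (∃ d, e ∈ W d) ∧ ¬ σ.Below f (some e.node) (some (top t.opp TB)) := by
      rw [List.nil_append] at he
      rcases List.mem_append.mp he with he | he
      · refine ⟨⟨t, ?_⟩, hhigh e he⟩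
        rw [← h.splitA, ← hA]
        simp only [List.mem_append] at he ⊢
        tauto
      · exact ⟨⟨t.opp, h.memTB he⟩, not_below_top hF σ hTB he⟩
    obtain ⟨⟨d, hx1⟩, hx2⟩ := hx'
    obtain ⟨⟨d', he1⟩, he2⟩ := he'
    exact hF.lt_of_below hx1 he1 hx2 he2
  obtain ⟨C, hCA, hCB, hsorted, hCsep, hdeco⟩ :=
    h.exists_absorb hF hA (List.append_nil B) hsep
  have hfeet := h.feet_nodup hF
  have hmin : (build (.leaf k) (U ++ C)).minLeaf (nodeValue f) =
      (build (.leaf k) U).minLeaf (nodeValue f) := by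
    rw [BinTree.minLeaf, hdeco]; rfl
  have hA1 : bananaAt σ.bananas .dummy = some (dummyBanana t B TB) :=
    bananaAt_lower hfeet h.dummyBanana_mem
  have hK1 : bananaAt σ.bananas ((build (.leaf k) U).minLeaf (nodeValue f)) =
      some (coreBanana f k t U A TA) := bananaAt_lower hfeet h.coreBanana_mem
  have hP : ∀ x ∈ (deco (nodeValue f) (build (.leaf k) U)).1.trail t,
      σ.Below f (some x) (some (top t.opp TB)) := by
    intro x hx
    refine h.below_top_of_mem_core hF σ hTB (fun e he => Or.inr he) ?_
    rw [← build_leaf_inorder, ← feet_deco (nodeValue f)]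
    exact Multiset.mem_add.mpr (Or.inl (OpenPath.mem_foot_of_mem_trail hx))
  -- The operation filters a whole trail of `κ`, consisting of a core trail followed by `A`. All
  -- core nodes are below `q`, so the cut falls inside `A`.
  have hP1 : ((deco (nodeValue f) (build (.leaf k) U)).1.trail t).filter
      (fun j => σ.Below f (some j) (some (top t.opp TB))) =
      (deco (nodeValue f) (build (.leaf k) U)).1.trail t := by
    rw [List.filter_eq_self]; simpa using hP
  have hP2 : ((deco (nodeValue f) (build (.leaf k) U)).1.trail t).filter
      (fun j => ¬ σ.Below f (some j) (some (top t.opp TB))) = [] := by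
    rw [List.filter_eq_nil_iff]; simpa using hP
  simp only [undoFatality, hA1, hK1, Option.bind_eq_bind, Option.bind_some, Option.pure_def,
    Side.opp_opp]
  refine ⟨_, rfl, C, A₂, ⟨?_, ?_, hsorted, ?_, ?_, ?_, h.restB, ?_⟩, hmin, hhigh⟩
  · rw [List.filter_append, hCB, ← h.splitB]
    simp
  · rw [Side.opp_opp, List.filter_append, hCA, ← h.splitA, ← hA]
    simp
  · intro u hu e he
    refine hCsep u hu e ?_
    simp only [List.mem_append] at he ⊢
    tauto
  · rw [hmin]
    intro e he
    exact h.passed e (by rw [← hA]; simp only [List.mem_append] at he ⊢; tauto)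
  · obtain ⟨hd1, hd2⟩ := h.dummy_trail hF
    obtain ⟨hc1, hc2⟩ := h.core_trail hF
    have hm := filter_map_below (f := f) σ (top t.opp TB) A
    refine (modify_modify h.bananas hfeet rfl rfl ?_).trans ?_
    · rfl
    rw [hdeco, hd1, hd2, hc1, hc2, List.filter_append, List.filter_append, hP1, hP2, hm.1, hm.2,
      ← hA₁, ← hA₂]
    congr 1
    · refine (Eq.trans ?_ (dummyBanana_eq (t := t.opp) (B := A₂) (TB := TA) ?_).symm)
      · refine Banana.ext_of_side t rfl ?_ ?_ ?_ <;> simp [trails, coreBanana, OpenPath.close]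
      · exact fun e he => by
          rw [Side.opp_opp]; exact hF.side _ e (h.memA (by rw [← hA]; simp [he]))
    · congr 1
      · refine Banana.ext_of_side t rfl rfl ?_ ?_
        · simp [trails, OpenPath.close, OpenPath.addAll, hCA]
        · simp [trails, OpenPath.close, OpenPath.addAll, hCB]
      · rw [← hA, Side.opp_opp]
        simp only [hang_append, hang_nil, add_zero]
        abel
  · rw [Side.opp_opp]; exact h.restA

/-- The core is untouched. Interchanging the minima makes the dummy path pass `e` and then whatever
the path of `μ` passed, while `μ` spans a banana with `e.node` just as the bottom of any hanging
subtree does. Since the minimum of the core is below `μ`, the condition `passed` persists. -/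
theorem Stage.undoScare_eq (hF : Frame f k W) (ε : ℝ) (σ : GlueState) {e : Entry}
    {V : List Entry} (h : Stage f k W S₀ σ.bananas t U A B TA (e :: V))
    (hμ : nodeValue f ((build (.leaf k) U).minLeaf (nodeValue f)) <
      nodeValue f (e.tree.minLeaf (nodeValue f))) :
    ∃ τ, undoScare f ε σ (e.tree.minLeaf (nodeValue f)) = some τ ∧
      Stage f k W S₀ τ.bananas t U A
        (B ++ e :: near (nodeValue f) (e.tree.minLeaf (nodeValue f)) V) TA
        (far (nodeValue f) (e.tree.minLeaf (nodeValue f)) V) := by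
  set μ := e.tree.minLeaf (nodeValue f) with hμdef
  set V₁ := near (nodeValue f) μ V with hV₁
  set V₂ := far (nodeValue f) μ V with hV₂
  have hV : V₁ ++ V₂ = V := near_append_far _ _ _
  have hTB := h.splitB
  rw [← List.append_assoc] at hTB
  have hTB' : (U.filter (fun e => e.side = t.opp) ++ B ++ [e]) ++ (V₁ ++ V₂) = W t.opp := by
    rw [hV, ← hTB]; simp
  have hrest := rest_cons t.opp e (hF.ne_of_mem_tail hTB)
  rw [← hμdef, ← hV₁, ← hV₂] at hrest
  have heW : e ∈ W t.opp := h.memTB (by simp)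
  have hside : e.side = t.opp := hF.side _ e heW
  have hVside : ∀ e' ∈ V₁, e'.side = t.opp := fun e' he' =>
    hF.side _ e' (h.memTB (by rw [← hV]; simp [he']))
  set De := deco (nodeValue f) e.tree with hDe
  set M := ((De.1.extend t e.node).addAll V₁).close (top t.opp V₂) with hM
  rw [hside, Side.opp_opp] at hrest
  have hfeet := h.feet_nodup hF
  have hbananas : (σ.bananas : Multiset Banana) = dummyBanana t B (e :: V) ::ₘ M ::ₘ
      (coreBanana f k t U A TA ::ₘ
        ((deco (nodeValue f) (build (.leaf k) U)).2 + hang (nodeValue f) A +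
          hang (nodeValue f) B + rest (nodeValue f) t TA +
          (De.2 + hang (nodeValue f) V₁ + rest (nodeValue f) t.opp V₂))) := by
    rw [h.bananas, hrest, Multiset.add_cons]
    rw [Multiset.cons_swap M]
    rfl
  have hMmem : M ∈ σ.bananas := by
    rw [← Multiset.mem_coe, hbananas]
    exact Multiset.mem_cons_of_mem (Multiset.mem_cons_self _ _)
  have hMt : M.trail t = De.1.trail t ++ [e.node] := by
    rw [hM]
    refine (OpenPath.addAll_trail_of_side_ne hVside (Side.opp_ne t)).trans ?_
    simp [OpenPath.extend]
  have hMs : M.trail t.opp = De.1.trail t.opp ++ V₁.map Entry.node := by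
    rw [hM]
    refine (OpenPath.addAll_trail_of_side hVside).trans ?_
    simp [OpenPath.extend]
  have hreal := hF.real_of_mem heW
  have hDlow : ∀ d, ∀ x ∈ De.1.trail d, x.IsReal ∧
      nodeValue f x < nodeValue f e.node := by
    intro d x hx
    have : x ∈ e.tree.inorder := by
      rw [← Multiset.mem_coe, ← feet_deco (nodeValue f)]
      exact Multiset.mem_add.mpr (Or.inl (OpenPath.mem_foot_of_mem_trail hx))
    exact ⟨hreal.2 x this, hF.heap _ e heW x this⟩
  have hVhigh : ∀ x ∈ V₁.map Entry.node, x.IsReal ∧ nodeValue f e.node < nodeValue f x := by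
    intro x hx
    obtain ⟨e', he', rfl⟩ := List.mem_map.mp hx
    refine ⟨(hF.real_of_mem (d := t.opp) (by rw [← hTB']; simp [he'])).1, ?_⟩
    have hs := hF.sorted t.opp
    rw [← hTB, List.pairwise_append, List.pairwise_cons] at hs
    exact hs.2.1.1 e' (by rw [← hV]; simp [he'])
  have hjt : e.node ∈ M.trail t := by rw [hMt]; simp
  have hjs : e.node ∉ M.trail t.opp := by
    rw [hMs, List.mem_append]
    rintro (hj | hj)
    · exact lt_irrefl _ (hDlow _ _ hj).2
    · exact lt_irrefl _ (hVhigh _ hj).2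
  -- Only real nodes are compared below, so the new value of the dummy leaf plays no role in how the
  -- trails of `μ` are split.
  set σ' : GlueState := { σ with alpha := nodeValue f μ - ε } with hσ'
  have hA1 : bananaAt σ.bananas .dummy = some (dummyBanana t B (e :: V)) :=
    bananaAt_lower hfeet h.dummyBanana_mem
  have hM1 : bananaAt σ.bananas μ = some M := bananaAt_lower hfeet hMmem
  have hup : (dummyBanana t B (e :: V)).upper = e.node := rfl
  have hor : e.node ∈ M.trail .left ∨ e.node ∈ M.trail .right := by
    cases t <;> simp [hjt]
  -- The subtree of `e` hangs on side `t.opp`, so the path that leaves it has `e.node` on its trail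
  -- on side `t`, namely as the last node; the entries `V₁` above it are on the other trail.
  have hd : (if e.node ∈ M.trail .left then Side.left else Side.right) = t := by
    cases t
    · exact if_pos hjt
    · exact if_neg hjs
  have hlot : (M.trail t).filter (fun u => σ'.Below f (some u) (some e.node)) =
      De.1.trail t := by
    rw [hMt, List.filter_append, List.filter_eq_self.mpr, List.filter_eq_nil_iff.mpr,
      List.append_nil]
    · simp [GlueState.below_irrefl]
    · intro x hx
      simpa using (GlueState.below_real (hDlow t x hx).1 hreal.1).mpr (hDlow t x hx).2
  have hlos : (M.trail t.opp).filter (fun u => σ'.Below f (some u) (some e.node)) =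
      De.1.trail t.opp := by
    rw [hMs, List.filter_append, List.filter_eq_self.mpr, List.filter_eq_nil_iff.mpr,
      List.append_nil]
    · intro x hx
      simpa using fun hb => ((GlueState.below_real (hVhigh x hx).1 hreal.1).mp hb).not_gt
        (hVhigh x hx).2
    · intro x hx
      simpa using (GlueState.below_real (hDlow _ x hx).1 hreal.1).mpr (hDlow _ x hx).2
  have hupt : (M.trail t).filter (fun u => σ'.Below f (some e.node) (some u)) = [] := by
    rw [hMt, List.filter_eq_nil_iff]
    intro x hx
    rcases List.mem_append.mp hx with hx | hx
    · simpa using fun hb => ((GlueState.below_real hreal.1 (hDlow t x hx).1).mp hb).not_gt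
        (hDlow t x hx).2
    · rw [List.mem_singleton.mp hx]
      simp [GlueState.below_irrefl]
  have hups : (M.trail t.opp).filter (fun u => σ'.Below f (some e.node) (some u)) =
      V₁.map Entry.node := by
    rw [hMs, List.filter_append, List.filter_eq_nil_iff.mpr, List.filter_eq_self.mpr,
      List.nil_append]
    · intro x hx
      simpa using (GlueState.below_real hreal.1 (hVhigh x hx).1).mpr (hVhigh x hx).2
    · intro x hx
      simpa using fun hb => ((GlueState.below_real hreal.1 (hDlow _ x hx).1).mp hb).not_gt
        (hDlow _ x hx).2
  simp only [undoScare, interchangeMinima, ← hσ', hA1, hM1, Option.bind_eq_bind,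
    Option.bind_some, Option.pure_def, hup, hor, if_true, hd]
  refine ⟨_, rfl, ⟨h.splitA, ?_, h.sorted, ?_, ?_, ?_, h.restA, ?_⟩⟩
  · rw [← h.splitB, List.append_assoc, List.cons_append, hV]
  · rw [List.append_assoc B, List.cons_append, hV]
    exact h.sep
  · intro e' he'
    simp only [List.mem_append, List.mem_cons] at he'
    rcases he' with he' | he' | rfl | he'
    · exact h.passed e' (by simp [he'])
    · exact h.passed e' (by simp [he'])
    · exact hμ
    · exact hμ.trans (lt_of_mem_near he')
  · obtain ⟨hd1, hd2⟩ := h.dummy_trail hF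
    refine (modify_modify (S := σ.bananas) hbananas hfeet rfl rfl ?_).trans ?_
    · rfl
    rw [hd1, hd2, hupt, hups]
    have h1 : (⟨.dummy, M.upper, trails t ([] ++ [])
        (B.map Entry.node ++ e.node :: V₁.map Entry.node)⟩ : Banana) =
        dummyBanana t (B ++ e :: V₁) V₂ := by
      rw [dummyBanana_eq]
      · simp [hM, OpenPath.close]
      · intro e' he'
        simp only [List.mem_append, List.mem_cons] at he'
        rcases he' with he' | rfl | he'
        · exact hF.side _ e' (h.memB he')
        · exact hside
        · exact hVside e' he'
    have h2 : (⟨μ, e.node, fun d => (M.trail d).filter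
        fun u => σ'.Below f (some u) (some e.node)⟩ : Banana) = De.1.close e.node :=
      Banana.ext_of_side t rfl rfl hlot hlos
    rw [h1, h2]
    change dummyBanana t (B ++ e :: V₁) V₂ ::ₘ _ = dummyBanana t (B ++ e :: V₁) V₂ ::ₘ _
    congr 1
    rw [Multiset.cons_swap]
    change coreBanana f k t U A TA ::ₘ _ = coreBanana f k t U A TA ::ₘ _
    congr 1
    rw [hang_append, hang_cons, ← hDe]
    simp only [← Multiset.singleton_add]
    abel
  · refine le_trans ?_ h.restB
    rw [hrest]
    exact (Multiset.le_add_left _ _).trans (Multiset.le_cons_self _ _)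

end

/-! ### The loop: invariant, progress, termination and final state -/

section

variable {f : ℕ → ℝ} {k : Node} {W : Side → List Entry} {S₀ : Multiset Banana} {S : List Banana}
  {t : Side} {U A B TA TB : List Entry}

/-- The state after a step at the current maximum on side `d`. -/
def GlueState.withNext (τ : GlueState) (cur : Side → Node) (d : Side) : GlueState :=
  { τ with cur := fun d' =>
      if d' = d then ((low τ.bananas (cur d)).bind (dth τ.bananas)).getD (cur d) else cur d' }

theorem GlueState.lower_side {σ : GlueState} {d : Side}
    (h : σ.Below f (some (σ.cur d)) (some (σ.cur d.opp))) :
    (if σ.Below f (some (σ.cur .left)) (some (σ.cur .right)) then Side.left else Side.right) =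
      d := by
  cases d
  · exact if_pos h
  · exact if_neg (lt_asymm h)

theorem glueStep_injury {ε : ℝ} {σ τ : GlueState} {d : Side}
    (h : σ.Below f (some (σ.cur d)) (some (σ.cur d.opp))) {a a' : Node}
    (ha : birth σ.bananas (σ.cur d) = some a) (ha' : birth σ.bananas (σ.cur d.opp) = some a')
    (hne : a ≠ .dummy) (hμ : σ.Below f (low σ.bananas (σ.cur d)) (some a))
    (hτ : undoInjury f σ d a (σ.cur d) = some τ) :
    glueStep f ε σ = some (τ.withNext σ.cur d) := by
  simp only [glueStep, GlueState.lower_side h, ha, ha', Option.bind_eq_bind, Option.bind_some,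
    Option.pure_def]
  simp [hne, hμ, hτ, GlueState.withNext]

theorem glueStep_fatality {ε : ℝ} {σ τ : GlueState} {d : Side}
    (h : σ.Below f (some (σ.cur d)) (some (σ.cur d.opp))) {a' : Node}
    (ha : birth σ.bananas (σ.cur d) = some .dummy)
    (ha' : birth σ.bananas (σ.cur d.opp) = some a')
    (hne : a' ≠ .dummy) (hμ : σ.Below f (low σ.bananas (σ.cur d)) (some a'))
    (hτ : undoFatality f σ d a' (σ.cur d) = some τ) :
    glueStep f ε σ = some (τ.withNext σ.cur d) := by
  simp only [glueStep, GlueState.lower_side h, ha, ha', Option.bind_eq_bind, Option.bind_some,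
    Option.pure_def]
  simp [hne, hμ, hτ, GlueState.withNext]

theorem glueStep_scare {ε : ℝ} {σ τ : GlueState} {d : Side}
    (h : σ.Below f (some (σ.cur d)) (some (σ.cur d.opp))) {a' μ : Node}
    (ha : birth σ.bananas (σ.cur d) = some .dummy)
    (ha' : birth σ.bananas (σ.cur d.opp) = some a')
    (hlow : low σ.bananas (σ.cur d) = some μ) (hμ : σ.Below f (some a') (some μ))
    (hτ : undoScare f ε σ μ = some τ) :
    glueStep f ε σ = some (τ.withNext σ.cur d) := by
  have hμ' : ¬ σ.Below f (some μ) (some a') := lt_asymm hμ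
  simp only [glueStep, GlueState.lower_side h, ha, ha', Option.bind_eq_bind, Option.bind_some,
    Option.pure_def, hlow]
  simp [hμ, hμ', hτ, GlueState.withNext]

/-- The invariant of the loop, with the number of maxima that are still ahead. -/
def GlueInv (f : ℕ → ℝ) (k : Node) (W : Side → List Entry) (S₀ : Multiset Banana)
    (σ : GlueState) (n : ℕ) : Prop :=
  ∃ t U A B TA TB, Stage f k W S₀ σ.bananas t U A B TA TB ∧
    (∀ e ∈ TA.head?, nodeValue f (e.tree.minLeaf (nodeValue f)) <
      nodeValue f ((build (.leaf k) U).minLeaf (nodeValue f))) ∧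
    σ.cur t = top t TA ∧ σ.cur t.opp = top t.opp TB ∧ TA.length + TB.length = n

theorem Stage.empty (hF : Frame f k W) {σ : GlueState}
    (h : Stage f k W S₀ σ.bananas t U A [] TA []) : σ.Empty t.opp := by
  have hb := fun d => below_upper (h.upper_nodup hF) h.dummyBanana_mem d
  constructor <;> refine (hb _).trans ?_ <;> rfl

theorem length_far_le (v : Node → ℝ) (a : Node) (V : List Entry) :
    (far v a V).length ≤ V.length := by
  conv_rhs => rw [← near_append_far v a V, List.length_append]
  omega

theorem far_head_lt (hF : Frame f k W) {d : Side} {e : Entry} {V V' : List Entry}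
    (hV : V' ++ e :: V = W d) :
    ∀ e' ∈ (far (nodeValue f) (e.tree.minLeaf (nodeValue f)) V).head?,
      nodeValue f (e'.tree.minLeaf (nodeValue f)) < nodeValue f (e.tree.minLeaf (nodeValue f)) := by
  intro e' he'
  refine lt_of_le_of_ne (le_of_mem_head_far he') (hF.ne_of_mem_tail hV e' ?_)
  rw [← near_append_far (nodeValue f) (e.tree.minLeaf (nodeValue f)) V]
  exact List.mem_append_right _ (List.mem_of_mem_head? he')

/-- Common ending of an injury and a fatality, where everything below `q` has been merged and the
core path ends at `q`. An ordinary `q` is absorbed by `Stage.advance`, and the new current maximum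
is where the path from its subtree ends. -/
theorem Stage.glueInv_withNext (hF : Frame f k W) {σ τ : GlueState}
    (h : Stage f k W S₀ τ.bananas t U [] B TA TB)
    (hhead : ∀ e ∈ TA.head?, nodeValue f (e.tree.minLeaf (nodeValue f)) <
      nodeValue f ((build (.leaf k) U).minLeaf (nodeValue f)))
    (hq : σ.Below f (some (top t TA)) (some (top t.opp TB)))
    (hhigh : ∀ e ∈ B ++ TB, ¬ σ.Below f (some e.node) (some (top t TA)))
    (cur : Side → Node) (hcur : cur t = top t TA) (hcur' : cur t.opp = top t.opp TB) :
    ∃ m, GlueInv f k W S₀ (τ.withNext cur t) m ∧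
      (m < TA.length + TB.length ∨ (τ.withNext cur t).Empty t.opp) := by
  have hnext : (τ.withNext cur t).cur t.opp = top t.opp TB := by
    simp [GlueState.withNext, hcur']
  cases TA with
  | nil =>
    -- Here `q` is the special root, above every ordinary node. Nothing can remain in `B` or `TB`,
    -- so the dummy tree is already empty; this replaces a decrease of the count.
    have hBr : ∀ e ∈ B ++ TB, False := by
      intro e he
      have he' : e ∈ W t.opp := by
        rw [← h.splitB]
        simp only [List.mem_append] at he ⊢
        tauto
      exact hhigh e he (GlueState.below_root (hF.real_of_mem he').1 t)
    have hnil := List.append_eq_nil_iff.mp (List.eq_nil_iff_forall_not_mem.mpr hBr)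
    obtain ⟨rfl, rfl⟩ := hnil
    refine ⟨0, ⟨t, U, [], [], [], [], h, by simp, ?_, hnext, rfl⟩, Or.inr ?_⟩
    · simp [GlueState.withNext, hcur, top, h.low_root hF]
    · exact Stage.empty hF (σ := τ.withNext cur t) h
  | cons e V =>
    have he := hhead e rfl
    have heW : e ∈ W t := h.memTA (by simp)
    have hsep : ∀ e' ∈ B ++ TB, nodeValue f e.node < nodeValue f e'.node := by
      intro e' he'
      have heW' : e' ∈ W t.opp := by
        rw [← h.splitB]
        simp only [List.mem_append] at he' ⊢
        tauto
      refine lt_of_le_of_ne (not_lt.mp fun hlt => hhigh e' he' ?_)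
        (h.node_ne hF (by simp) he')
      exact (GlueState.below_real (hF.real_of_mem heW').1 (hF.real_of_mem heW).1).mpr hlt
    obtain ⟨h', hmin⟩ := h.advance hF he hsep
    have hW : U.filter (fun e => e.side = t) ++ e :: V = W t := h.splitA
    obtain ⟨hl1, hl2⟩ := low_of_rest hF (h.feet_nodup hF) hW h.rest_le.1
    refine ⟨_, ⟨t, _, _, _, _, _, h', ?_, ?_, hnext, rfl⟩, Or.inl ?_⟩
    · rw [hmin]
      exact far_head_lt hF hW
    · simp [GlueState.withNext, hcur, top, hl1, hl2]
    · have := length_far_le (nodeValue f) (e.tree.minLeaf (nodeValue f)) V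
      simp only [List.length_cons]
      omega

/-- Every iteration succeeds and makes progress. -/
theorem GlueInv.step (hF : Frame f k W) (ε : ℝ) {σ : GlueState} {n : ℕ}
    (h : GlueInv f k W S₀ σ n) :
    ∃ τ m, glueStep f ε σ = some τ ∧ GlueInv f k W S₀ τ m ∧ (m < n ∨ ∃ s, τ.Empty s) := by
  obtain ⟨t, U, A, B, TA, TB, h, hhead, hcA, hcB, rfl⟩ := h
  have hTA := h.splitA
  have hTB := h.splitB
  rw [← List.append_assoc] at hTA hTB
  have hfeet := h.feet_nodup hF
  have hκ := h.minLeaf_real hF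
  have hbA : birth σ.bananas (top t TA) = some ((build (.leaf k) U).minLeaf (nodeValue f)) :=
    birth_upper (h.upper_nodup hF) h.coreBanana_mem
  have hbB : birth σ.bananas (top t.opp TB) = some .dummy :=
    birth_upper (h.upper_nodup hF) h.dummyBanana_mem
  -- If the core path has the lower end, the case is an injury: by `hhead`, or since nil is below
  -- everything real, `Low q` is below `κ`. Otherwise `q` is paired with the dummy leaf, and
  -- comparing `Low q` with the minimum of the core decides between fatality and scare.
  rcases h.below_or_below hF σ with hq | hq
  · obtain ⟨τ, hτ, C, B₂, h', hmin, hhigh⟩ := h.undoInjury_eq hF σ hq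
    obtain ⟨m, hinv, hm⟩ := h'.glueInv_withNext hF (by rw [hmin]; exact hhead) hq hhigh σ.cur
      hcA hcB
    refine ⟨_, m, glueStep_injury (d := t) (a' := .dummy) ?_ ?_ ?_ hκ.ne_dummy ?_ ?_, hinv, ?_⟩
    · rw [hcA, hcB]; exact hq
    · rw [hcA]; exact hbA
    · rw [hcB]; exact hbB
    · rw [hcA]
      cases TA with
      | nil =>
        rw [show top t [] = .root t from rfl, h.low_root hF]
        exact GlueState.none_below hκ
      | cons e V =>
        rw [top, (low_of_rest hF hfeet hTA h.rest_le.1).1]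
        refine (GlueState.below_real ?_ hκ).mpr (hhead e rfl)
        exact (hF.real_of_mem (h.memTA (List.mem_cons_self))).2 _ (minLeaf_mem _ _)
    · rw [hcA]; exact hτ
    · exact hm.imp id fun he => ⟨_, he⟩
  · have hd : σ.Below f (some (σ.cur t.opp)) (some (σ.cur t.opp.opp)) := by
      rw [Side.opp_opp, hcA, hcB]; exact hq
    have hd1 : birth σ.bananas (σ.cur t.opp) = some .dummy := by rw [hcB]; exact hbB
    have hd2 : birth σ.bananas (σ.cur t.opp.opp) =
        some ((build (.leaf k) U).minLeaf (nodeValue f)) := by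
      rw [Side.opp_opp, hcA]; exact hbA
    by_cases hμ : σ.Below f (low σ.bananas (top t.opp TB))
        (some ((build (.leaf k) U).minLeaf (nodeValue f)))
    · obtain ⟨τ, hτ, C, A₂, h', hmin, hhigh⟩ := h.undoFatality_eq hF σ hq
      have hhead' : ∀ e ∈ TB.head?, nodeValue f (e.tree.minLeaf (nodeValue f)) <
          nodeValue f ((build (.leaf k) (U ++ C)).minLeaf (nodeValue f)) := by
        intro e he
        cases TB with
        | nil => simp at he
        | cons e' V =>
          obtain rfl : e' = e := by simpa using he
          rw [top, (low_of_rest hF hfeet hTB h.rest_le.2).1] at hμ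
          rw [hmin]
          refine (GlueState.below_real ?_ hκ).mp hμ
          exact (hF.real_of_mem (h.memTB (List.mem_cons_self))).2 _ (minLeaf_mem _ _)
      obtain ⟨m, hinv, hm⟩ := h'.glueInv_withNext hF hhead' (by rw [Side.opp_opp]; exact hq)
        hhigh σ.cur hcB (by rw [Side.opp_opp]; exact hcA)
      refine ⟨_, m, glueStep_fatality hd hd1 hd2 hκ.ne_dummy ?_ ?_, hinv, ?_⟩
      · rw [hcB]; exact hμ
      · rw [hcB]; exact hτ
      · rw [add_comm]
        exact hm.imp id fun he => ⟨_, he⟩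
    · cases TB with
      | nil =>
        -- A scare cannot occur at a special root, whose `Low` is nil and hence below `κ`.
        rw [show top t.opp [] = .root t.opp from rfl, h.low_root hF] at hμ
        exact absurd (GlueState.none_below hκ) hμ
      | cons e V =>
        have hlow := (low_of_rest hF hfeet hTB h.rest_le.2).1
        have hreal : (e.tree.minLeaf (nodeValue f)).IsReal :=
          (hF.real_of_mem (h.memTB (List.mem_cons_self))).2 _ (minLeaf_mem _ _)
        rw [top, hlow, GlueState.below_real hreal hκ] at hμ
        have hμ' := lt_of_le_of_ne (not_lt.mp hμ) (h.minLeaf_ne hF (Or.inr (by simp))).symm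
        obtain ⟨τ, hτ, h'⟩ := h.undoScare_eq hF ε σ hμ'
        refine ⟨_, _, glueStep_scare hd hd1 hd2 (by rw [hcB]; exact hlow)
          ((GlueState.below_real hκ hreal).mpr hμ') hτ,
          ⟨t, _, _, _, _, _, h', hhead, ?_, ?_, rfl⟩, Or.inl ?_⟩
        · simp [GlueState.withNext, hcA]
        -- After the scare, `q` lies on the trail of the dummy leaf, so following `Low` and then
        -- `Dth` leads to the new upper end of the dummy banana.
        · have hm := h'.dummyBanana_mem
          have h1 : low τ.bananas e.node = some .dummy := by
            refine low_eq_lower (h'.feet_nodup hF) hm ?_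
            rw [dummyBanana, OpenPath.foot_close, OpenPath.foot_addAll]
            simp
          have h2 := dth_lower (h'.feet_nodup hF) hm
          have h3 : dth τ.bananas .dummy = some (top t.opp (far (nodeValue f)
            (e.tree.minLeaf (nodeValue f)) V)) := h2
          simp [GlueState.withNext, hcB, top, h1, h3]
        · have := length_far_le (nodeValue f) (e.tree.minLeaf (nodeValue f)) V
          simp only [List.length_cons]
          omega

theorem GlueInv.inSpine (hF : Frame f k W) {σ : GlueState} {n : ℕ}
    (h : GlueInv f k W (S : Multiset Banana) σ n) (s : Side) :
    InSpine S (.root s) s.opp (σ.cur s) ∧ InSpine σ.bananas (.root s) s.opp (σ.cur s) := by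
  obtain ⟨t, U, A, B, TA, TB, h, hhead, hcA, hcB, -⟩ := h
  have hTA := h.splitA
  have hTB := h.splitB
  rw [← List.append_assoc] at hTA hTB
  rcases Side.eq_or_eq_opp t s with rfl | rfl
  · rw [hcA]
    exact ⟨inSpine_top hF hTA h.restA, inSpine_top hF hTA h.rest_le.1⟩
  · rw [hcB]
    exact ⟨inSpine_top hF hTB h.restB, inSpine_top hF hTB h.rest_le.2⟩

/-- The loop terminates. -/
theorem GlueInv.exists_run (hF : Frame f k W) (ε : ℝ) {n : ℕ} : ∀ {σ : GlueState},
    GlueInv f k W S₀ σ n → ∃ (N : ℕ) (run : ℕ → GlueState), run 0 = σ ∧ 0 < N ∧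
      (∀ i < N, glueStep f ε (run i) = some (run (i + 1))) ∧
      (∀ i, 0 < i → i < N → ∀ s, ¬ (run i).Empty s) ∧
      (∃ s, (run N).Empty s) ∧ ∀ i ≤ N, ∃ m, GlueInv f k W S₀ (run i) m := by
  -- The number of remaining maxima decreases unless an empty tree appears. Emptiness is tested only
  -- after a step, which gives `0 < N`.
  induction n using Nat.strong_induction_on with
  | _ n ih =>
  intro σ h
  obtain ⟨τ, m, hτ, hinv, hm⟩ := h.step hF ε
  by_cases he : ∃ s, τ.Empty s
  · refine ⟨1, fun i => if i = 0 then σ else τ, rfl, one_pos, ?_, ?_, he, ?_⟩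
    · intro i hi
      obtain rfl : i = 0 := by omega
      exact hτ
    · intro i h0 h1; omega
    · intro i hi
      by_cases h0 : i = 0
      · exact ⟨n, by simpa [h0] using h⟩
      · exact ⟨m, by simpa [h0] using hinv⟩
  · obtain ⟨N, run, h0, h1, h2, h3, h4, h5⟩ := ih m (hm.resolve_right he) hinv
    refine ⟨N + 1, fun i => if i = 0 then σ else run (i - 1), rfl, Nat.succ_pos _, ?_, ?_, ?_, ?_⟩
    · intro i hi
      cases i with
      | zero => simpa [h0] using hτ
      | succ i => simpa using h2 i (by omega)
    · intro i hi0 hi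
      obtain ⟨j, rfl⟩ : ∃ j, i = j + 1 := ⟨i - 1, by omega⟩
      cases j with
      | zero => simpa [h0] using fun s hs => he ⟨s, hs⟩
      | succ j => simpa using h3 (j + 1) (by omega) (by omega)
    · simpa using h4
    · intro i hi
      cases i with
      | zero => exact ⟨n, by simpa using h⟩
      | succ i => simpa using h5 i (by omega)

/-- When a tree is empty, the bananas of the other tree are those of the merged tree. -/
theorem GlueInv.result_eq (hF : Frame f k W) {σ : GlueState} {n : ℕ}
    (h : GlueInv f k W S₀ σ n) (he : ∃ s, σ.Empty s) :
    ∃ U : List Entry, (∀ d, U.filter (fun e => e.side = d) = W d) ∧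
      U.Pairwise (fun e e' => nodeValue f e.node < nodeValue f e'.node) ∧
      (σ.result : Multiset Banana) =
        (deco (nodeValue f) (build (.leaf k) U)).1.close (.root σ.survivor) ::ₘ
          (deco (nodeValue f) (build (.leaf k) U)).2 := by
  obtain ⟨t, U, A, B, TA, TB, h, hhead, -, -, -⟩ := h
  have hfeet := h.feet_nodup hF
  have hupper := h.upper_nodup hF
  have hTB := h.splitB
  rw [← List.append_assoc] at hTB
  -- If both nodes below the root are the dummy leaf, the banana of this root is the dummy banana,
  -- by uniqueness of feet. Its upper end is a special root only if `TB` is empty, and a nonempty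
  -- `B` would put a real node directly below the root.
  have key : ∀ {d : Side}, σ.Empty d → d = t.opp ∧ TB = [] ∧ B = [] := by
    intro d hd
    obtain ⟨X, hX, hXd⟩ := Option.map_eq_some_iff.mp hd.1
    have hXS := List.mem_of_find?_eq_some hX
    have hXu : X.upper = .root d := by simpa using List.find?_some hX
    have hlast : ∀ e, ((X.trail e).getLast?).getD X.lower = .dummy := by
      intro e
      have h2 : below σ.bananas (.root d) e = some .dummy := by
        cases e
        · exact hd.1
        · exact hd.2
      rw [← hXu, below_upper hupper hXS] at h2
      exact Option.some.inj h2
    have hfoot : Node.dummy ∈ X.foot := by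
      have h1 := hlast .left
      cases hl : (X.trail .left).getLast? with
      | none => rw [hl] at h1; rw [← show X.lower = .dummy from h1]; exact X.lower_mem_foot
      | some y =>
        rw [hl] at h1
        obtain rfl : y = .dummy := h1
        exact Banana.mem_foot_of_mem_trail (List.mem_of_mem_getLast? hl)
    have hXe : X = dummyBanana t B TB :=
      eq_of_mem_foot hfeet hXS h.dummyBanana_mem hfoot (Banana.lower_mem_foot _)
    subst hXe
    have hu : top t.opp TB = .root d := hXu
    rcases top_real_or_root hF hTB with ⟨h0, h1⟩ | ⟨e, T', h0, h1, h2⟩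
    · rw [h1] at hu
      refine ⟨(Node.root.inj hu).symm, h0, ?_⟩
      have h3 := hlast t.opp
      rw [(h.dummy_trail hF).2] at h3
      by_contra hB
      have hne : B.map Entry.node ≠ [] := by simpa using hB
      rw [List.getLast?_eq_some_getLast hne] at h3
      obtain ⟨b, hb, hb'⟩ := List.mem_map.mp (List.getLast_mem hne)
      have hbr := (hF.real_of_mem (h.memB hb)).1
      rw [hb'] at hbr
      exact hbr.ne_dummy h3
    · rw [h1] at hu
      exact absurd hu (h2.ne_root d)
  obtain ⟨d, hd⟩ := he
  obtain ⟨rfl, rfl, rfl⟩ := key hd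
  have hsurv : σ.survivor = t := by
    have hnot : ¬ σ.Empty t := fun ht => Side.ne_opp t (key ht).1
    cases t
    · exact if_neg hnot
    · exact if_pos hd
  have hnd : (((build (.leaf k) U).inorder + nodes (A ++ TA) : Multiset Node).map
      (nodeValue f)).Nodup := by
    have := hF.nodup
    rw [← h.nodes_eq] at this
    rw [build_leaf_inorder, nodes_append, Multiset.cons_add, ← add_assoc]
    simpa using this
  have hsplitA := h.splitA
  have hsplitB := h.splitB
  have hfil : ∀ d, (U ++ (A ++ TA)).filter (fun e => e.side = d) = W d := by
    have hs : ∀ e ∈ A ++ TA, e.side = t := by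
      intro e he
      refine hF.side t e ?_
      rw [← hsplitA]
      exact List.mem_append_right _ he
    intro d
    rw [List.filter_append]
    rcases Side.eq_or_eq_opp t d with rfl | rfl
    · have : (A ++ TA).filter (fun e => e.side = d) = A ++ TA := by
        rw [List.filter_eq_self]; simpa using hs
      rw [this, hsplitA]
    · have : (A ++ TA).filter (fun e => e.side = t.opp) = [] := by
        rw [List.filter_eq_nil_iff]
        intro e he
        simp [hs e he]
      rw [this, ← hsplitB]
      rfl
  -- Nothing of the other tree remains, so what is left of tree `t` can be put on top of the core as
  -- it is. Its decomposition is then already present: the core path passes `A` and ends at the head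
  -- of `TA`.
  refine ⟨U ++ (A ++ TA), hfil, ?_, ?_⟩
  · rw [List.pairwise_append]
    refine ⟨h.sorted, ?_, fun u hu e he => h.sep u hu e (by simpa using he)⟩
    refine (hF.sorted t).sublist ?_
    rw [← hsplitA]
    exact List.sublist_append_right _ _
  · rw [hsurv, build_append, deco_build hnd,
      foldl_step_append_close t _ (fun e he => h.passed e (by simpa using he)) hhead]
    have hb := h.bananas
    rw [hang_nil, add_zero, show rest (nodeValue f) t.opp [] = 0 from rfl, add_zero] at hb
    rw [hb] at hfeet hupper
    rw [GlueState.result, hsurv, ← Multiset.filter_coe, hb, Multiset.filter_cons_of_neg,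
      Multiset.filter_eq_self.mpr]
    -- Discarding removes just the dummy banana: no other banana has the same lower end, and none
    -- has the same upper end.
    · intro X hX
      refine ⟨lower_ne_of_feet_nodup hfeet X hX, fun hu => ?_⟩
      rw [Multiset.map_cons, Multiset.nodup_cons] at hupper
      exact hupper.1 (Multiset.mem_map.mpr ⟨X, hX, hu⟩)
    · exact fun hX => hX.1 rfl

end

/-! ### Heap-ordered trees -/

namespace BinTree

variable {v : Node → ℝ}

theorem top_mem_inorder (T : BinTree) : T.top ∈ T.inorder := by
  cases T <;> simp [top, inorder]

theorem HeapOrdered.eq_or_lt {T : BinTree} (h : T.HeapOrdered v) :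
    ∀ x ∈ T.inorder, x = T.top ∨ v x < v T.top := by
  induction T with
  | leaf a => simp [inorder, top]
  | node l b r ihl ihr =>
    obtain ⟨h1, h2, h3, h4⟩ := h
    intro x hx
    simp only [inorder, List.mem_append, List.mem_cons] at hx
    rcases hx with hx | rfl | hx
    · right
      rcases ihl h3 x hx with rfl | hx
      · exact h1
      · exact hx.trans h1
    · exact Or.inl rfl
    · right
      rcases ihr h4 x hx with rfl | hx
      · exact h2
      · exact hx.trans h2

theorem HeapOrdered.le {T : BinTree} (h : T.HeapOrdered v) {x : Node} (hx : x ∈ T.inorder) :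
    v x ≤ v T.top := by
  rcases h.eq_or_lt x hx with rfl | h'
  · exact le_rfl
  · exact h'.le

theorem inorder_ne_nil (T : BinTree) : T.inorder ≠ [] := List.ne_nil_of_mem T.top_mem_inorder

/-- A heap-ordered tree is determined by its in-order sequence. -/
theorem HeapOrdered.unique {T T' : BinTree} (h : T.HeapOrdered v) (h' : T'.HeapOrdered v)
    (he : T.inorder = T'.inorder) : T = T' := by
  induction T generalizing T' with
  | leaf a =>
    cases T' with
    | leaf a' => simpa [inorder] using he
    | node l b r =>
      have := congrArg List.length he
      have := List.length_pos_iff.mpr l.inorder_ne_nil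
      simp [inorder] at *
      omega
  | node l b r ihl ihr =>
    cases T' with
    | leaf a' =>
      have := congrArg List.length he
      have := List.length_pos_iff.mpr l.inorder_ne_nil
      simp [inorder] at *
      omega
    | node l' b' r' =>
      -- Both roots are the unique maximum of the common in-order sequence.
      have hb : b = b' := by
        have h1 := h.eq_or_lt b' (by rw [he]; simp [inorder])
        have h2 := h'.eq_or_lt b (by rw [← he]; simp [inorder])
        simp only [top] at h1 h2
        rcases h1 with h1 | h1
        · exact h1.symm
        · rcases h2 with h2 | h2
          · exact h2
          · exact absurd h1 h2.not_gt
      subst hb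
      obtain ⟨h1, h2, h3, h4⟩ := h
      obtain ⟨h1', h2', h3', h4'⟩ := h'
      simp only [inorder] at he
      have hl : b ∉ l.inorder := fun hb => ((h3.le hb).trans_lt h1).false
      have hl' : b ∉ l'.inorder := fun hb => ((h3'.le hb).trans_lt h1').false
      -- As `b` occurs in neither left subtree, the sequence can be cut at `b` in only one way.
      obtain ⟨he1, he2⟩ : l.inorder = l'.inorder ∧ r.inorder = r'.inorder := by
        rcases List.append_eq_append_iff.mp he with ⟨c, hc, hc'⟩ | ⟨c, hc, hc'⟩ <;> cases c <;>
          simp_all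
      rw [ihl h3 h3' he1, ihr h4 h4' he2]

theorem heapOrdered_join {s : Side} {O I : BinTree} {b : Node} :
    (join s O b I).HeapOrdered v ↔
      (v O.top < v b ∧ O.HeapOrdered v) ∧ v I.top < v b ∧ I.HeapOrdered v := by
  cases s <;> simp only [join, HeapOrdered] <;> tauto

@[simp] theorem top_join (s : Side) (O : BinTree) (b : Node) (I : BinTree) :
    (join s O b I).top = b := by
  cases s <;> rfl

end BinTree

/-- Along a stack, heap order reduces to increasing spine maxima, since the top of the tree below an
entry is the previous spine maximum or the top of `T`. The criterion does not see sides, so a sorted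
merge of two heap-ordered stacks is heap-ordered. -/
theorem heapOrdered_build {v : Node → ℝ} {T : BinTree} {W : List Entry} :
    (build T W).HeapOrdered v ↔ T.HeapOrdered v ∧
      (∀ e ∈ W, v e.tree.top < v e.node ∧ e.tree.HeapOrdered v ∧ v T.top < v e.node) ∧
      W.Pairwise (fun e e' => v e.node < v e'.node) := by
  induction W using List.reverseRecOn with
  | nil => simp [build]
  | append_singleton W e ih =>
    have hmem : ∀ w ∈ W, w.node ∈ (build T W).inorder := by
      intro w hw
      rw [← Multiset.mem_coe, inorder_build]
      exact Multiset.mem_add.mpr (Or.inr (mem_nodes.mpr ⟨w, hw, Or.inl rfl⟩))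
    have hmemT : T.top ∈ (build T W).inorder := by
      rw [← Multiset.mem_coe, inorder_build]
      exact Multiset.mem_add.mpr (Or.inl T.top_mem_inorder)
    have htop : (build T W).top = T.top ∨ ∃ w ∈ W, (build T W).top = w.node := by
      rcases List.eq_nil_or_concat W with rfl | ⟨W', w, rfl⟩
      · exact Or.inl rfl
      · refine Or.inr ⟨w, by simp, ?_⟩
        rw [List.concat_eq_append, build_concat, BinTree.top_join]
    rw [build_concat, BinTree.heapOrdered_join, ih, List.pairwise_append]
    constructor
    · rintro ⟨⟨h1, h2⟩, h3, h4⟩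
      have hheap := ih.mpr h4
      refine ⟨h4.1, ?_, h4.2.2, List.pairwise_singleton _ _, ?_⟩
      · intro e' he'
        rcases List.mem_append.mp he' with he' | he'
        · exact h4.2.1 e' he'
        · rw [List.mem_singleton.mp he']
          exact ⟨h1, h2, (hheap.le hmemT).trans_lt h3⟩
      · intro w hw e' he'
        rw [List.mem_singleton.mp he']
        exact (hheap.le (hmem w hw)).trans_lt h3
    · rintro ⟨h1, h2, h3, -, h4⟩
      have he := h2 e (by simp)
      refine ⟨⟨he.1, he.2.1⟩, ?_, h1, fun e' he' => h2 e' (by simp [he']), h3⟩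
      rcases htop with ht | ⟨w, hw, ht⟩
      · rw [ht]; exact he.2.2
      · rw [ht]; exact h4 w hw e (by simp)

/-! ### Unfolding a tree along its spine, and in-order sequences of stacks -/

/-- The leaf at the end of a spine, and the entries of the spine from bottom to top; the spine of
tree `d` faces the other side. -/
def spine (d : Side) : BinTree → Node × List Entry
  | .leaf a => (a, [])
  | .node l b r =>
    match d with
    | .left => ((spine .left r).1, (spine .left r).2 ++ [⟨.left, b, l⟩])
    | .right => ((spine .right l).1, (spine .right l).2 ++ [⟨.right, b, r⟩])

theorem build_spine (d : Side) (T : BinTree) : build (.leaf (spine d T).1) (spine d T).2 = T := by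
  induction T with
  | leaf a => rfl
  | node l b r ihl ihr =>
    cases d
    · simp only [spine, build_concat, BinTree.join, ihr]
    · simp only [spine, build_concat, BinTree.join, ihl]

theorem side_spine (d : Side) (T : BinTree) : ∀ e ∈ (spine d T).2, e.side = d := by
  induction T with
  | leaf a => simp [spine]
  | node l b r ihl ihr =>
    cases d <;>
    · intro e he
      simp only [spine, List.mem_append, List.mem_singleton] at he
      rcases he with he | rfl
      · first | exact ihl e he | exact ihr e he
      · rfl

/-- The part of the in-order sequence on the outer side of a spine. -/
def outer (d : Side) : List Entry → List Node
  | [] => []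
  | e :: W =>
    match d with
    | .left => if e.side = .left then outer .left W ++ (e.tree.inorder ++ [e.node])
        else outer .left W
    | .right => if e.side = .right then e.node :: (e.tree.inorder ++ outer .right W)
        else outer .right W

/-- Each entry surrounds what is below it from one side, so the two sides grow independently of each
other. -/
theorem inorder_build_eq (T : BinTree) (W : List Entry) :
    (build T W).inorder = outer .left W ++ T.inorder ++ outer .right W := by
  induction W generalizing T with
  | nil => simp [build, outer]
  | cons e W ih =>
    have : build T (e :: W) = build (.join e.side e.tree e.node T) W := rfl
    rw [this, ih]
    cases hs : e.side <;> simp [BinTree.join, BinTree.inorder, outer, hs]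

/-- Entries of the other side contribute nothing. Thus the way in which two one-sided lists are
interleaved does not affect the in-order sequence. -/
theorem outer_filter (d : Side) (W : List Entry) :
    outer d (W.filter fun e => e.side = d) = outer d W := by
  induction W with
  | nil => rfl
  | cons e W ih =>
    cases d
    · by_cases hs : e.side = .left <;> simp [outer, hs, ih]
    · by_cases hs : e.side = .right <;> simp [outer, hs, ih]

theorem outer_opp {d : Side} {W : List Entry} (h : ∀ e ∈ W, e.side = d) : outer d.opp W = [] := by
  rw [← outer_filter, List.filter_eq_nil_iff.mpr]
  · rfl
  · intro e he
    simp [h e he]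

/-- Attach the nodes `Y`, listed from outside to inside, at the inner end of the sequence `X` on
side `d`. -/
def attach (d : Side) (X Y : List Node) : List Node :=
  match d with
  | .left => X ++ Y
  | .right => Y.reverse ++ X

theorem attach_inj {d : Side} {X X' Y Y' : List Node} (h : attach d X Y = attach d X' Y')
    (hl : Y.length = Y'.length) : X = X' ∧ Y = Y' := by
  cases d
  · exact List.append_inj' h hl
  · obtain ⟨h1, h2⟩ := List.append_inj h (by simpa using hl)
    exact ⟨h2, List.reverse_injective h1⟩

theorem inorder_build_side {d : Side} {W : List Entry} (h : ∀ e ∈ W, e.side = d) (k : Node) :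
    (build (.leaf k) W).inorder = attach d (outer d W) [k] := by
  have := outer_opp h
  rw [inorder_build_eq]
  cases d <;> simp_all [attach, BinTree.inorder, Side.opp]

theorem inorder_build_join {d : Side} {W : List Entry} (h : ∀ e ∈ W, e.side = d) (O : BinTree)
    (b k : Node) : (build (.join d O b (.leaf k)) W).inorder =
      attach d (build O W).inorder [b, k] := by
  have := outer_opp h
  rw [inorder_build_eq, inorder_build_eq]
  cases d <;> simp_all [attach, BinTree.inorder, Side.opp, BinTree.join]

/-! ### Dependence on the values -/

/-- Needed because the maps of a part and of the whole list differ at the hook next to the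
connection; they agree on the critical points that survive pre-processing. -/
theorem decompose_congr {v v' : Node → ℝ} {T : BinTree} (h : ∀ x ∈ T.inorder, v x = v' x) :
    decompose v T = decompose v' T := by
  induction T with
  | leaf a => rfl
  | node l b r ihl ihr =>
    simp only [BinTree.inorder, List.mem_append, List.mem_cons] at h
    have hl := ihl fun x hx => h x (Or.inl hx)
    have hr := ihr fun x hx => h x (Or.inr (Or.inr hx))
    have h1 := h _ (Or.inl (minLeaf_mem v l))
    have h2 := h _ (Or.inr (Or.inr (minLeaf_mem v r)))
    simp only [BinTree.minLeaf, deco, hl, hr] at h1 h2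
    simp only [decompose, hl, hr, h1, h2]

theorem deco_congr {v v' : Node → ℝ} {T : BinTree} (h : ∀ x ∈ T.inorder, v x = v' x) :
    deco v T = deco v' T := by
  simp only [deco, decompose_congr h]

theorem minLeaf_congr {v v' : Node → ℝ} {T : BinTree} (h : ∀ x ∈ T.inorder, v x = v' x) :
    v (T.minLeaf v) = v' (T.minLeaf v') := by
  rw [h _ (minLeaf_mem v T), BinTree.minLeaf, deco_congr h]; rfl

theorem hang_congr {v v' : Node → ℝ} {W : List Entry} (h : ∀ x ∈ nodes W, v x = v' x) :
    hang v W = hang v' W := by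
  induction W with
  | nil => rfl
  | cons e W ih =>
    simp only [nodes_cons, Multiset.mem_cons, Multiset.mem_add, Multiset.mem_coe] at h
    rw [hang_cons, hang_cons, ih fun x hx => h x (by tauto), deco_congr fun x hx => h x (by tauto)]

theorem foldl_step_congr {v v' : Node → ℝ} {W : List Entry} {X : Deco}
    (h : ∀ x ∈ nodes W, v x = v' x) (hX : v X.1.lower = v' X.1.lower) :
    W.foldl (Deco.step v) X = W.foldl (Deco.step v') X := by
  induction W generalizing X with
  | nil => rfl
  | cons e W ih =>
    simp only [nodes_cons, Multiset.mem_cons, Multiset.mem_add, Multiset.mem_coe] at h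
    have he : ∀ x ∈ e.tree.inorder, v x = v' x := fun x hx => h x (by tauto)
    have hstep : X.step v e = X.step v' e := by
      simp only [Deco.step, minLeaf_congr he, hX, Deco.turn, Deco.pass, deco_congr he]
    rw [List.foldl_cons, List.foldl_cons, hstep]
    refine ih (fun x hx => h x (by tauto)) ?_
    rw [← hstep]
    unfold Deco.step
    split_ifs
    · exact he _ (minLeaf_mem v e.tree)
    · exact hX

theorem rest_congr {v v' : Node → ℝ} (s : Side) {W : List Entry}
    (h : ∀ x ∈ nodes W, v x = v' x) : rest v s W = rest v' s W := by
  cases W with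
  | nil => rfl
  | cons e W =>
    simp only [nodes_cons, Multiset.mem_cons, Multiset.mem_add, Multiset.mem_coe] at h
    have he : ∀ x ∈ e.tree.inorder, v x = v' x := fun x hx => h x (by tauto)
    simp only [rest]
    rw [foldl_step_congr (v' := v') (fun x hx => h x (by tauto)), deco_congr he]
    exact he _ (minLeaf_mem v e.tree)

theorem minLeaf_le {v : Node → ℝ} {T : BinTree} (hT : T.HeapOrdered v) :
    ∀ x ∈ T.inorder, v (T.minLeaf v) ≤ v x := by
  induction T with
  | leaf a => simp [BinTree.minLeaf, deco, decompose, BinTree.inorder]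
  | node l b r ihl ihr =>
    obtain ⟨h1, h2, h3, h4⟩ := hT
    have hl := ihl h3
    have hr := ihr h4
    have hb := (hl _ l.top_mem_inorder).trans h1.le
    have hb' := (hr _ r.top_mem_inorder).trans h2.le
    simp only [BinTree.minLeaf, deco] at hl hr hb hb'
    simp only [BinTree.minLeaf, deco, decompose, BinTree.inorder]
    intro x hx
    rw [List.mem_append, List.mem_cons] at hx
    split_ifs with hlt
    · rcases hx with hx | rfl | hx
      · exact hl x hx
      · exact hb
      · exact hlt.le.trans (hr x hx)
    · rcases hx with hx | rfl | hx
      · exact (not_lt.mp hlt).trans (hl x hx)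
      · exact hb'
      · exact hr x hx

/-! ### Removing a pair of nodes -/

/-- Remove the node `b` from the trails. -/
def OpenPath.erase (b : Node) (P : OpenPath) : OpenPath :=
  ⟨P.lower, fun d => (P.trail d).filter fun u => u ≠ b⟩

/-- Remove the node `b` from the trails. -/
def Banana.erase (b : Node) (B : Banana) : Banana :=
  { B with trail := fun d => (B.trail d).filter fun u => u ≠ b }

/-- Remove the banana with lower end `h`, and the node `b` from all trails. -/
def eraseBananas (b h : Node) (M : Multiset Banana) : Multiset Banana :=
  (M.filter fun B => B.lower ≠ h).map (Banana.erase b)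

@[simp] theorem eraseBananas_add (b h : Node) (M M' : Multiset Banana) :
    eraseBananas b h (M + M') = eraseBananas b h M + eraseBananas b h M' := by
  simp [eraseBananas]

theorem eraseBananas_cons (b h : Node) {B : Banana} (M : Multiset Banana) (hB : B.lower ≠ h) :
    eraseBananas b h (B ::ₘ M) = B.erase b ::ₘ eraseBananas b h M := by
  simp [eraseBananas, hB]

theorem OpenPath.erase_of_notMem {b : Node} {P : OpenPath} (h : b ∉ P.foot) : P.erase b = P := by
  have : ∀ d, (P.trail d).filter (fun u => u ≠ b) = P.trail d := fun d => by
    rw [List.filter_eq_self]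
    intro u hu
    simpa using fun hb : u = b => h (hb ▸ OpenPath.mem_foot_of_mem_trail hu)
  simp only [OpenPath.erase, this]

theorem Banana.erase_of_notMem {b : Node} {B : Banana} (h : b ∉ B.foot) : B.erase b = B := by
  have : ∀ d, (B.trail d).filter (fun u => u ≠ b) = B.trail d := fun d => by
    rw [List.filter_eq_self]
    intro u hu
    simpa using fun hb : u = b => h (hb ▸ Banana.mem_foot_of_mem_trail hu)
  simp only [Banana.erase, this]

theorem eraseBananas_of_notMem {b h : Node} {M : Multiset Banana} (hb : b ∉ feet M)
    (hh : h ∉ feet M) : eraseBananas b h M = M := by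
  rw [eraseBananas, Multiset.filter_eq_self.mpr]
  · conv_rhs => rw [← Multiset.map_id M]
    exact Multiset.map_congr rfl fun B hB =>
      Banana.erase_of_notMem fun hx => hb (mem_feet.mpr ⟨B, hB, hx⟩)
  · intro B hB he
    exact hh (mem_feet.mpr ⟨B, hB, he ▸ B.lower_mem_foot⟩)

/-- Removing a pair of nodes commutes with adding entries that do not contain them. -/
theorem foldl_step_erase {v : Node → ℝ} {b h : Node} {W : List Entry} {X : Deco}
    (hb : b ∉ nodes W) (hh : h ∉ nodes W) (hX : X.1.lower ≠ h) :
    let Y := W.foldl (Deco.step v) X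
    W.foldl (Deco.step v) (X.1.erase b, eraseBananas b h X.2) =
        (Y.1.erase b, eraseBananas b h Y.2) ∧ Y.1.lower ≠ h := by
  induction W generalizing X with
  | nil => exact ⟨rfl, hX⟩
  | cons e W ih =>
    simp only [nodes_cons, Multiset.mem_cons, Multiset.mem_add, Multiset.mem_coe, not_or]
      at hb hh
    obtain ⟨hb1, hb2, hb3⟩ := hb
    obtain ⟨hh1, hh2, hh3⟩ := hh
    have hfeet := feet_deco v e.tree
    have hfoot : ∀ x ∉ e.tree.inorder,
        x ∉ (deco v e.tree).1.foot ∧ x ∉ feet (deco v e.tree).2 := by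
      intro x hx
      rw [← Multiset.mem_coe, ← hfeet, Multiset.mem_add, not_or] at hx
      exact hx
    have e1 := OpenPath.erase_of_notMem (hfoot b hb2).1
    have e2 := eraseBananas_of_notMem (hfoot b hb2).2 (hfoot h hh2).2
    have e3 : (deco v e.tree).1.lower ≠ h := fun he => hh2 (he ▸ minLeaf_mem v e.tree)
    have e4 : (((deco v e.tree).1.close e.node).erase b) = (deco v e.tree).1.close e.node :=
      Banana.erase_of_notMem (hfoot b hb2).1
    have hext : ∀ (P : OpenPath) (d : Side),
        (P.extend d e.node).erase b = (P.erase b).extend d e.node := by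
      intro P d
      simp only [OpenPath.erase, OpenPath.extend, OpenPath.mk.injEq, true_and]
      funext d'
      split_ifs
      · rw [List.filter_append]
        congr 1
        simpa using Ne.symm hb1
      · rfl
    have hstep : Deco.step v (X.1.erase b, eraseBananas b h X.2) e =
        ((X.step v e).1.erase b, eraseBananas b h (X.step v e).2) ∧
        (X.step v e).1.lower ≠ h := by
      have hlow : (X.1.erase b).lower = X.1.lower := rfl
      unfold Deco.step
      simp only [hlow]
      split_ifs
      · refine ⟨?_, e3⟩
        simp only [Deco.turn, hext, e1]
        rw [eraseBananas_cons b h _ hX, eraseBananas_add, e2]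
        rfl
      · refine ⟨?_, hX⟩
        simp only [Deco.pass, hext]
        rw [eraseBananas_cons b h _ e3, eraseBananas_add, e2, e4]
    rw [List.foldl_cons, List.foldl_cons, hstep.1]
    exact ih hb3 hh3 hstep.2

/-- Removing a maximum next to the end of a sequence together with the last minimum. -/
theorem deco_build_erase {v : Node → ℝ} {d : Side} {O : BinTree} {b h : Node} {W : List Entry}
    (hnd : (((build (.join d O b (.leaf h)) W).inorder : Multiset Node).map v).Nodup)
    (hlt : v (O.minLeaf v) < v h) (β : Node) :
    eraseBananas b h ((deco v (build (.join d O b (.leaf h)) W)).1.close β ::ₘ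
        (deco v (build (.join d O b (.leaf h)) W)).2) =
      (deco v (build O W)).1.close β ::ₘ (deco v (build O W)).2 := by
  have hnd1 := hnd
  rw [inorder_build] at hnd1
  have hnd2 : (((O.inorder : Multiset Node) + nodes W).map v).Nodup := by
    refine Multiset.nodup_of_le (Multiset.map_le_map ?_) hnd1
    rw [inorder_join, add_comm (O.inorder : Multiset Node), Multiset.cons_add]
    refine le_trans ?_ (Multiset.le_cons_self _ _)
    rw [add_comm _ (nodes W)]
    exact add_le_add le_rfl (Multiset.le_add_right _ _)
  have hnd3 := Multiset.Nodup.of_map _ hnd1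
  rw [inorder_join] at hnd3
  have hleaf : ((BinTree.leaf h).inorder : Multiset Node) = {h} := rfl
  rw [hleaf, Multiset.cons_add, Multiset.nodup_cons] at hnd3
  obtain ⟨hb, hnd4⟩ := hnd3
  have hh : h ∉ (O.inorder : Multiset Node) + nodes W := by
    rw [add_right_comm, add_comm, Multiset.singleton_add, Multiset.nodup_cons] at hnd4
    exact hnd4.1
  simp only [Multiset.mem_add, not_or] at hb hh
  have hfeet := feet_deco v O
  have hfoot : ∀ x ∉ (O.inorder : Multiset Node),
      x ∉ (deco v O).1.foot ∧ x ∉ feet (deco v O).2 := by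
    intro x hx
    rw [← hfeet, Multiset.mem_add, not_or] at hx
    exact hx
  -- The leaf `h` is larger than a leaf of `O`, so its path ends immediately at `b`. The pair forms
  -- a banana with empty trails, and `b` otherwise occurs only on top of the open path of `O`.
  have hjoin : deco v (.join d O b (.leaf h)) =
      ((deco v O).1.extend d.opp b, (⟨h, b, fun _ => []⟩ : Banana) ::ₘ (deco v O).2) := by
    have := deco_join v ⟨d, b, O⟩ (.leaf h) hlt.ne
    refine this.trans ((if_pos hlt).trans ?_)
    rw [Deco.turn, show (deco v (.leaf h)).2 = 0 from rfl, add_zero]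
    rfl
  have h1 : ((deco v O).1.extend d.opp b).erase b = (deco v O).1 := by
    rw [← OpenPath.erase_of_notMem (hfoot b hb.1.1).1]
    simp only [OpenPath.erase, OpenPath.extend, OpenPath.mk.injEq, true_and]
    funext d'
    split_ifs <;> simp
  have h2 : eraseBananas b h ((⟨h, b, fun _ => []⟩ : Banana) ::ₘ (deco v O).2) =
      (deco v O).2 := by
    conv_rhs => rw [← eraseBananas_of_notMem (hfoot b hb.1.1).2 (hfoot h hh.1).2]
    simp [eraseBananas]
  have hlow : ((deco v O).1.extend d.opp b).lower ≠ h := fun he =>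
    hh.1 (Multiset.mem_coe.mpr (he ▸ minLeaf_mem v O))
  obtain ⟨key, hkey⟩ := foldl_step_erase (v := v) (X := ((deco v O).1.extend d.opp b,
    (⟨h, b, fun _ => []⟩ : Banana) ::ₘ (deco v O).2)) hb.2 hh.2 hlow
  simp only [h1, h2] at key
  have key' : List.foldl (Deco.step v) (deco v O) W = _ := key
  rw [deco_build hnd1, deco_build hnd2, hjoin, key']
  exact eraseBananas_cons b h _ hkey

/-! ### The binary tree of an alternating sequence -/

/-- A sequence that continues a sequence with last minimum `a`, alternating between maxima and
minima. -/
def Zigzag (v : Node → ℝ) : Node → List Node → Prop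
  | _, [] => True
  | _, [_] => False
  | a, b :: a' :: L => v a < v b ∧ v a' < v b ∧ Zigzag v a' L

theorem lastLeaf_addRight (v : Node → ℝ) (b a : Node) (T : BinTree) :
    (T.addRight v b a).lastLeaf = a := by
  induction T with
  | leaf x => rfl
  | node l b' r _ ihr =>
    unfold BinTree.addRight
    split_ifs
    · exact ihr
    · rfl

/-- The next maximum exceeds the last leaf because the sequence is a zigzag, and differs from all
earlier values because these are distinct; this is what one insertion on the right requires. -/
theorem heapOrdered_addAll {v : Node → ℝ} {T : BinTree} {L : List Node} (hT : T.HeapOrdered v)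
    (hL : Zigzag v T.lastLeaf L) (hnd : ((T.inorder ++ L).map v).Nodup) :
    (T.addAll v L).HeapOrdered v ∧ (T.addAll v L).inorder = T.inorder ++ L := by
  induction hn : L.length using Nat.strong_induction_on generalizing T L with
  | _ n ih =>
  match L with
  | [] => exact ⟨hT, by simp [BinTree.addAll]⟩
  | [b] => exact hL.elim
  | b :: a :: L =>
    obtain ⟨h1, h2, h3⟩ := hL
    have hin := BinTree.inorder_addRight v b a T
    have hne : ∀ x ∈ T.inorder, v x ≠ v b := by
      intro x hx he
      rw [List.map_append, List.nodup_append] at hnd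
      exact hnd.2.2 (v x) (List.mem_map_of_mem hx) (v b) (by simp) he
    have := ih L.length (by simp only [← hn, List.length_cons]; omega)
      (BinTree.heapOrdered_addRight v b a T hT h1 h2 hne) (by rwa [lastLeaf_addRight])
      (by rw [hin]; simpa using hnd) rfl
    refine ⟨this.1, this.2.trans ?_⟩
    rw [hin]; simp

theorem binaryTree_spec {v : Node → ℝ} {a : Node} {L : List Node} (hL : Zigzag v a L)
    (hnd : ((a :: L).map v).Nodup) :
    (binaryTree v (a :: L)).HeapOrdered v ∧ (binaryTree v (a :: L)).inorder = a :: L :=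
  heapOrdered_addAll (T := .leaf a) trivial hL hnd

/-! ### The critical points of a list -/

theorem nodeValue_point (f : ℕ → ℝ) (s t i : ℕ) : nodeValue f (point s t i) = f i := by
  unfold point
  split_ifs <;> rfl

theorem point_real (s t i : ℕ) : (point s t i).IsReal := by
  unfold point
  split_ifs <;> trivial

/-- The homological critical points among the `n` positions from `i` on. -/
def crit (f : ℕ → ℝ) (s t i n : ℕ) : List Node :=
  ((List.range' i n).filter fun i => IsMinAt f s t i ∨ IsMaxAt f s t i).map (point s t)

theorem crit_add (f : ℕ → ℝ) (s t i n n' : ℕ) :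
    crit f s t i (n + n') = crit f s t i n ++ crit f s t (i + n) n' := by
  simp only [crit, ← List.range'_append_1, List.filter_append, List.map_append]

theorem crit_one_of {f : ℕ → ℝ} {s t i : ℕ} (h : IsMinAt f s t i ∨ IsMaxAt f s t i) :
    crit f s t i 1 = [point s t i] := by
  simp [crit, h]

theorem crit_one_of_not {f : ℕ → ℝ} {s t i : ℕ} (h : ¬ (IsMinAt f s t i ∨ IsMaxAt f s t i)) :
    crit f s t i 1 = [] := by
  simp [crit, h]

theorem crit_succ (f : ℕ → ℝ) (s t i n : ℕ) :
    crit f s t i (n + 1) = crit f s t i 1 ++ crit f s t (i + 1) n := by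
  rw [add_comm, crit_add]

theorem criticals_eq (c : ℕ → ℝ) (s t : ℕ) (ε : ℝ) :
    criticals c s t ε = crit (hookedMap c s t ε) s t (s - 1) (t + 3 - s) := rfl

theorem crit_congr {f g : ℕ → ℝ} {s t s' t' i n : ℕ}
    (h : ∀ j, i ≤ j → j < i + n → ((IsMinAt f s t j ∨ IsMaxAt f s t j) ↔
      (IsMinAt g s' t' j ∨ IsMaxAt g s' t' j)))
    (hp : ∀ j, i ≤ j → j < i + n → point s t j = point s' t' j) :
    crit f s t i n = crit g s' t' i n := by
  induction n generalizing i with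
  | zero => rfl
  | succ n ih =>
    rw [crit_succ, crit_succ g, ih]
    · congr 1
      have h1 := h i le_rfl (by omega)
      by_cases hc : IsMinAt f s t i ∨ IsMaxAt f s t i
      · rw [crit_one_of hc, crit_one_of (h1.mp hc), hp i le_rfl (by omega)]
      · rw [crit_one_of_not hc, crit_one_of_not (fun hg => hc (h1.mpr hg))]
    · exact fun j h1 h2 => h j (by omega) (by omega)
    · exact fun j h1 h2 => hp j (by omega) (by omega)

theorem crit_eq_nil {f : ℕ → ℝ} {s t i n : ℕ}
    (h : ∀ j, i ≤ j → j < i + n → ¬ (IsMinAt f s t j ∨ IsMaxAt f s t j)) :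
    crit f s t i n = [] := by
  rw [crit, List.filter_eq_nil_iff.mpr]
  · rfl
  · intro j hj
    rw [List.mem_range'_1] at hj
    simpa using h j hj.1 hj.2

/-- Backward induction from the last position. The direction in which the map enters position `k`
decides what comes next: when it rises, the last minimum `a` is still waiting for a maximum, or the
sequence ends; when it falls, a minimum of value at most `f k` must follow. The bounds on the values
carry the comparisons across non-critical positions. -/
theorem zigzag_crit {f : ℕ → ℝ} {s t : ℕ} (hs : 1 ≤ s)
    (hne : ∀ i, s - 1 ≤ i → i ≤ t → f i ≠ f (i + 1)) (n : ℕ) : ∀ k, k + n = t + 1 → s ≤ k →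
    (f (k - 1) < f k → ∀ a, nodeValue f a ≤ f (k - 1) →
      Zigzag (nodeValue f) a (crit f s t k (n + 1))) ∧
    (f k < f (k - 1) → ∃ a L, crit f s t k (n + 1) = a :: L ∧ nodeValue f a ≤ f k ∧
      Zigzag (nodeValue f) a L) := by
  induction n with
  | zero =>
    intro k hk hsk
    constructor
    · intro hlt a _
      rw [crit_one_of_not]
      · trivial
      · rintro (h | h)
        · exact (h.1 hsk).not_gt hlt
        · have := h.2.1; omega
    · intro hlt
      refine ⟨point s t k, [], crit_one_of (Or.inl ⟨fun _ => hlt, fun h => by omega⟩), ?_,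
        trivial⟩
      rw [nodeValue_point]
  | succ n ih =>
    intro k hk hsk
    have ih' := ih (k + 1) (by omega) (by omega)
    rw [Nat.add_sub_cancel] at ih'
    rw [crit_succ]
    rcases lt_or_gt_of_ne (hne k (by omega) (by omega)) with hup | hup
    · constructor
      · intro hlt a ha
        rw [crit_one_of_not]
        · exact ih'.1 hup a (ha.trans hlt.le)
        · rintro (h | h)
          · exact (h.1 hsk).not_gt hlt
          · exact h.2.2.2.not_gt hup
      · intro hlt
        refine ⟨point s t k, _, by rw [crit_one_of (Or.inl ⟨fun _ => hlt, fun _ => hup⟩)]; rfl,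
          (nodeValue_point f s t k).le, ih'.1 hup _ (nodeValue_point f s t k).le⟩
    · obtain ⟨a', L, hL, ha', hz⟩ := ih'.2 hup
      constructor
      · intro hlt a ha
        rw [crit_one_of (Or.inr ⟨hsk, by omega, hlt, hup⟩), hL]
        simp only [List.cons_append, List.nil_append, Zigzag, nodeValue_point]
        exact ⟨ha.trans_lt hlt, ha'.trans_lt hup, hz⟩
      · intro hlt
        refine ⟨a', L, ?_, ha'.trans hup.le, hz⟩
        rw [crit_one_of_not, hL]
        · rfl
        · rintro (h | h)
          · exact (h.2 (by omega)).not_gt hup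
          · exact h.2.2.1.not_gt hlt

theorem exists_zigzag_crit {f : ℕ → ℝ} {s t : ℕ} (hs : 1 ≤ s) (hst : s ≤ t + 1)
    (hne : ∀ i, s - 1 ≤ i → i ≤ t → f i ≠ f (i + 1)) :
    ∃ a L, crit f s t (s - 1) (t + 3 - s) = a :: L ∧ Zigzag (nodeValue f) a L := by
  obtain ⟨n, hn⟩ : ∃ n, s + n = t + 1 := ⟨t + 1 - s, by omega⟩
  have key := zigzag_crit hs hne n s hn le_rfl
  have hlen : t + 3 - s = (n + 1) + 1 := by omega
  rw [hlen, crit_succ, show s - 1 + 1 = s by omega]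
  have h0 := hne (s - 1) le_rfl (by omega)
  rw [show s - 1 + 1 = s by omega] at h0
  rcases lt_or_gt_of_ne h0 with h | h
  · refine ⟨point s t (s - 1), _, ?_, key.1 h _ (nodeValue_point f s t _).le⟩
    rw [crit_one_of]
    · rfl
    · refine Or.inl ⟨fun h => by omega, fun _ => ?_⟩
      rwa [show s - 1 + 1 = s by omega]
  · obtain ⟨a, L, h1, -, h2⟩ := key.2 h
    refine ⟨a, L, ?_, h2⟩
    rw [crit_one_of_not, h1]
    · rfl
    · rintro (h' | h')
      · have := h'.2 (by omega)
        rw [show s - 1 + 1 = s by omega] at this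
        exact this.not_gt h
      · have := h'.1; omega

/-! ### Hooks -/

/-- Distinct values with gaps larger than `ε`. -/
structure Gapped (c : ℕ → ℝ) (s t : ℕ) (ε : ℝ) : Prop where
  one_le : 1 ≤ s
  lt : s < t
  pos : 0 < ε
  gap : ∀ i, s ≤ i → i ≤ t → ∀ j, s ≤ j → j ≤ t → i ≠ j → ε < |c i - c j|

namespace Gapped

variable {c : ℕ → ℝ} {s t : ℕ} {ε : ℝ}

theorem ne (h : Gapped c s t ε) {i j : ℕ} (hi : s ≤ i) (hi' : i ≤ t) (hj : s ≤ j) (hj' : j ≤ t)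
    (hij : i ≠ j) : c i ≠ c j := by
  intro he
  have := h.gap i hi hi' j hj hj' hij
  rw [he, sub_self, abs_zero] at this
  exact this.not_gt h.pos

theorem item (c : ℕ → ℝ) (ε : ℝ) {i : ℕ} (hi : s ≤ i) (hi' : i ≤ t) :
    hookedMap c s t ε i = c i := by
  rw [hookedMap, if_neg (by omega), if_neg (by omega)]

theorem hook_left_of_lt (h : Gapped c s t ε) (hc : c s < c (s + 1)) :
    hookedMap c s t ε (s - 1) = c s + ε := by
  have := h.one_le
  rw [hookedMap, if_pos (by omega), sign_pos (sub_pos.mpr hc)]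
  simp

theorem hook_left_of_gt (h : Gapped c s t ε) (hc : c (s + 1) < c s) :
    hookedMap c s t ε (s - 1) = c s - ε := by
  have := h.one_le
  rw [hookedMap, if_pos (by omega), sign_neg (sub_neg.mpr hc)]
  simp [sub_eq_add_neg]

theorem hook_right_of_lt (h : Gapped c s t ε) (hc : c t < c (t - 1)) :
    hookedMap c s t ε (t + 1) = c t + ε := by
  have := h.lt
  rw [hookedMap, if_neg (by omega), if_pos (by omega), sign_pos (sub_pos.mpr hc)]
  simp

theorem hook_right_of_gt (h : Gapped c s t ε) (hc : c (t - 1) < c t) :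
    hookedMap c s t ε (t + 1) = c t - ε := by
  have := h.lt
  rw [hookedMap, if_neg (by omega), if_pos (by omega), sign_neg (sub_neg.mpr hc)]
  simp [sub_eq_add_neg]

theorem hookedMap_ne (h : Gapped c s t ε) : ∀ i, s - 1 ≤ i → i ≤ t →
    hookedMap c s t ε i ≠ hookedMap c s t ε (i + 1) := by
  intro i hi hi'
  have h1 := h.one_le
  have h2 := h.lt
  have h3 := h.pos
  by_cases hs : i = s - 1
  · subst hs
    rw [show s - 1 + 1 = s by omega, item c ε le_rfl h2.le]
    rcases lt_or_gt_of_ne (h.ne le_rfl h2.le (by omega) h2 (by omega : s ≠ s + 1)) with hc | hc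
    · rw [h.hook_left_of_lt hc]; linarith
    · rw [h.hook_left_of_gt hc]; linarith
  · by_cases ht : i = t
    · subst ht
      rw [item c ε h2.le le_rfl]
      rcases lt_or_gt_of_ne (h.ne h2.le le_rfl (j := i - 1) (by omega) (by omega) (by omega))
        with hc | hc
      · rw [h.hook_right_of_lt hc]; linarith
      · rw [h.hook_right_of_gt hc]; linarith
    · rw [item c ε (by omega) hi', item c ε (by omega) (by omega)]
      exact h.ne (by omega) hi' (by omega) (by omega) (by omega)

/-- The value at a critical point is that of an item, or a hook below its item. -/
theorem value_of_crit (h : Gapped c s t ε) {i : ℕ} (hi : s - 1 ≤ i) (hi' : i ≤ t + 1)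
    (hc : IsMinAt (hookedMap c s t ε) s t i ∨ IsMaxAt (hookedMap c s t ε) s t i) :
    (s ≤ i ∧ i ≤ t ∧ hookedMap c s t ε i = c i) ∨
      (i = s - 1 ∧ hookedMap c s t ε i = c s - ε) ∨
      (i = t + 1 ∧ hookedMap c s t ε i = c t - ε) := by
  have h1 := h.one_le
  have h2 := h.lt
  have h3 := h.pos
  by_cases hs : i = s - 1
  · subst hs
    refine Or.inr (Or.inl ⟨rfl, ?_⟩)
    rcases hc with hc | hc
    · have := hc.2 (by omega)
      rw [show s - 1 + 1 = s by omega, item c ε le_rfl h2.le] at this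
      rcases lt_or_gt_of_ne (h.ne le_rfl h2.le (by omega) h2 (by omega : s ≠ s + 1)) with hc | hc
      · rw [h.hook_left_of_lt hc] at this; linarith
      · exact h.hook_left_of_gt hc
    · have := hc.1; omega
  · by_cases ht : i = t + 1
    · subst ht
      refine Or.inr (Or.inr ⟨rfl, ?_⟩)
      rcases hc with hc | hc
      · have := hc.1 (by omega)
        rw [Nat.add_sub_cancel, item c ε h2.le le_rfl] at this
        rcases lt_or_gt_of_ne (h.ne h2.le le_rfl (j := t - 1) (by omega) (by omega) (by omega))
          with hc | hc
        · rw [h.hook_right_of_lt hc] at this; linarith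
        · exact h.hook_right_of_gt hc
      · have := hc.2.1; omega
    · exact Or.inl ⟨by omega, by omega, item c ε (by omega) (by omega)⟩

theorem nodup_values (h : Gapped c s t ε) :
    ((criticals c s t ε).map (nodeValue (hookedMap c s t ε))).Nodup := by
  have h1 := h.one_le
  have h2 := h.lt
  have h3 := h.pos
  rw [criticals, List.map_map]
  refine List.Nodup.map_on ?_ ((List.nodup_range' (step := 1)).filter _)
  intro i hi j hj hij
  simp only [Function.comp, nodeValue_point] at hij
  rw [List.mem_filter, List.mem_range'_1] at hi hj
  have hi' := h.value_of_crit hi.1.1 (by omega) (by simpa using hi.2)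
  have hj' := h.value_of_crit hj.1.1 (by omega) (by simpa using hj.2)
  by_contra hne
  -- A critical hook lies exactly `ε` below its item, whereas different items are strictly more than
  -- `ε` apart; so it cannot share its value with another item.
  have gap : ∀ {x y : ℕ}, s ≤ x → x ≤ t → s ≤ y → y ≤ t → x ≠ y → c x ≠ c y - ε := by
    intro x y hx hx' hy hy' hxy he
    have := h.gap x hx hx' y hy hy' hxy
    rw [he, show c y - ε - c y = -ε by ring, abs_neg, abs_of_pos h3] at this
    exact this.false
  have gap' : ∀ {x y : ℕ}, s ≤ x → x ≤ t → s ≤ y → y ≤ t → c x ≠ c y - ε := by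
    intro x y hx hx' hy hy' he
    by_cases hxy : x = y
    · subst hxy; linarith
    · exact gap hx hx' hy hy' hxy he
  rcases hi' with ⟨ha, ha', hi'⟩ | ⟨ha, hi'⟩ | ⟨ha, hi'⟩ <;>
  rcases hj' with ⟨hb, hb', hj'⟩ | ⟨hb, hj'⟩ | ⟨hb, hj'⟩ <;>
  rw [hi', hj'] at hij
  · exact h.ne ha ha' hb hb' hne hij
  · exact gap' ha ha' le_rfl h2.le hij
  · exact gap' ha ha' h2.le le_rfl hij
  · exact gap' hb hb' le_rfl h2.le hij.symm
  · omega
  · exact h.ne le_rfl h2.le h2.le le_rfl h2.ne (by linarith)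
  · exact gap' hb hb' h2.le le_rfl hij.symm
  · exact h.ne le_rfl h2.le h2.le le_rfl h2.ne (by linarith)
  · omega

theorem binaryTree_spec (h : Gapped c s t ε) :
    (binaryTree (nodeValue (hookedMap c s t ε)) (criticals c s t ε)).HeapOrdered
        (nodeValue (hookedMap c s t ε)) ∧
      (binaryTree (nodeValue (hookedMap c s t ε)) (criticals c s t ε)).inorder =
        criticals c s t ε := by
  obtain ⟨a, L, h1, h2⟩ := exists_zigzag_crit h.one_le (by have := h.lt; omega) h.hookedMap_ne
  have hnd := h.nodup_values
  rw [criticals_eq, h1] at hnd ⊢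
  exact BananaTree.binaryTree_spec h2 hnd

theorem real_of_mem_criticals {x : Node} (hx : x ∈ criticals c s t ε) : x.IsReal := by
  obtain ⟨i, -, rfl⟩ := List.mem_map.mp hx
  exact point_real s t i

end Gapped

/-! ### The critical points of two connected lists -/

section

variable {c : ℕ → ℝ} {ℓ m : ℕ} {ε : ℝ}

/-- The critical points of the map of `c 1, …, c m` that belong to one of the two parts. -/
def innerList (c : ℕ → ℝ) (ℓ m : ℕ) (ε : ℝ) : Side → List Node
  | .left => crit (hookedMap c 1 m ε) 1 m 0 (ℓ + 1)
  | .right => crit (hookedMap c 1 m ε) 1 m (ℓ + 1) (m + 1 - ℓ)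

/-- The critical points of the map of one of the two parts. -/
def partCriticals (c : ℕ → ℝ) (ℓ m : ℕ) (ε : ℝ) (d : Side) : List Node :=
  criticals c (firstItem ℓ d) (lastItem ℓ m d) ε

/-- The values of the map of one of the two parts. -/
def partValue (c : ℕ → ℝ) (ℓ m : ℕ) (ε : ℝ) (d : Side) : Node → ℝ :=
  nodeValue (hookedMap c (firstItem ℓ d) (lastItem ℓ m d) ε)

theorem criticals_eq_inner (hm : ℓ + 2 ≤ m) :
    criticals c 1 m ε = innerList c ℓ m ε .left ++ innerList c ℓ m ε .right := by
  rw [criticals_eq, show m + 3 - 1 = (ℓ + 1) + (m + 1 - ℓ) by omega, crit_add]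
  simp [innerList]

theorem hookedMap_left {i : ℕ} (hi : i ≤ ℓ) (hm : ℓ + 2 ≤ m) :
    hookedMap c 1 ℓ ε i = hookedMap c 1 m ε i := by
  unfold hookedMap
  split_ifs <;> first | rfl | omega

theorem hookedMap_right {i : ℕ} (hi : ℓ + 1 ≤ i) :
    hookedMap c (ℓ + 1) m ε i = hookedMap c 1 m ε i := by
  unfold hookedMap
  split_ifs <;> first | rfl | omega

/-- Criticality at `j` involves `j + 1`. Stopping before `ℓ` keeps away from position `ℓ + 1`, which
is a hook for the part but an item for the whole list. -/
theorem crit_left_eq (hℓ : 2 ≤ ℓ) (hm : ℓ + 2 ≤ m) {i n : ℕ} (hi : i + n ≤ ℓ) :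
    crit (hookedMap c 1 ℓ ε) 1 ℓ i n = crit (hookedMap c 1 m ε) 1 m i n := by
  refine crit_congr (fun j hj hj' => ?_) (fun j hj hj' => ?_)
  · have h1 : hookedMap c 1 ℓ ε j = hookedMap c 1 m ε j := hookedMap_left (by omega) hm
    have h2 : hookedMap c 1 ℓ ε (j - 1) = hookedMap c 1 m ε (j - 1) :=
      hookedMap_left (by omega) hm
    have h3 : hookedMap c 1 ℓ ε (j + 1) = hookedMap c 1 m ε (j + 1) :=
      hookedMap_left (by omega) hm
    have h4 : (j ≤ ℓ) = (j ≤ m) := by simp only [eq_iff_iff]; omega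
    simp only [IsMinAt, IsMaxAt, h1, h2, h3, h4]
  · have h4 : (j ≤ ℓ) = (j ≤ m) := by simp only [eq_iff_iff]; omega
    simp only [point, h4]

theorem crit_right_eq {i n : ℕ} (hi : ℓ + 2 ≤ i) :
    crit (hookedMap c (ℓ + 1) m ε) (ℓ + 1) m i n = crit (hookedMap c 1 m ε) 1 m i n := by
  refine crit_congr (fun j hj hj' => ?_) (fun j hj hj' => ?_)
  · have h1 : hookedMap c (ℓ + 1) m ε j = hookedMap c 1 m ε j := hookedMap_right (by omega)
    have h2 : hookedMap c (ℓ + 1) m ε (j - 1) = hookedMap c 1 m ε (j - 1) :=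
      hookedMap_right (by omega)
    have h3 : hookedMap c (ℓ + 1) m ε (j + 1) = hookedMap c 1 m ε (j + 1) :=
      hookedMap_right (by omega)
    have h4 : (ℓ + 1 ≤ j) = (1 ≤ j) := by simp only [eq_iff_iff]; omega
    simp only [IsMinAt, IsMaxAt, h1, h2, h3, h4]
  · have h4 : (ℓ + 1 ≤ j) = (1 ≤ j) := by simp only [eq_iff_iff]; omega
    simp only [point, h4]

theorem Gapped.left (h : Gapped c 1 m ε) (hℓ : 2 ≤ ℓ) (hm : ℓ + 2 ≤ m) : Gapped c 1 ℓ ε :=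
  ⟨le_rfl, by omega, h.pos, fun i hi hi' j hj hj' => h.gap i hi (by omega) j hj (by omega)⟩

theorem Gapped.right (h : Gapped c 1 m ε) (hm : ℓ + 2 ≤ m) : Gapped c (ℓ + 1) m ε :=
  ⟨by omega, by omega, h.pos, fun i hi hi' j hj hj' => h.gap i (by omega) hi' j (by omega) hj'⟩

theorem Gapped.part (h : Gapped c 1 m ε) (hℓ : 2 ≤ ℓ) (hm : ℓ + 2 ≤ m) (d : Side) :
    Gapped c (firstItem ℓ d) (lastItem ℓ m d) ε := by
  cases d
  · exact h.left hℓ hm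
  · exact h.right hm

theorem point_item {s t i : ℕ} (h : s ≤ i) (h' : i ≤ t) : point s t i = .item i :=
  if_pos ⟨h, h'⟩

theorem point_hook {s t i : ℕ} (h : ¬ (s ≤ i ∧ i ≤ t)) : point s t i = .hook i := if_neg h

/-- The end of the critical sequence of the left part. -/
theorem criticals_left (h : Gapped c 1 m ε) (hℓ : 2 ≤ ℓ) (hm : ℓ + 2 ≤ m) :
    criticals c 1 ℓ ε = crit (hookedMap c 1 m ε) 1 m 0 ℓ ++
      if c (ℓ - 1) < c ℓ then [.item ℓ, .hook (ℓ + 1)] else [.item ℓ] := by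
  have hg := h.left hℓ hm
  have hpos := h.pos
  have e1 : hookedMap c 1 ℓ ε ℓ = c ℓ := Gapped.item c ε (by omega) le_rfl
  have e2 : hookedMap c 1 ℓ ε (ℓ - 1) = c (ℓ - 1) := Gapped.item c ε (by omega) (by omega)
  rw [criticals_eq, show ℓ + 3 - 1 = ℓ + 1 + 1 by omega, crit_add, crit_add,
    crit_left_eq hℓ hm (by omega), List.append_assoc]
  simp only [Nat.sub_self, Nat.zero_add]
  congr 1
  split_ifs with hd
  · have e3 := hg.hook_right_of_gt hd
    rw [crit_one_of, crit_one_of, point_item (by omega) le_rfl, point_hook (by omega)]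
    · rfl
    · refine Or.inl ⟨fun _ => ?_, fun h => by omega⟩
      rw [Nat.add_sub_cancel, e1, e3]; linarith
    · refine Or.inr ⟨by omega, le_rfl, ?_, ?_⟩
      · rw [e1, e2]; exact hd
      · rw [e1, e3]; linarith
  · have hd' : c ℓ < c (ℓ - 1) := lt_of_le_of_ne (not_lt.mp hd)
      (hg.ne (by omega) le_rfl (by omega) (by omega) (by omega))
    have e3 := hg.hook_right_of_lt hd'
    rw [crit_one_of, crit_one_of_not, point_item (by omega) le_rfl]
    · rfl
    · rintro (h' | h')
      · have := h'.1 (by omega)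
        rw [Nat.add_sub_cancel, e1, e3] at this; linarith
      · have := h'.2.1; omega
    · refine Or.inl ⟨fun _ => ?_, fun _ => ?_⟩
      · rw [e1, e2]; exact hd'
      · rw [e1, e3]; linarith

/-- The beginning of the critical sequence of the right part. -/
theorem criticals_right (h : Gapped c 1 m ε) (hm : ℓ + 2 ≤ m) :
    criticals c (ℓ + 1) m ε =
      (if c (ℓ + 2) < c (ℓ + 1) then [.hook ℓ, .item (ℓ + 1)] else [.item (ℓ + 1)]) ++
        crit (hookedMap c 1 m ε) 1 m (ℓ + 2) (m - ℓ) := by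
  have hg := h.right hm
  have hpos := h.pos
  have e1 : hookedMap c (ℓ + 1) m ε (ℓ + 1) = c (ℓ + 1) := Gapped.item c ε le_rfl (by omega)
  have e2 : hookedMap c (ℓ + 1) m ε (ℓ + 2) = c (ℓ + 2) :=
    Gapped.item c ε (by omega) (by omega)
  rw [criticals_eq, show m + 3 - (ℓ + 1) = (m - ℓ) + 1 + 1 by omega, crit_succ, crit_succ _ _ _
    (ℓ + 1 - 1 + 1) (m - ℓ), Nat.add_sub_cancel, crit_right_eq (i := ℓ + 1 + 1) le_rfl,
    ← List.append_assoc]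
  congr 1
  split_ifs with hd
  · have e3 : hookedMap c (ℓ + 1) m ε ℓ = c (ℓ + 1) - ε := hg.hook_left_of_gt hd
    rw [crit_one_of, crit_one_of, point_item le_rfl (by omega), point_hook (by omega)]
    · rfl
    · refine Or.inr ⟨le_rfl, by omega, ?_, ?_⟩
      · rw [Nat.add_sub_cancel, e1, e3]; linarith
      · rw [show ℓ + 1 + 1 = ℓ + 2 from rfl, e1, e2]; exact hd
    · refine Or.inl ⟨fun h => by omega, fun _ => ?_⟩
      rw [e1, e3]; linarith
  · have hd' : c (ℓ + 1) < c (ℓ + 2) := lt_of_le_of_ne (not_lt.mp hd)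
      (hg.ne le_rfl (by omega) (by omega) (by omega) (by omega))
    have e3 : hookedMap c (ℓ + 1) m ε ℓ = c (ℓ + 1) + ε := hg.hook_left_of_lt hd'
    rw [crit_one_of_not, crit_one_of, point_item le_rfl (by omega)]
    · rfl
    · refine Or.inl ⟨fun _ => ?_, fun _ => ?_⟩
      · rw [Nat.add_sub_cancel, e1, e3]; linarith
      · rw [show ℓ + 1 + 1 = ℓ + 2 from rfl, e1, e2]; exact hd'
    · rintro (h' | h')
      · have := h'.2 (by omega)
        rw [e1, e3] at this; linarith
      · have := h'.1; omega

/-- In the whole list, `ℓ` is critical exactly when both neighbors lie on the same side of it in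
value: both below for a maximum, both above for a minimum. -/
theorem crit_end_left (h : Gapped c 1 m ε) (hℓ : 2 ≤ ℓ) (hm : ℓ + 2 ≤ m) :
    crit (hookedMap c 1 m ε) 1 m ℓ 1 =
      if (c (ℓ - 1) < c ℓ ↔ c (ℓ + 1) < c ℓ) then [.item ℓ] else [] := by
  have e1 : hookedMap c 1 m ε ℓ = c ℓ := Gapped.item c ε (by omega) (by omega)
  have e2 : hookedMap c 1 m ε (ℓ - 1) = c (ℓ - 1) := Gapped.item c ε (by omega) (by omega)
  have e3 : hookedMap c 1 m ε (ℓ + 1) = c (ℓ + 1) := Gapped.item c ε (by omega) (by omega)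
  have n1 := h.ne (i := ℓ - 1) (j := ℓ) (by omega) (by omega) (by omega) (by omega) (by omega)
  have n2 := h.ne (i := ℓ + 1) (j := ℓ) (by omega) (by omega) (by omega) (by omega) (by omega)
  have l1 : 1 ≤ ℓ := by omega
  have l2 : ℓ ≤ m := by omega
  rw [← point_item l1 l2]
  split_ifs with hd
  · refine crit_one_of ?_
    simp only [IsMinAt, IsMaxAt, e1, e2, e3, l1, l2, forall_const, true_and]
    rcases lt_or_gt_of_ne n1 with h1 | h1
    · exact Or.inr ⟨h1, hd.mp h1⟩
    · exact Or.inl ⟨h1, lt_of_le_of_ne (not_lt.mp fun h2 => (hd.mpr h2).not_gt h1) n2.symm⟩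
  · refine crit_one_of_not ?_
    simp only [IsMinAt, IsMaxAt, e1, e2, e3, l1, l2, forall_const, true_and]
    rintro (⟨h1, h2⟩ | ⟨h1, h2⟩)
    · exact hd ⟨fun h3 => absurd h1 h3.not_gt, fun h3 => absurd h2 h3.not_gt⟩
    · exact hd ⟨fun _ => h2, fun _ => h1⟩

theorem crit_end_right (h : Gapped c 1 m ε) (hℓ : 2 ≤ ℓ) (hm : ℓ + 2 ≤ m) :
    crit (hookedMap c 1 m ε) 1 m (ℓ + 1) 1 =
      if (c (ℓ + 2) < c (ℓ + 1) ↔ c ℓ < c (ℓ + 1)) then [.item (ℓ + 1)] else [] := by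
  have e1 : hookedMap c 1 m ε (ℓ + 1) = c (ℓ + 1) := Gapped.item c ε (by omega) (by omega)
  have e2 : hookedMap c 1 m ε (ℓ + 1 - 1) = c ℓ := Gapped.item c ε (by omega) (by omega)
  have e3 : hookedMap c 1 m ε (ℓ + 1 + 1) = c (ℓ + 2) := Gapped.item c ε (by omega) (by omega)
  have n1 := h.ne (i := ℓ) (j := ℓ + 1) (by omega) (by omega) (by omega) (by omega) (by omega)
  have n2 := h.ne (i := ℓ + 2) (j := ℓ + 1) (by omega) (by omega) (by omega) (by omega) (by omega)
  have l1 : 1 ≤ ℓ + 1 := by omega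
  have l2 : ℓ + 1 ≤ m := by omega
  rw [← point_item l1 l2]
  split_ifs with hd
  · refine crit_one_of ?_
    simp only [IsMinAt, IsMaxAt, e1, e2, e3, l1, l2, forall_const, true_and]
    rcases lt_or_gt_of_ne n1 with h1 | h1
    · exact Or.inr ⟨h1, hd.mpr h1⟩
    · exact Or.inl ⟨h1, lt_of_le_of_ne (not_lt.mp fun h2 => (hd.mp h2).not_gt h1) n2.symm⟩
  · refine crit_one_of_not ?_
    simp only [IsMinAt, IsMaxAt, e1, e2, e3, l1, l2, forall_const, true_and]
    rintro (⟨h1, h2⟩ | ⟨h1, h2⟩)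
    · exact hd ⟨fun h3 => absurd h2 h3.not_gt, fun h3 => absurd h1 h3.not_gt⟩
    · exact hd ⟨fun _ => h1, fun _ => h2⟩

theorem innerList_left (h : Gapped c 1 m ε) (hℓ : 2 ≤ ℓ) (hm : ℓ + 2 ≤ m) :
    innerList c ℓ m ε .left = crit (hookedMap c 1 m ε) 1 m 0 ℓ ++
      if (c (ℓ - 1) < c ℓ ↔ c (ℓ + 1) < c ℓ) then [.item ℓ] else [] := by
  rw [innerList, crit_add, Nat.zero_add, crit_end_left h hℓ hm]

theorem innerList_right (h : Gapped c 1 m ε) (hℓ : 2 ≤ ℓ) (hm : ℓ + 2 ≤ m) :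
    innerList c ℓ m ε .right =
      (if (c (ℓ + 2) < c (ℓ + 1) ↔ c ℓ < c (ℓ + 1)) then [.item (ℓ + 1)] else []) ++
        crit (hookedMap c 1 m ε) 1 m (ℓ + 2) (m - ℓ) := by
  rw [innerList, show m + 1 - ℓ = (m - ℓ) + 1 by omega, crit_succ, crit_end_right h hℓ hm]

theorem lowerPart_eq_left : lowerPart c ℓ = .left ↔ c ℓ < c (ℓ + 1) := by
  unfold lowerPart; split_ifs <;> simp_all

theorem lowerPart_eq_right (h : Gapped c 1 m ε) (hℓ : 2 ≤ ℓ) (hm : ℓ + 2 ≤ m) :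
    lowerPart c ℓ = .right ↔ c (ℓ + 1) < c ℓ := by
  have := h.ne (i := ℓ) (j := ℓ + 1) (by omega) (by omega) (by omega) (by omega) (by omega)
  unfold lowerPart
  split_ifs with hl
  · simp [hl.le]
  · simpa using lt_of_le_of_ne (not_lt.mp hl) this.symm

theorem lowerPart_lt (h : Gapped c 1 m ε) (hℓ : 2 ≤ ℓ) (hm : ℓ + 2 ≤ m) :
    c (endItem ℓ (lowerPart c ℓ)) < c (endItem ℓ (lowerPart c ℓ).opp) := by
  cases hd : lowerPart c ℓ
  · exact lowerPart_eq_left.mp hd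
  · exact (lowerPart_eq_right h hℓ hm).mp hd

/-- The new neighbor of the lower end item is higher. An up-type end item therefore stays a minimum,
while a down-type one was a maximum only because of its hook: both drop out. -/
theorem partCriticals_lower (h : Gapped c 1 m ε) (hℓ : 2 ≤ ℓ) (hm : ℓ + 2 ≤ m) :
    partCriticals c ℓ m ε (lowerPart c ℓ) =
      if IsDownType c ℓ (lowerPart c ℓ) then
        attach (lowerPart c ℓ) (innerList c ℓ m ε (lowerPart c ℓ))
          [.item (endItem ℓ (lowerPart c ℓ)), .hook (endHook ℓ (lowerPart c ℓ))]
      else innerList c ℓ m ε (lowerPart c ℓ) := by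
  cases hd : lowerPart c ℓ
  · have hlt := lowerPart_eq_left.mp hd
    rw [innerList_left h hℓ hm]
    refine (criticals_left h hℓ hm).trans ?_
    simp only [IsDownType, attach, endItem, endHook, iff_false, hlt.not_gt]
    split_ifs <;> simp
  · have hlt := (lowerPart_eq_right h hℓ hm).mp hd
    rw [innerList_right h hℓ hm]
    refine (criticals_right h hm).trans ?_
    simp only [IsDownType, attach, endItem, endHook, iff_false, hlt.not_gt]
    split_ifs <;> simp

/-- The new neighbor of the higher end item is lower. A down-type end item stays a maximum and loses
its hook, an up-type one ceases to be a minimum; in either case just one leaf is lost at the inner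
end. -/
theorem partCriticals_higher (h : Gapped c 1 m ε) (hℓ : 2 ≤ ℓ) (hm : ℓ + 2 ≤ m) :
    partCriticals c ℓ m ε (lowerPart c ℓ).opp =
      attach (lowerPart c ℓ).opp (innerList c ℓ m ε (lowerPart c ℓ).opp)
        [dummyLeaf c ℓ (lowerPart c ℓ).opp] := by
  cases hd : lowerPart c ℓ
  · have hlt := lowerPart_eq_left.mp hd
    simp only [Side.opp]
    rw [innerList_right h hℓ hm]
    refine (criticals_right h hm).trans ?_
    simp only [IsDownType, attach, endItem, endHook, dummyLeaf, iff_true, hlt]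
    split_ifs with hx <;> simp [hx]
  · have hlt := (lowerPart_eq_right h hℓ hm).mp hd
    simp only [Side.opp]
    rw [innerList_left h hℓ hm]
    refine (criticals_left h hℓ hm).trans ?_
    simp only [IsDownType, attach, endItem, endHook, dummyLeaf, iff_true, hlt]
    split_ifs with hx <;> simp [hx]

/-- A hook is only `ε` below the higher end item, and the gap to the lower end item exceeds `ε`. It
follows that the dummy leaf starts above `k`, as the first stage requires. -/
theorem value_dummyLeaf (h : Gapped c 1 m ε) (hℓ : 2 ≤ ℓ) (hm : ℓ + 2 ≤ m) :
    c (endItem ℓ (lowerPart c ℓ)) <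
      partValue c ℓ m ε (lowerPart c ℓ).opp (dummyLeaf c ℓ (lowerPart c ℓ).opp) := by
  have hlt := lowerPart_lt h hℓ hm
  have hgap : ε < c (endItem ℓ (lowerPart c ℓ).opp) - c (endItem ℓ (lowerPart c ℓ)) := by
    rw [← abs_of_pos (sub_pos.mpr hlt)]
    cases lowerPart c ℓ <;> simp only [endItem, Side.opp] <;>
      exact h.gap _ (by omega) (by omega) _ (by omega) (by omega) (by omega)
  have hpos := h.pos
  unfold dummyLeaf
  generalize (lowerPart c ℓ).opp = d at *
  split_ifs with hd <;> simp only [partValue, nodeValue]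
  · cases d
    · have := (h.left hℓ hm).hook_right_of_gt hd
      simp only [firstItem, lastItem, endHook, this]
      simp only [endItem] at hgap ⊢
      linarith
    · have : hookedMap c (ℓ + 1) m ε ℓ = c (ℓ + 1) - ε := (h.right hm).hook_left_of_gt hd
      simp only [firstItem, lastItem, endHook, this]
      simp only [endItem] at hgap ⊢
      linarith
  · rw [Gapped.item]
    · exact hlt
    · cases d <;> simp only [firstItem, endItem] <;> omega
    · cases d <;> simp only [lastItem, endItem] <;> omega

theorem partValue_inner (hm : ℓ + 2 ≤ m) (d : Side) :
    ∀ x ∈ innerList c ℓ m ε d, partValue c ℓ m ε d x = nodeValue (hookedMap c 1 m ε) x := by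
  intro x hx
  cases d <;>
  · obtain ⟨i, hi, rfl⟩ := List.mem_map.mp hx
    have hi := (List.mem_filter.mp hi).1
    rw [List.mem_range'_1] at hi
    simp only [partValue, nodeValue_point, firstItem, lastItem]
    first | exact hookedMap_left (by omega) hm | exact hookedMap_right (by omega)

/-- The values rise from the sought minimum up to `ℓ` and on to `ℓ + 1`: it is the start `j` of the
longest rising run ending at `ℓ`. Inside the run nothing is critical for the whole list, so `j` is
also its last critical point up to `ℓ`. -/
theorem closestMin_left (h : Gapped c 1 m ε) (hℓ : 2 ≤ ℓ) (hm : ℓ + 2 ≤ m)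
    (hlt : c ℓ < c (ℓ + 1)) : ∃ j X, closestMin c ℓ m ε .left = some j ∧
      innerList c ℓ m ε .left = X ++ [.item j] ∧ c j ≤ c ℓ ∧ 1 ≤ j ∧ j ≤ ℓ ∧
      (c (ℓ - 1) < c ℓ → j ≠ ℓ) := by
  have hg := h.left hℓ hm
  have hpos := h.pos
  have hex : ∃ j, 1 ≤ j ∧ ∀ i, j ≤ i → i < ℓ → c i < c (i + 1) :=
    ⟨ℓ, by omega, fun i hi hi' => by omega⟩
  classical
  obtain ⟨j, ⟨hj1, hchain⟩, hjmin⟩ : ∃ j, (1 ≤ j ∧ ∀ i, j ≤ i → i < ℓ → c i < c (i + 1)) ∧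
      ∀ j' < j, ¬ (1 ≤ j' ∧ ∀ i, j' ≤ i → i < ℓ → c i < c (i + 1)) :=
    ⟨Nat.find hex, Nat.find_spec hex, fun j' hj' => Nat.find_min hex hj'⟩
  have hjℓ : j ≤ ℓ := not_lt.mp fun hlt' =>
    hjmin ℓ hlt' ⟨by omega, fun i hi hi' => by omega⟩
  have item : ∀ i, 1 ≤ i → i ≤ m → hookedMap c 1 m ε i = c i :=
    fun i hi hi' => Gapped.item c ε hi hi'
  have item' : ∀ i, 1 ≤ i → i ≤ ℓ → hookedMap c 1 ℓ ε i = c i :=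
    fun i hi hi' => Gapped.item c ε hi hi'
  have hup : ∀ i, j ≤ i → i ≤ ℓ → c i < c (i + 1) := by
    intro i hi hi'
    rcases Nat.lt_or_ge i ℓ with h1 | h1
    · exact hchain i hi h1
    · obtain rfl : i = ℓ := by omega
      exact hlt
  have hprev : c j < hookedMap c 1 m ε (j - 1) := by
    rcases Nat.lt_or_ge 1 j with h1 | h1
    · rw [item _ (by omega) (by omega)]
      refine lt_of_le_of_ne (not_lt.mp fun h2 => hjmin (j - 1) (by omega) ⟨by omega, ?_⟩)
        (h.ne hj1 (by omega) (by omega) (by omega) (by omega))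
      intro i hi hi'
      rcases Nat.lt_or_ge i j with h3 | h3
      · obtain rfl : i = j - 1 := by omega
        rwa [show j - 1 + 1 = j by omega]
      · exact hchain i h3 hi'
    -- A run that starts at the first item is preceded by a hook above that item, so `1` is still a
    -- minimum.
    · obtain rfl : j = 1 := by omega
      have : hookedMap c 1 m ε (1 - 1) = c 1 + ε := h.hook_left_of_lt (hup 1 le_rfl hjℓ)
      rw [this]; linarith
  have hmin : IsMinAt (hookedMap c 1 m ε) 1 m j := by
    refine ⟨fun _ => ?_, fun _ => ?_⟩
    · rw [item j hj1 (by omega)]; exact hprev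
    · rw [item j hj1 (by omega), item (j + 1) (by omega) (by omega)]
      exact hup j le_rfl hjℓ
  have hmin' : IsMinAt (hookedMap c 1 ℓ ε) 1 ℓ j := by
    refine ⟨fun _ => ?_, fun _ => ?_⟩
    · rw [item' j hj1 hjℓ, hookedMap_left (by omega) hm]; exact hprev
    · rcases Nat.lt_or_ge j ℓ with h1 | h1
      · rw [item' j hj1 hjℓ, item' (j + 1) (by omega) (by omega)]
        exact hup j le_rfl hjℓ
      · obtain rfl : j = ℓ := by omega
        rw [item (j - 1) (by omega) (by omega)] at hprev
        rw [hg.hook_right_of_lt hprev, item' j hj1 hjℓ]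
        linarith
  have hno : ∀ i, j < i → i ≤ ℓ → c (i - 1) < c i := by
    intro i hi hi'
    have := hup (i - 1) (by omega) (by omega)
    rwa [show i - 1 + 1 = i by omega] at this
  refine ⟨j, crit (hookedMap c 1 m ε) 1 m 0 j, ?_, ?_, ?_, hj1, hjℓ, ?_⟩
  · change ((List.range' 1 (ℓ + 1 - 1)).filter
      fun i => IsMinAt (hookedMap c 1 ℓ ε) 1 ℓ i).getLast? = some j
    have hr : List.range' 1 (ℓ + 1 - 1) =
        List.range' 1 (j - 1) ++ ([j] ++ List.range' (j + 1) (ℓ - j)) := by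
      rw [show ℓ + 1 - 1 = (j - 1) + (1 + (ℓ - j)) by omega, ← List.range'_append_1,
        ← List.range'_append_1, show 1 + (j - 1) = j by omega]
      rfl
    have hnil : (List.range' (j + 1) (ℓ - j)).filter
        (fun i => IsMinAt (hookedMap c 1 ℓ ε) 1 ℓ i) = [] := by
      rw [List.filter_eq_nil_iff]
      intro i hi
      rw [List.mem_range'_1] at hi
      simp only [decide_eq_true_eq]
      intro hi'
      have := hi'.1 (by omega)
      rw [item' i (by omega) (by omega), item' (i - 1) (by omega) (by omega)] at this
      exact this.not_gt (hno i (by omega) (by omega))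
    rw [hr, List.filter_append, List.filter_append, hnil, List.append_nil]
    simp [hmin']
  · suffices hnil : crit (hookedMap c 1 m ε) 1 m (j + 1) (ℓ - j) = [] by
      rw [innerList, show ℓ + 1 = j + (1 + (ℓ - j)) by omega, crit_add, crit_add, Nat.zero_add,
        crit_one_of (Or.inl hmin), point_item hj1 (by omega), hnil, List.append_nil]
    refine crit_eq_nil ?_
    intro i hi hi'
    have h1 := hno i (by omega) (by omega)
    have h2 := hup i (by omega) (by omega)
    have e1 := item i (by omega) (by omega)
    have e2 := item (i - 1) (by omega) (by omega)
    have e3 := item (i + 1) (by omega) (by omega)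
    rintro (hc | hc)
    · have := hc.1 (by omega)
      rw [e1, e2] at this
      exact this.not_gt h1
    · have := hc.2.2.2
      rw [e1, e3] at this
      exact this.not_gt h2
  · have mono : ∀ n, j + n ≤ ℓ → c j ≤ c (j + n) := by
      intro n
      induction n with
      | zero => simp
      | succ n ih => exact fun hn => (ih (by omega)).trans (hup (j + n) (by omega) (by omega)).le
    have := mono (ℓ - j) (by omega)
    rwa [show j + (ℓ - j) = ℓ by omega] at this
  · rintro hd rfl
    rw [item (j - 1) (by omega) (by omega)] at hprev
    exact hprev.not_gt hd

theorem closestMin_right (h : Gapped c 1 m ε) (hℓ : 2 ≤ ℓ) (hm : ℓ + 2 ≤ m)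
    (hlt : c (ℓ + 1) < c ℓ) : ∃ j X, closestMin c ℓ m ε .right = some j ∧
      innerList c ℓ m ε .right = .item j :: X ∧ c j ≤ c (ℓ + 1) ∧ ℓ + 1 ≤ j ∧ j ≤ m ∧
      (c (ℓ + 2) < c (ℓ + 1) → j ≠ ℓ + 1) := by
  have hg := h.right hm
  have hpos := h.pos
  -- The farthest end of the falling run is sought here; counting from `m` turns it into a least
  -- `n`, with `j = m - n`.
  have hex : ∃ n, ℓ + 1 ≤ m - n ∧ ∀ i, ℓ < i → i < m - n → c (i + 1) < c i :=
    ⟨m - (ℓ + 1), by omega, fun i hi hi' => by omega⟩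
  classical
  obtain ⟨j, hj1, hjm, hchain, hjmax⟩ : ∃ j, ℓ + 1 ≤ j ∧ j ≤ m ∧
      (∀ i, ℓ < i → i < j → c (i + 1) < c i) ∧
      (j < m → ¬ ∀ i, ℓ < i → i < j + 1 → c (i + 1) < c i) := by
    have hspec := Nat.find_spec hex
    refine ⟨m - Nat.find hex, hspec.1, Nat.sub_le _ _, hspec.2, fun hj hall => ?_⟩
    refine Nat.find_min hex (m := Nat.find hex - 1) (by omega) ⟨by omega, fun i hi hi' => ?_⟩
    exact hall i hi (by omega)
  have item : ∀ i, 1 ≤ i → i ≤ m → hookedMap c 1 m ε i = c i :=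
    fun i hi hi' => Gapped.item c ε hi hi'
  have item' : ∀ i, ℓ + 1 ≤ i → i ≤ m → hookedMap c (ℓ + 1) m ε i = c i :=
    fun i hi hi' => Gapped.item c ε hi hi'
  have hdown : ∀ i, ℓ < i → i ≤ j → c i < c (i - 1) := by
    intro i hi hi'
    rcases Nat.lt_or_ge (ℓ + 1) i with h1 | h1
    · have := hchain (i - 1) (by omega) (by omega)
      rwa [show i - 1 + 1 = i by omega] at this
    · obtain rfl : i = ℓ + 1 := by omega
      exact hlt
  have hnext : c j < hookedMap c 1 m ε (j + 1) := by
    rcases Nat.lt_or_ge j m with h1 | h1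
    · rw [item _ (by omega) (by omega)]
      refine lt_of_le_of_ne (not_lt.mp fun h2 => hjmax h1 ?_)
        (h.ne (by omega) (by omega) (by omega) (by omega) (by omega))
      intro i hi hi'
      rcases Nat.lt_or_ge i j with h3 | h3
      · exact hchain i hi h3
      · obtain rfl : i = j := by omega
        exact h2
    · obtain rfl : j = m := by omega
      rw [h.hook_right_of_lt (hdown j hj1 le_rfl)]; linarith
  have hmin : IsMinAt (hookedMap c 1 m ε) 1 m j := by
    refine ⟨fun _ => ?_, fun _ => ?_⟩
    · rw [item j (by omega) hjm, item (j - 1) (by omega) (by omega)]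
      exact hdown j hj1 le_rfl
    · rw [item j (by omega) hjm]; exact hnext
  have hmin' : IsMinAt (hookedMap c (ℓ + 1) m ε) (ℓ + 1) m j := by
    refine ⟨fun _ => ?_, fun _ => ?_⟩
    · rcases Nat.lt_or_ge (ℓ + 1) j with h1 | h1
      · rw [item' j hj1 hjm, item' (j - 1) (by omega) (by omega)]
        exact hdown j hj1 le_rfl
      · obtain rfl : j = ℓ + 1 := by omega
        rw [item (ℓ + 1 + 1) (by omega) (by omega)] at hnext
        rw [hg.hook_left_of_lt hnext, item' (ℓ + 1) hj1 hjm]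
        linarith
    · rw [item' j hj1 hjm, hookedMap_right (by omega)]; exact hnext
  refine ⟨j, crit (hookedMap c 1 m ε) 1 m (j + 1) (m + 1 - j), ?_, ?_, ?_, hj1, hjm, ?_⟩
  · change ((List.range' (ℓ + 1) (m + 1 - (ℓ + 1))).filter
      fun i => IsMinAt (hookedMap c (ℓ + 1) m ε) (ℓ + 1) m i).head? = some j
    have hr : List.range' (ℓ + 1) (m + 1 - (ℓ + 1)) =
        List.range' (ℓ + 1) (j - (ℓ + 1)) ++ ([j] ++ List.range' (j + 1) (m - j)) := by
      rw [show m + 1 - (ℓ + 1) = (j - (ℓ + 1)) + (1 + (m - j)) by omega, ← List.range'_append_1,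
        ← List.range'_append_1, show ℓ + 1 + (j - (ℓ + 1)) = j by omega]
      rfl
    have hnil : (List.range' (ℓ + 1) (j - (ℓ + 1))).filter
        (fun i => IsMinAt (hookedMap c (ℓ + 1) m ε) (ℓ + 1) m i) = [] := by
      rw [List.filter_eq_nil_iff]
      intro i hi
      rw [List.mem_range'_1] at hi
      simp only [decide_eq_true_eq]
      intro hi'
      have := hi'.2 (by omega)
      rw [item' i (by omega) (by omega), item' (i + 1) (by omega) (by omega)] at this
      exact this.not_gt (hchain i (by omega) (by omega))
    rw [hr, List.filter_append, List.filter_append, hnil, List.nil_append]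
    simp [hmin']
  · rw [innerList, show m + 1 - ℓ = (j - (ℓ + 1)) + (1 + (m + 1 - j)) by omega, crit_add, crit_add,
      show ℓ + 1 + (j - (ℓ + 1)) = j by omega,
      crit_one_of (Or.inl hmin), point_item (by omega) (by omega), crit_eq_nil, List.nil_append]
    · rfl
    intro i hi hi'
    have h1 := hdown i (by omega) (by omega)
    have h2 := hchain i (by omega) (by omega)
    have e1 := item i (by omega) (by omega)
    have e2 := item (i - 1) (by omega) (by omega)
    have e3 := item (i + 1) (by omega) (by omega)
    rintro (hc | hc)
    · have := hc.2 (by omega)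
      rw [e1, e3] at this
      exact this.not_gt h2
    · have := hc.2.2.1
      rw [e1, e2] at this
      exact this.not_gt h1
  · have mono : ∀ n, ℓ + 1 + n ≤ j → c (ℓ + 1 + n) ≤ c (ℓ + 1) := by
      intro n
      induction n with
      | zero => simp
      | succ n ih =>
        exact fun hn => (hchain (ℓ + 1 + n) (by omega) (by omega)).le.trans (ih (by omega))
    have := mono (j - (ℓ + 1)) (by omega)
    rwa [show ℓ + 1 + (j - (ℓ + 1)) = j by omega] at this
  · rintro hd rfl
    rw [item (ℓ + 1 + 1) (by omega) (by omega)] at hnext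
    exact hnext.not_gt hd

/-- The minimum of the lower part that is closest to the connection. -/
theorem exists_closestMin (h : Gapped c 1 m ε) (hℓ : 2 ≤ ℓ) (hm : ℓ + 2 ≤ m) :
    ∃ j X, closestMin c ℓ m ε (lowerPart c ℓ) = some j ∧
      innerList c ℓ m ε (lowerPart c ℓ) = attach (lowerPart c ℓ) X [.item j] ∧
      c j ≤ c (endItem ℓ (lowerPart c ℓ)) ∧ firstItem ℓ (lowerPart c ℓ) ≤ j ∧
      j ≤ lastItem ℓ m (lowerPart c ℓ) ∧
      (IsDownType c ℓ (lowerPart c ℓ) → j ≠ endItem ℓ (lowerPart c ℓ)) := by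
  cases hd : lowerPart c ℓ
  · exact closestMin_left h hℓ hm (lowerPart_eq_left.mp hd)
  · exact closestMin_right h hℓ hm ((lowerPart_eq_right h hℓ hm).mp hd)

end

/-! ### Pre-processing -/

theorem BinTree.HeapOrdered.congr {v v' : Node → ℝ} {T : BinTree} (hT : T.HeapOrdered v)
    (h : ∀ x ∈ T.inorder, v x = v' x) : T.HeapOrdered v' := by
  induction T with
  | leaf a => trivial
  | node l b r ihl ihr =>
    simp only [BinTree.inorder, List.mem_append, List.mem_cons] at h
    obtain ⟨h1, h2, h3, h4⟩ := hT
    have hb := h b (by simp)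
    refine ⟨?_, ?_, ihl h3 fun x hx => h x (Or.inl hx),
      ihr h4 fun x hx => h x (Or.inr (Or.inr hx))⟩
    · rw [← hb, ← h _ (Or.inl l.top_mem_inorder)]; exact h1
    · rw [← hb, ← h _ (Or.inr (Or.inr r.top_mem_inorder))]; exact h2

theorem attach_pair (d : Side) (X : List Node) (b a : Node) :
    attach d X [b, a] = attach d (attach d X [b]) [a] := by
  cases d <;> simp [attach]

theorem coe_attach (d : Side) (X Y : List Node) :
    (attach d X Y : Multiset Node) = (X : Multiset Node) + (Y : Multiset Node) := by
  cases d
  · rfl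
  · rw [attach, ← Multiset.coe_add, Multiset.coe_reverse, add_comm]

theorem minLeaf_ne_of_nodup {v : Node → ℝ} {k : Node} {W : List Entry}
    (h : (((BinTree.leaf k).inorder + nodes W : Multiset Node).map v).Nodup) :
    ∀ e ∈ W, v (e.tree.minLeaf v) ≠ v k := by
  intro e he heq
  rw [Multiset.map_add] at h
  have hk : v k ∈ ((BinTree.leaf k).inorder : Multiset Node).map v := by simp [BinTree.inorder]
  refine Multiset.disjoint_left.mp (Multiset.nodup_add.mp h).2.2 hk ?_
  exact Multiset.mem_map.mpr ⟨_, mem_nodes.mpr ⟨e, he, Or.inr (minLeaf_mem _ _)⟩, heq⟩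

theorem coe_prepareLower_of_down {c : ℕ → ℝ} {ℓ : ℕ} {s : Side} (hd : IsDownType c ℓ s)
    (S : List Banana) : (prepareLower c ℓ s S : Multiset Banana) =
      eraseBananas (.item (endItem ℓ s)) (.hook (endHook ℓ s)) S := by
  rw [prepareLower, if_pos hd, eraseBananas, Multiset.filter_coe, Multiset.map_coe]
  rfl

theorem exists_build_eq (d : Side) (T : BinTree) :
    ∃ k W, build (.leaf k) W = T ∧ ∀ e ∈ W, e.side = d :=
  ⟨_, _, build_spine d T, side_spine d T⟩

/-- The innermost node of a tree that is built on one side. -/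
theorem mem_of_inorder_build_eq {d : Side} {O : BinTree} {W : List Entry}
    (h : ∀ e ∈ W, e.side = d) {X : List Node} {k : Node}
    (hk : (build O W).inorder = attach d X [k]) : k ∈ O.inorder := by
  obtain ⟨k', W', rfl, hside⟩ := exists_build_eq d O
  rw [← build_append, inorder_build_side (List.forall_mem_append.mpr ⟨hside, h⟩)] at hk
  obtain rfl : k' = k := by simpa using (attach_inj hk rfl).2
  rw [← Multiset.mem_coe, build_leaf_inorder]
  exact Multiset.mem_cons_self _ _

section

variable {c : ℕ → ℝ} {ℓ m : ℕ} {ε : ℝ}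

theorem coe_eq_of_perm_upTree {s t : ℕ} {β : Node} {S : List Banana}
    (hS : S.Perm (upTree c s t ε β)) :
    (S : Multiset Banana) =
      (deco (nodeValue (hookedMap c s t ε)) (binaryTree (nodeValue (hookedMap c s t ε))
        (criticals c s t ε))).1.close β ::ₘ
      (deco (nodeValue (hookedMap c s t ε)) (binaryTree (nodeValue (hookedMap c s t ε))
        (criticals c s t ε))).2 :=
  (Multiset.coe_eq_coe.mpr hS).trans rfl

/-- In the down-type case the end item is the innermost spine maximum and the hook is the leaf below
it. Deleting both leaves a heap-ordered tree on the remaining sequence, and `deco_build_erase` says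
that deletion in the up-tree has the same effect. -/
theorem exists_lower_tree (h : Gapped c 1 m ε) (hℓ : 2 ≤ ℓ) (hm : ℓ + 2 ≤ m) {s : Side}
    (hs : s = lowerPart c ℓ) {S : List Banana}
    (hS : S.Perm (upTree c (firstItem ℓ s) (lastItem ℓ m s) ε (.root s))) :
    ∃ T : BinTree, T.inorder = innerList c ℓ m ε s ∧
      T.HeapOrdered (nodeValue (hookedMap c 1 m ε)) ∧
      (prepareLower c ℓ s S : Multiset Banana) =
        (deco (nodeValue (hookedMap c 1 m ε)) T).1.close (.root s) ::ₘ
          (deco (nodeValue (hookedMap c 1 m ε)) T).2 := by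
  have hp := h.part hℓ hm s
  have hS := coe_eq_of_perm_upTree hS
  obtain ⟨hheap, hin⟩ := hp.binaryTree_spec
  have hnd := hp.nodup_values
  have hcrit : partCriticals c ℓ m ε s = _ := hs ▸ partCriticals_lower h hℓ hm
  have hval := partValue_inner (c := c) (ε := ε) hm s
  rw [← hin] at hnd
  change (binaryTree (partValue c ℓ m ε s) (partCriticals c ℓ m ε s)).HeapOrdered
    (partValue c ℓ m ε s) at hheap
  change (binaryTree (partValue c ℓ m ε s) (partCriticals c ℓ m ε s)).inorder =
    partCriticals c ℓ m ε s at hin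
  change ((binaryTree (partValue c ℓ m ε s) (partCriticals c ℓ m ε s)).inorder.map
    (partValue c ℓ m ε s)).Nodup at hnd
  change (S : Multiset Banana) = (deco (partValue c ℓ m ε s)
    (binaryTree (partValue c ℓ m ε s) (partCriticals c ℓ m ε s))).1.close (.root s) ::ₘ
    (deco (partValue c ℓ m ε s)
      (binaryTree (partValue c ℓ m ε s) (partCriticals c ℓ m ε s))).2 at hS
  generalize binaryTree (partValue c ℓ m ε s) (partCriticals c ℓ m ε s) = T at hheap hin hnd hS
  rw [hcrit] at hin
  by_cases hd : IsDownType c ℓ s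
  · rw [if_pos hd] at hin
    obtain ⟨k, W, rfl, hside⟩ := exists_build_eq s T
    rw [inorder_build_side hside, attach_pair] at hin
    obtain ⟨hin1, hin2⟩ := attach_inj hin rfl
    obtain rfl : k = .hook (endHook ℓ s) := by simpa using hin2
    -- An empty spine is excluded by the presence of at least the end item and its hook.
    cases W with
    | nil =>
      have := congrArg List.length hin1
      cases s <;> simp [outer, attach] at this
    | cons e W =>
      have hes := hside e (by simp)
      have hsideW : ∀ e' ∈ W, e'.side = s := fun e' he' => hside e' (by simp [he'])
      have hbuild : build (.leaf (.hook (endHook ℓ s))) (e :: W) =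
          build (.join s e.tree e.node (.leaf (.hook (endHook ℓ s)))) W := by
        rw [← hes]; rfl
      have hin3 := inorder_build_side hside (.hook (endHook ℓ s))
      rw [hin, ← attach_pair, hbuild, inorder_build_join hsideW] at hin3
      obtain ⟨hI, hb⟩ := attach_inj hin3 rfl
      have hnode : e.node = .item (endItem ℓ s) := by simpa using hb
      rw [heapOrdered_build] at hheap
      obtain ⟨-, hW, hsorted⟩ := hheap
      have he := hW e (by simp)
      rw [List.pairwise_cons] at hsorted
      have hheap' : (build e.tree W).HeapOrdered (partValue c ℓ m ε s) := by
        rw [heapOrdered_build]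
        refine ⟨he.2.1, fun e' he' => ?_, hsorted.2⟩
        have := hW e' (by simp [he'])
        exact ⟨this.1, this.2.1, he.1.trans (hsorted.1 e' he')⟩
      have hval' : ∀ x ∈ (build e.tree W).inorder,
          partValue c ℓ m ε s x = nodeValue (hookedMap c 1 m ε) x := by
        rw [hI]; exact hval
      refine ⟨_, hI, hheap'.congr hval', ?_⟩
      rw [← deco_congr hval', coe_prepareLower_of_down hd, hS, hbuild, hnode]
      refine deco_build_erase ?_ ?_ _
      · rw [← hnode, ← hbuild]; exact hnd
      -- That the hook is paired with the end item is witnessed by the closest minimum `j`: it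
      -- belongs to the subtree on the other side of the end item, and its distance from that item
      -- exceeds `ε`, so it is below the hook.
      · obtain ⟨j, X, -, hX, hle, hj1, hj2, hj3⟩ := exists_closestMin h hℓ hm
        rw [← hs] at hX hle hj1 hj2 hj3
        have hmem : Node.item j ∈ e.tree.inorder :=
          mem_of_inorder_build_eq hsideW (hI.trans hX)
        refine (minLeaf_le he.2.1 _ hmem).trans_lt ?_
        have e1 : partValue c ℓ m ε s (.item j) = c j := Gapped.item c ε hj1 hj2
        have e2 : partValue c ℓ m ε s (.hook (endHook ℓ s)) = c (endItem ℓ s) - ε := by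
          cases s
          · exact hp.hook_right_of_gt hd
          · exact hp.hook_left_of_gt hd
        have hend : firstItem ℓ s ≤ endItem ℓ s ∧ endItem ℓ s ≤ lastItem ℓ m s := by
          cases s <;> simp only [firstItem, endItem, lastItem] <;> omega
        have hgap := hp.gap j hj1 hj2 _ hend.1 hend.2 (hj3 hd)
        rw [abs_of_nonpos (by linarith)] at hgap
        rw [e1, e2]
        linarith
  · rw [if_neg hd] at hin
    have hval' : ∀ x ∈ T.inorder,
        partValue c ℓ m ε s x = nodeValue (hookedMap c 1 m ε) x := by
      rw [hin]; exact hval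
    refine ⟨T, hin, hheap.congr hval', ?_⟩
    rw [← deco_congr hval', prepareLower, if_neg hd]
    exact hS

/-- The replaced leaf is the innermost one, so the tree is a stack on top of it. Renaming the leaf
changes the lower end of a single banana; `near` and `far` are still determined by the value of the
old leaf. -/
theorem exists_higher_tree (h : Gapped c 1 m ε) (hℓ : 2 ≤ ℓ) (hm : ℓ + 2 ≤ m) {t : Side}
    (ht : t = (lowerPart c ℓ).opp) {S : List Banana}
    (hS : S.Perm (upTree c (firstItem ℓ t) (lastItem ℓ m t) ε (.root t))) :
    ∃ W : List Entry, (∀ e ∈ W, e.side = t) ∧ outer t W = innerList c ℓ m ε t ∧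
      (build (.leaf (dummyLeaf c ℓ t)) W).HeapOrdered (partValue c ℓ m ε t) ∧
      (modify S (dummyLeaf c ℓ t) fun B => { B with lower := .dummy } : Multiset Banana) =
        (dummyPath.addAll (near (partValue c ℓ m ε t) (dummyLeaf c ℓ t) W)).close
            (top t (far (partValue c ℓ m ε t) (dummyLeaf c ℓ t) W)) ::ₘ
          (hang (partValue c ℓ m ε t) (near (partValue c ℓ m ε t) (dummyLeaf c ℓ t) W) +
            rest (partValue c ℓ m ε t) t
              (far (partValue c ℓ m ε t) (dummyLeaf c ℓ t) W)) := by
  have hp := h.part hℓ hm t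
  have hS := coe_eq_of_perm_upTree hS
  obtain ⟨hheap, hin⟩ := hp.binaryTree_spec
  have hnd := hp.nodup_values
  have hcrit : partCriticals c ℓ m ε t = _ := ht ▸ partCriticals_higher h hℓ hm
  rw [← hin] at hnd
  change (binaryTree (partValue c ℓ m ε t) (partCriticals c ℓ m ε t)).HeapOrdered
    (partValue c ℓ m ε t) at hheap
  change (binaryTree (partValue c ℓ m ε t) (partCriticals c ℓ m ε t)).inorder =
    partCriticals c ℓ m ε t at hin
  change ((binaryTree (partValue c ℓ m ε t) (partCriticals c ℓ m ε t)).inorder.map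
    (partValue c ℓ m ε t)).Nodup at hnd
  change (S : Multiset Banana) = (deco (partValue c ℓ m ε t)
    (binaryTree (partValue c ℓ m ε t) (partCriticals c ℓ m ε t))).1.close (.root t) ::ₘ
    (deco (partValue c ℓ m ε t)
      (binaryTree (partValue c ℓ m ε t) (partCriticals c ℓ m ε t))).2 at hS
  generalize binaryTree (partValue c ℓ m ε t) (partCriticals c ℓ m ε t) = T at hheap hin hnd hS
  rw [hcrit] at hin
  obtain ⟨x, W, rfl, hside⟩ := exists_build_eq t T
  rw [inorder_build_side hside] at hin
  obtain ⟨hin1, hin2⟩ := attach_inj hin rfl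
  obtain rfl : x = dummyLeaf c ℓ t := by simpa using hin2
  have hnd' : (((BinTree.leaf (dummyLeaf c ℓ t)).inorder + nodes W : Multiset Node).map
      (partValue c ℓ m ε t)).Nodup := by
    rw [← inorder_build]; exact hnd
  have hfeet : (feet (S : Multiset Banana)).Nodup := by
    rw [hS, feet_cons, OpenPath.foot_close, feet_deco]
    exact Multiset.Nodup.of_map (s := ((_ : List Node) : Multiset Node)) _ hnd
  refine ⟨W, hside, hin1, hheap, ?_⟩
  rw [deco_build hnd', foldl_step_close] at hS
  · rw [hS] at hfeet
    have := modify_cons hS rfl (lower_ne_of_feet_nodup hfeet)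
      fun B => { B with lower := .dummy }
    refine this.trans ?_
    rw [show (deco (partValue c ℓ m ε t) (BinTree.leaf (dummyLeaf c ℓ t))).2 = 0 from rfl, zero_add]
    rfl
  · exact minLeaf_ne_of_nodup hnd'

end

/-! ### Correctness of gluing -/

/-- The first stage, in which nothing is merged yet. -/
theorem Frame.initial_stage {f : ℕ → ℝ} {k : Node} {W : Side → List Entry} (hF : Frame f k W)
    {s : Side} {B TB : List Entry} (hB : B ++ TB = W s.opp)
    (hk : ∀ e ∈ B, nodeValue f k < nodeValue f (e.tree.minLeaf (nodeValue f)))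
    {S S' : List Banana}
    (hS : (S : Multiset Banana) = (deco (nodeValue f) (build (.leaf k) (W s))).1.close (.root s) ::ₘ
      (deco (nodeValue f) (build (.leaf k) (W s))).2)
    (hS' : (S' : Multiset Banana) = (dummyPath.addAll B).close (top s.opp TB) ::ₘ
      (hang (nodeValue f) B + rest (nodeValue f) s.opp TB)) :
    Stage f k W (S ++ S' : List Banana) (S ++ S') s [] (near (nodeValue f) k (W s)) B
      (far (nodeValue f) k (W s)) TB ∧
    ∀ e ∈ (far (nodeValue f) k (W s)).head?,
      nodeValue f (e.tree.minLeaf (nodeValue f)) < nodeValue f k := by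
  have hnd : (((BinTree.leaf k).inorder + nodes (W s) : Multiset Node).map
      (nodeValue f)).Nodup := by
    refine Multiset.nodup_of_le (Multiset.map_le_map ?_) hF.nodup
    rw [← Frame.nodes_eq W s, ← Multiset.singleton_add, ← add_assoc]
    exact Multiset.le_add_right _ _
  have hne : ∀ e ∈ W s, nodeValue f (e.tree.minLeaf (nodeValue f)) ≠ nodeValue f k :=
    minLeaf_ne_of_nodup hnd
  have hleaf : deco (nodeValue f) (.leaf k) = (⟨k, fun _ => []⟩, 0) := rfl
  rw [deco_build hnd, foldl_step_close s _ hne, hleaf, zero_add] at hS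
  have hmem : (S ++ S' : List Banana) = (dummyPath.addAll B).close (top s.opp TB) ::ₘ
    ((deco (nodeValue f) (build (.leaf k) [])).1.addAll (near (nodeValue f) k (W s))).close
      (top s (far (nodeValue f) k (W s))) ::ₘ
      ((deco (nodeValue f) (build (.leaf k) [])).2 +
        hang (nodeValue f) (near (nodeValue f) k (W s)) + hang (nodeValue f) B +
        rest (nodeValue f) s (far (nodeValue f) k (W s)) + rest (nodeValue f) s.opp TB) := by
    rw [← Multiset.coe_add, hS, hS', show build (.leaf k) [] = .leaf k from rfl, hleaf, zero_add]
    simp only [Multiset.cons_add, Multiset.add_cons]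
    congr 2
    abel
  refine ⟨⟨?_, hB, .nil, by simp, ?_, hmem, ?_, ?_⟩, ?_⟩
  · rw [near_append_far]; rfl
  · intro e he
    rcases List.mem_append.mp he with he | he
    · exact lt_of_mem_near he
    · exact hk e he
  · rw [← Multiset.coe_add, hS]
    exact ((Multiset.le_add_left _ _).trans (Multiset.le_cons_self _ _)).trans
      (Multiset.le_add_right _ _)
  · rw [← Multiset.coe_add, hS']
    exact ((Multiset.le_add_left _ _).trans (Multiset.le_cons_self _ _)).trans
      (Multiset.le_add_left _ _)
  · intro e he
    refine lt_of_le_of_ne (le_of_mem_head_far he) (hne e ?_)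
    rw [← near_append_far (nodeValue f) k (W s)]
    exact List.mem_append_right _ (List.mem_of_mem_head? he)

section

variable {c : ℕ → ℝ} {ℓ m : ℕ} {ε : ℝ}

/-- After pre-processing, the invariant of the loop holds. -/
theorem exists_glueInit (h : Gapped c 1 m ε) (hℓ : 2 ≤ ℓ) (hm : ℓ + 2 ≤ m)
    {T : Side → List Banana}
    (hT : ∀ d, (T d).Perm (upTree c (firstItem ℓ d) (lastItem ℓ m d) ε (.root d))) :
    ∃ k W σ n, Frame (hookedMap c 1 m ε) k W ∧ glueInit c ℓ m ε T = some σ ∧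
      GlueInv (hookedMap c 1 m ε) k W σ.bananas σ n ∧
      (∀ d, ∀ e ∈ W d, e.tree.HeapOrdered (nodeValue (hookedMap c 1 m ε))) ∧
      outer .left (W .left) ++ [k] ++ outer .right (W .right) = criticals c 1 m ε := by
  obtain ⟨s, hs⟩ : ∃ s, s = lowerPart c ℓ := ⟨_, rfl⟩
  obtain ⟨T₀, hin, hheap, hS⟩ := exists_lower_tree h hℓ hm hs (hT s)
  obtain ⟨Wt, hsidet, houtt, hheapt, hS'⟩ :=
    exists_higher_tree h hℓ hm (t := s.opp) (by rw [hs]) (hT s.opp)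
  obtain ⟨j, X, hj, hX, hle, hj1, hj2, -⟩ := exists_closestMin h hℓ hm
  have hx := value_dummyLeaf h hℓ hm
  rw [← hs] at hj hX hle hj1 hj2 hx
  obtain ⟨k, Ws, rfl, hsides⟩ := exists_build_eq s T₀
  have hk := inorder_build_side hsides k
  rw [hin, hX] at hk
  obtain ⟨rfl, hjk⟩ := attach_inj hk rfl
  obtain rfl : Node.item j = k := by simpa using hjk
  set v := nodeValue (hookedMap c 1 m ε) with hv
  -- Two value functions are needed: the replaced leaf may be a hook, whose position is an item of
  -- the whole list with another value. On the entries `Wt` they agree.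
  set vt := partValue c ℓ m ε s.opp with hvt
  set x := dummyLeaf c ℓ s.opp with hxdef
  have hkc : v (.item j) = c j := by
    refine Gapped.item c ε ?_ ?_
    · refine le_trans ?_ hj1
      cases s <;> simp [firstItem]
    · refine hj2.trans ?_
      cases s <;> simp only [lastItem] <;> omega
  have hnodes : .item j ::ₘ nodes Ws = (innerList c ℓ m ε s : Multiset Node) := by
    rw [← hin, build_leaf_inorder]
  have hnodest : nodes Wt = (innerList c ℓ m ε s.opp : Multiset Node) := by
    have h1 := build_leaf_inorder x Wt
    rw [inorder_build_side hsidet, coe_attach, houtt, add_comm, Multiset.coe_singleton,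
      Multiset.singleton_add] at h1
    exact ((Multiset.cons_inj_right x).mp h1).symm
  have hval : ∀ y ∈ nodes Wt, vt y = v y := by
    rw [hnodest]; exact partValue_inner hm s.opp
  have hvale : ∀ e ∈ Wt, vt e.node = v e.node ∧ ∀ y ∈ e.tree.inorder, vt y = v y := fun e he =>
    ⟨hval _ (mem_nodes.mpr ⟨e, he, Or.inl rfl⟩),
      fun y hy => hval _ (mem_nodes.mpr ⟨e, he, Or.inr hy⟩)⟩
  rw [heapOrdered_build] at hheap hheapt
  have hkx : v (.item j) < vt x := by rw [hkc]; exact hle.trans_lt hx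
  let W : Side → List Entry := fun d => if d = s then Ws else Wt
  have hWs : W s = Ws := if_pos rfl
  have hWt : W s.opp = Wt := if_neg (Side.opp_ne s)
  have hW : ∀ d, (d = s ∧ W d = Ws) ∨ (d = s.opp ∧ W d = Wt) := by
    intro d
    rcases Side.eq_or_eq_opp s d with rfl | rfl
    · exact Or.inl ⟨rfl, hWs⟩
    · exact Or.inr ⟨rfl, hWt⟩
  have hall : .item j ::ₘ (nodes (W .left) + nodes (W .right)) =
      (criticals c 1 m ε : Multiset Node) := by
    rw [← Frame.nodes_eq W s, hWs, hWt, ← Multiset.cons_add, hnodes, hnodest,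
      criticals_eq_inner hm, ← Multiset.coe_add]
    cases s
    · rfl
    · exact add_comm _ _
  have hF : Frame (hookedMap c 1 m ε) (.item j) W := by
    refine ⟨?_, ?_, ?_, ?_, ?_, ?_⟩
    · intro d
      rcases hW d with ⟨rfl, hd⟩ | ⟨rfl, hd⟩ <;> rw [hd]
      · exact hsides
      · exact hsidet
    · intro y hy
      rw [hall] at hy
      exact Gapped.real_of_mem_criticals hy
    · rw [hall]
      exact h.nodup_values
    · intro d
      rcases hW d with ⟨rfl, hd⟩ | ⟨rfl, hd⟩ <;> rw [hd]
      · exact hheap.2.2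
      · refine hheapt.2.2.imp_of_mem fun {a b} ha hb hab => ?_
        rwa [(hvale a ha).1, (hvale b hb).1] at hab
    · intro d
      rcases hW d with ⟨rfl, hd⟩ | ⟨rfl, hd⟩ <;> rw [hd]
      · exact fun e he y hy => ((hheap.2.1 e he).2.1.le hy).trans_lt (hheap.2.1 e he).1
      · intro e he y hy
        have := ((hheapt.2.1 e he).2.1.le hy).trans_lt (hheapt.2.1 e he).1
        rwa [(hvale e he).1, (hvale e he).2 y hy] at this
    · intro d
      rcases hW d with ⟨rfl, hd⟩ | ⟨rfl, hd⟩ <;> rw [hd]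
      · exact fun e he => (hheap.2.1 e he).2.2
      · intro e he
        have := hkx.trans (hheapt.2.1 e he).2.2
        rwa [(hvale e he).1] at this
  have hsplit := near_append_far vt x Wt
  have hcongr : (modify (T s.opp) x fun B => { B with lower := .dummy } : Multiset Banana) =
      (dummyPath.addAll (near vt x Wt)).close (top s.opp (far vt x Wt)) ::ₘ
        (hang v (near vt x Wt) + rest v s.opp (far vt x Wt)) := by
    rw [hS', hang_congr (v' := v), rest_congr (v' := v)]
    · intro y hy
      refine hval y ?_
      rw [← hsplit, nodes_append]
      exact Multiset.mem_add.mpr (Or.inr hy)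
    · intro y hy
      refine hval y ?_
      rw [← hsplit, nodes_append]
      exact Multiset.mem_add.mpr (Or.inl hy)
  -- The entries passed by the dummy path have minima above the replaced leaf `x`, and `x` is above
  -- `k`; this yields `passed` for `U = []`.
  obtain ⟨hstage, hhead⟩ := hF.initial_stage (s := s) (hsplit.trans hWt.symm) (fun e he => by
    have he' : e ∈ Wt := by rw [← hsplit]; exact List.mem_append_left _ he
    exact (hkx.trans (lt_of_mem_near he)).trans_eq (minLeaf_congr (hvale e he').2))
    (by rw [hWs]; exact hS) hcongr
  have hdth : dth _ (.item j) = some (top s (far v (.item j) (W s))) :=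
    dth_lower (hstage.feet_nodup hF) hstage.coreBanana_mem
  have hdth' : dth _ .dummy = some (top s.opp (far vt x Wt)) :=
    dth_lower (hstage.feet_nodup hF) hstage.dummyBanana_mem
  refine ⟨.item j, W, ⟨prepareLower c ℓ s (T s) ++ modify (T s.opp) x fun B =>
    { B with lower := .dummy }, vt x, fun d => if d = s then top s (far v (.item j) (W s))
      else top s.opp (far vt x Wt)⟩, _, hF, ?_,
    ⟨s, [], _, _, _, _, hstage, hhead, if_pos rfl, if_neg (Side.opp_ne s), rfl⟩, ?_, ?_⟩
  · rw [glueInit, ← hs]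
    simp only [hj, ← hxdef, hdth, hdth', Option.bind_eq_bind, Option.bind_some, Option.pure_def]
    rfl
  · intro d
    rcases hW d with ⟨rfl, hd⟩ | ⟨rfl, hd⟩ <;> rw [hd]
    · exact fun e he => (hheap.2.1 e he).2.1
    · exact fun e he => (hheapt.2.1 e he).2.1.congr (hvale e he).2
  · rw [criticals_eq_inner hm]
    cases s
    · change outer .left Ws ++ [Node.item j] ++ outer .right Wt = _
      rw [hX]; exact congrArg _ houtt
    · change outer .left Wt ++ [Node.item j] ++ outer .right Ws = _
      rw [hX, List.append_assoc]; exact congrArg₂ _ houtt rfl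

end

end BananaTree

end
open BananaTree in
theorem theoremB6 (c : ℕ → ℝ) (ℓ m : ℕ) (hℓ : 2 ≤ ℓ) (hm : ℓ + 2 ≤ m)
    (hc : Set.InjOn c (Set.Icc 1 m)) (ε : ℝ) (hε : 0 < ε)
    (hgap : ∀ i ∈ Set.Icc 1 m, ∀ j ∈ Set.Icc 1 m, i ≠ j → ε < |c i - c j|)
    (T : Side → List Banana)
    (hg : (T .left).Perm (upTree c 1 ℓ ε (.root .left)))
    (hh : (T .right).Perm (upTree c (ℓ + 1) m ε (.root .right))) :
    ∃ (N : ℕ) (run : ℕ → GlueState),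
      IsGlueRun c ℓ m ε T N run ∧
      (∀ i < N, ∀ s : Side,
        InSpine (run 0).bananas (.root s) s.opp ((run i).cur s) ∧
        InSpine (run i).bananas (.root s) s.opp ((run i).cur s)) ∧
      ((run N).result).Perm (upTree c 1 m ε (.root (run N).survivor)) := by
  have h : Gapped c 1 m ε := ⟨le_rfl, by omega, hε, fun i hi hi' j hj hj' =>
    hgap i ⟨hi, hi'⟩ j ⟨hj, hj'⟩⟩
  obtain ⟨k, W, σ, n, hF, hinit, hinv, htree, hout⟩ := exists_glueInit h hℓ hm (T := T) fun d => by
    cases d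
    · exact hg
    · exact hh
  obtain ⟨N, run, rfl, hN, hstep, hcont, hempty, hrun⟩ := hinv.exists_run hF ε
  refine ⟨N, run, ⟨hinit, hN, hstep, hcont, hempty⟩, fun i hi s => ?_, ?_⟩
  · obtain ⟨n', hi'⟩ := hrun i hi.le
    exact hi'.inSpine hF s
  · obtain ⟨n', hN'⟩ := hrun N le_rfl
    obtain ⟨U, hU, hsorted, hres⟩ := hN'.result_eq hF hempty
    obtain ⟨hheap, hin⟩ := h.binaryTree_spec
    have hmem : ∀ e ∈ U, e ∈ W e.side := fun e he => by
      rw [← hU]; simp [he]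
    -- The sorted merge `U` gives a heap-ordered tree, and its two sides are those of `W`, so its
    -- in-order sequence is the critical sequence of the whole list. Uniqueness identifies it with
    -- the binary tree from which the up-tree is built.
    have key : build (.leaf k) U = binaryTree (nodeValue (hookedMap c 1 m ε))
        (criticals c 1 m ε) := by
      refine BinTree.HeapOrdered.unique ?_ hheap ?_
      · rw [heapOrdered_build]
        refine ⟨trivial, fun e he => ⟨?_, ?_, hF.leaf _ e (hmem e he)⟩, hsorted⟩
        · exact hF.heap _ e (hmem e he) _ e.tree.top_mem_inorder
        · exact htree _ e (hmem e he)
      · rw [hin, inorder_build_eq, ← outer_filter .left, ← outer_filter .right, hU, hU]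
        exact hout
    rw [← Multiset.coe_eq_coe, hres, key]
    rfl
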